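/- Let $n\ge 2$, $p,d\ge 1$, $r=pd$. Let $F$ be a field, $\zeta\in F$ a primitive $p$th root of unity, $q\in F\setminus\{0,1\}$ of multiplicative order $e\in\mathbb N_{\ge2}\cup\{\infty\}$; put $I=\mathbb Z/e\mathbb Z$ ($I=\mathbb Z$ if $e=\infty$) and $J=\mathbb Z/p\mathbb Z$. Let $\Lambda=(\Lambda_{i,j})_{(i,j)\in I\times J}$ be a finitely supported family of non-negative integers with $\sum_{i,j}\Lambda_{i,j}=r$ such that $\Lambda_{i,j}=:\Lambda_i$ does not depend on $j$. Let $H_n^\Lambda(q,\zeta)$ be the unital associative $F$-algebra generated by $S,T_1,\dots,T_{n-1}$ with relations $\prod_{i\in I,\,j\in J}(S-\zeta^jq^i)^{\Lambda_{i,j}}=0$, $(T_a+1)(T_a-q)=0$, $ST_1ST_1=T_1ST_1S$, $ST_a=T_aS$ for $a>1$, $T_aT_b=T_bT_a$ for $|a-b|>1$, $T_aT_{a+1}T_a=T_{a+1}T_aT_{a+1}$. Put $X_1=S$ and $qX_{a+1}=T_aX_aT_a$ for $1\le a\le n-1$. For $w\in\mathfrak S_n$ put $T_w=T_{a_1}\cdots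 T_{a_m}$, where $w=s_{a_1}\cdots s_{a_m}$ is any reduced expression in the transpositions $s_a=(a,a+1)$. Let $H_{p,n}^\Lambda(q)$ be the unital associative $F$-algebra generated by $s,t'_1,t_1,\dots,t_{n-1}$ with relations (each imposed whenever the generators involved exist) $\prod_{i\in I}(s-q^{pi})^{\Lambda_i}=0$, $(t'_1+1)(t'_1-q)=(t_a+1)(t_a-q)=0$, $t'_1t_2t'_1=t_2t'_1t_2$, $t_at_{a+1}t_a=t_{a+1}t_at_{a+1}$, $(t'_1t_1t_2)^2=(t_2t'_1t_1)^2$, $t'_1t_a=t_at'_1$ for $a\ge3$, $t_at_b=t_bt_a$ for $|a-b|>1$, $st_a=t_as$ for $a\ge2$, $st'_1t_1=t'_1t_1s$, and $$\underbrace{s\,t'_1t_1t'_1t_1\cdots}_{p+1\text{ factors}}=\underbrace{t_1s\,t'_1t_1t'_1\cdots}_{p+1\text{ factors}}.$$ Then $S$ is invertible in $H_n^\Lambda(q,\zeta)$. There is an algebra automorphism $\sigma$ of $H_n^\Lambda(q,\zeta)$ (the shift automorphism) with $\sigma(S)=\zeta S$ and $\sigma(T_a)=T_a$ for all $a$. There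 is an algebra homomorphism $\phi:H_{p,n}^\Lambda(q)\to H_n^\Lambda(q,\zeta)$ with $\phi(s)=S^p$, $\phi(t'_1)=S^{-1}T_1S$ and $\phi(t_a)=T_a$ for all $a$. The map $\phi$ is injective and its image is exactly the fixed-point subalgebra $H_n^\Lambda(q,\zeta)^\sigma$, so that $H_{p,n}^\Lambda(q)\cong H_n^\Lambda(q,\zeta)^\sigma$ via $\phi$. Moreover, for any choice of reduced expressions, the elements $X_1^{m_1}\cdots X_n^{m_n}T_w$ with $0\le m_a\le r-1$ and $w\in\mathfrak S_n$ form an $F$-basis of $H_n^\Lambda(q,\zeta)$, and those among them with $m_1+\cdots+m_n\equiv0\pmod p$ span $H_n^\Lambda(q,\zeta)^\sigma$ (and hence form a basis of it). -/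

import Mathlib

open Polynomial

noncomputable section

namespace CycHecke

/-- Weights on `I × J`, where `I = ℤ/eℤ` with `e` the multiplicative order of `q`
(`I = ℤ` if this order is infinite: then `orderOf q = 0` and `ZMod 0 = ℤ`) and `J = ℤ/pℤ`. -/
abbrev Weight {F : Type*} [Field F] (p : ℕ) (q : F) : Type :=
  (ZMod (orderOf q) × ZMod p) →₀ ℕ

/-- Weights on `I`. -/
abbrev WeightI {F : Type*} [Field F] (q : F) : Type :=
  ZMod (orderOf q) →₀ ℕ

/-- For `x` with `x ^ m = 1`, the power `x ^ i` for `i ∈ ℤ/mℤ` (`i ∈ ℤ` if `m = 0`),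
computed on an integer representative of `i`. -/
def zmodPow {F : Type*} [Field F] {m : ℕ} (x : F) (i : ZMod m) : F :=
  x ^ (i.cast : ℤ)

/-- The generators `S, T_1, …, T_{n-1}`; the constructor `T a` with `a = 0, …, n-2`
stands for `T_{a+1}`. -/
inductive AKGen (n : ℕ) : Type
  | S : AKGen n
  | T (a : Fin (n - 1)) : AKGen n

/-- The generators `s, t'_1, t_1, …, t_{n-1}`; the constructor `t a` with `a = 0, …, n-2`
stands for `t_{a+1}`. -/
inductive GGen (n : ℕ) : Type
  | s : GGen n
  | t' : GGen n
  | t (a : Fin (n - 1)) : GGen n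

section Algebras

variable {F : Type*} [Field F]

/-- The polynomial `∏_{i,j} (X - ζ^j q^i)^{Λ_{i,j}}`. -/
def akPoly (p : ℕ) (q ζ : F) (Λ : Weight p q) : F[X] :=
  Λ.prod fun ij m => (X - C (zmodPow ζ ij.2 * zmodPow q ij.1)) ^ m

/-- The polynomial `∏_i (X - q^{pi})^{Λ_i}`. -/
def gPoly (p : ℕ) (q : F) (lam : WeightI q) : F[X] :=
  lam.prod fun i m => (X - C (zmodPow q i ^ p)) ^ m

/-- The free generator `S`. -/
def fS (F : Type*) [Field F] (n : ℕ) : FreeAlgebra F (AKGen n) := FreeAlgebra.ι F AKGen.S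

/-- The free generators `T_{a+1}`. -/
def fT (F : Type*) [Field F] {n : ℕ} (a : Fin (n - 1)) : FreeAlgebra F (AKGen n) :=
  FreeAlgebra.ι F (AKGen.T a)

/-- The defining relations of the Ariki--Koike algebra (type `G(r,1,n)`). -/
inductive AKRel (n p : ℕ) (q ζ : F) (Λ : Weight p q) :
    FreeAlgebra F (AKGen n) → FreeAlgebra F (AKGen n) → Prop
  | cyclo : AKRel n p q ζ Λ (aeval (fS F n) (akPoly p q ζ Λ)) 0
  | quad (a : Fin (n - 1)) :
      AKRel n p q ζ Λ ((fT F a + 1) * (fT F a - algebraMap F _ q)) 0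
  | braidS (a : Fin (n - 1)) (ha : a.val = 0) :
      AKRel n p q ζ Λ (fS F n * fT F a * fS F n * fT F a) (fT F a * fS F n * fT F a * fS F n)
  | commS (a : Fin (n - 1)) (ha : 0 < a.val) :
      AKRel n p q ζ Λ (fS F n * fT F a) (fT F a * fS F n)
  | comm (a b : Fin (n - 1)) (hab : a.val + 1 < b.val ∨ b.val + 1 < a.val) :
      AKRel n p q ζ Λ (fT F a * fT F b) (fT F b * fT F a)
  | braid (a b : Fin (n - 1)) (hab : a.val + 1 = b.val) :
      AKRel n p q ζ Λ (fT F a * fT F b * fT F a) (fT F b * fT F a * fT F b)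

/-- The Ariki--Koike algebra `H_n^Λ(q, ζ)`. -/
abbrev AK (n p : ℕ) (q ζ : F) (Λ : Weight p q) : Type _ :=
  RingQuot (AKRel n p q ζ Λ)

/-- The generator `S` of `H_n^Λ(q, ζ)`. -/
def AK.S (n p : ℕ) (q ζ : F) (Λ : Weight p q) : AK n p q ζ Λ :=
  RingQuot.mkAlgHom F (AKRel n p q ζ Λ) (fS F n)

/-- The generator `T_{a+1}` of `H_n^Λ(q, ζ)`. -/
def AK.T (n p : ℕ) (q ζ : F) (Λ : Weight p q) (a : Fin (n - 1)) : AK n p q ζ Λ :=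
  RingQuot.mkAlgHom F (AKRel n p q ζ Λ) (fT F a)

/-- `AK.X n p q ζ Λ k` is the element `X_{k+1}`, for `k = 0, …, n-1`: `X_1 = S` and
`q X_{a+1} = T_a X_a T_a`. (The value for `k ≥ n` is irrelevant.) -/
def AK.X (n p : ℕ) (q ζ : F) (Λ : Weight p q) : ℕ → AK n p q ζ Λ
  | 0 => AK.S n p q ζ Λ
  | k + 1 =>
    if h : k < n - 1 then
      q⁻¹ • (AK.T n p q ζ Λ ⟨k, h⟩ * AK.X n p q ζ Λ k * AK.T n p q ζ Λ ⟨k, h⟩)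
    else 0

/-- The product `T_{a_1} ⋯ T_{a_m}` for a word `(a_1, …, a_m)`. -/
def AK.Tword (n p : ℕ) (q ζ : F) (Λ : Weight p q) (l : List (Fin (n - 1))) : AK n p q ζ Λ :=
  (l.map (AK.T n p q ζ Λ)).prod

/-- The element `X_1^{m_1} ⋯ X_n^{m_n} T_{a_1} ⋯ T_{a_k}` for exponents `m` and a word
`(a_1, …, a_k)`. -/
def AK.monomial (n p : ℕ) (q ζ : F) (Λ : Weight p q) (m : Fin n → ℕ)
    (l : List (Fin (n - 1))) : AK n p q ζ Λ :=
  (List.ofFn fun a : Fin n => AK.X n p q ζ Λ a.val ^ m a).prod * AK.Tword n p q ζ Λ l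

/-- The alternating product `a b a b ⋯` with `k` factors. -/
def altProd {A : Type*} [Monoid A] (a b : A) : ℕ → A
  | 0 => 1
  | k + 1 => a * altProd b a k

/-- The free generator `s`. -/
def fs (F : Type*) [Field F] (n : ℕ) : FreeAlgebra F (GGen n) := FreeAlgebra.ι F GGen.s

/-- The free generator `t'_1`. -/
def ft' (F : Type*) [Field F] (n : ℕ) : FreeAlgebra F (GGen n) := FreeAlgebra.ι F GGen.t'

/-- The free generators `t_{a+1}`. -/
def ft (F : Type*) [Field F] {n : ℕ} (a : Fin (n - 1)) : FreeAlgebra F (GGen n) :=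
  FreeAlgebra.ι F (GGen.t a)

/-- The defining relations of the cyclotomic Hecke algebra of type `G(r,p,n)`. -/
inductive GRel (n p : ℕ) (q : F) (lam : WeightI q) :
    FreeAlgebra F (GGen n) → FreeAlgebra F (GGen n) → Prop
  | cyclo : GRel n p q lam (aeval (fs F n) (gPoly p q lam)) 0
  | quad' : GRel n p q lam ((ft' F n + 1) * (ft' F n - algebraMap F _ q)) 0
  | quad (a : Fin (n - 1)) :
      GRel n p q lam ((ft F a + 1) * (ft F a - algebraMap F _ q)) 0
  | braid' (b : Fin (n - 1)) (hb : b.val = 1) :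
      GRel n p q lam (ft' F n * ft F b * ft' F n) (ft F b * ft' F n * ft F b)
  | braid (a b : Fin (n - 1)) (hab : a.val + 1 = b.val) :
      GRel n p q lam (ft F a * ft F b * ft F a) (ft F b * ft F a * ft F b)
  | braid6 (a b : Fin (n - 1)) (ha : a.val = 0) (hb : b.val = 1) :
      GRel n p q lam ((ft' F n * ft F a * ft F b) ^ 2) ((ft F b * ft' F n * ft F a) ^ 2)
  | comm' (a : Fin (n - 1)) (ha : 2 ≤ a.val) :
      GRel n p q lam (ft' F n * ft F a) (ft F a * ft' F n)
  | comm (a b : Fin (n - 1)) (hab : a.val + 1 < b.val ∨ b.val + 1 < a.val) :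
      GRel n p q lam (ft F a * ft F b) (ft F b * ft F a)
  | commS (a : Fin (n - 1)) (ha : 1 ≤ a.val) :
      GRel n p q lam (fs F n * ft F a) (ft F a * fs F n)
  | braidS (a : Fin (n - 1)) (ha : a.val = 0) :
      GRel n p q lam (fs F n * ft' F n * ft F a) (ft' F n * ft F a * fs F n)
  | bigBraid (a : Fin (n - 1)) (ha : a.val = 0) :
      GRel n p q lam (fs F n * altProd (ft' F n) (ft F a) p)
        (ft F a * fs F n * altProd (ft' F n) (ft F a) (p - 1))

/-- The cyclotomic Hecke algebra `H_{p,n}^Λ(q)` of type `G(r,p,n)`. -/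
abbrev HG (n p : ℕ) (q : F) (lam : WeightI q) : Type _ :=
  RingQuot (GRel n p q lam)

/-- The generator `s` of `H_{p,n}^Λ(q)`. -/
def HG.s (n p : ℕ) (q : F) (lam : WeightI q) : HG n p q lam :=
  RingQuot.mkAlgHom F (GRel n p q lam) (fs F n)

/-- The generator `t'_1` of `H_{p,n}^Λ(q)`. -/
def HG.t' (n p : ℕ) (q : F) (lam : WeightI q) : HG n p q lam :=
  RingQuot.mkAlgHom F (GRel n p q lam) (ft' F n)

/-- The generator `t_{a+1}` of `H_{p,n}^Λ(q)`. -/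
def HG.t (n p : ℕ) (q : F) (lam : WeightI q) (a : Fin (n - 1)) : HG n p q lam :=
  RingQuot.mkAlgHom F (GRel n p q lam) (ft F a)

/-- The subalgebra of elements fixed by an automorphism. -/
def fixedSubalgebra {A : Type*} [Semiring A] [Algebra F A] (σ : A ≃ₐ[F] A) : Subalgebra F A :=
  AlgHom.equalizer (σ : A →ₐ[F] A) (AlgHom.id F A)

end Algebras

/-- The simple transposition exchanging `a` and `a + 1`, in the group of permutations of
`{0, …, n-1}`. -/
def simpleTransp {n : ℕ} (a : Fin (n - 1)) : Equiv.Perm (Fin n) :=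
  Equiv.swap ⟨a.val, by omega⟩ ⟨a.val + 1, by omega⟩

/-- `l = (a_1, …, a_m)` is a reduced expression of `w`: `w = s_{a_1} ⋯ s_{a_m}` and no shorter
word has this property. -/
def IsReducedExpr {n : ℕ} (l : List (Fin (n - 1))) (w : Equiv.Perm (Fin n)) : Prop :=
  (l.map simpleTransp).prod = w ∧
    ∀ l' : List (Fin (n - 1)), (l'.map simpleTransp).prod = w → l.length ≤ l'.length

/-- Every permutation has a reduced expression. -/
theorem exists_isReducedExpr {n : ℕ} (w : Equiv.Perm (Fin n)) : ∃ l, IsReducedExpr l w := by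
  classical
  have hex : ∃ k, ∃ l : List (Fin (n-1)), l.length = k ∧ (l.map simpleTransp).prod = w := by
    cases n with
    | zero => exact ⟨0, [], rfl, Subsingleton.elim _ _⟩
    | succ k =>
      have : w ∈ Submonoid.closure (Set.range fun i : Fin k => Equiv.swap i.castSucc i.succ) := by
        rw [Equiv.Perm.mclosure_swap_castSucc_succ]; trivial
      induction this using Submonoid.closure_induction with
      | mem x hx => obtain ⟨i, rfl⟩ := hx; exact ⟨1, [i], rfl, by simp [simpleTransp]; rfl⟩
      | one => exact ⟨0, [], rfl, rfl⟩
      | mul x y _ _ hx hy =>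
        obtain ⟨_, l, _, rfl⟩ := hx
        obtain ⟨_, l', _, rfl⟩ := hy
        exact ⟨_, l ++ l', rfl, by simp⟩
  obtain ⟨l, hl, hw⟩ := Nat.find_spec hex
  exact ⟨l, hw, fun l' h' => hl ▸ Nat.find_min' hex ⟨l', rfl, h'⟩⟩

end CycHecke

end

/-!
The argument has four parts, all for `H = H_n^Λ(q, ζ)` and `H' = H_{p,n}^Λ(q)`.

*Spanning.* By braid and quadratic relations, `H` is spanned by the products of an element one level
below, a power of the last Jucys--Murphy element `X` and a descending product `T_{n-1} ⋯ T_j`. Powers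
of `X` beyond the degree `r` of the cyclotomic polynomial are reduced by expanding
`T_{n-1} ⋯ T_1 S^r`: its leading term is `X^r T_{n-1}⁻¹ ⋯ T_1⁻¹`, and `S^r` is a combination of lower
powers of `S` (`AKSystem.jm_pow_mem`). This gives `r^n n!` spanning elements. The descending products
compose to normal form words, one for each permutation; every reduced expression can be rewritten to
such a word by braid relations (`IsReducedExpr.exists_normalWord`), so the choice of reduced
expressions does not matter.

*Independence.* The dimension of `H` is at least `r^n n!` (`le_finrank`): given the algebra on one
strand fewer, a module with basis vectors `T_{j-1}⁻¹ ⋯ T_1⁻¹ S^k T_1 ⋯ T_{n-1} b` is written down by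
explicit formulas, where `b` runs through a basis of the smaller algebra, `0 ≤ k < r` and
`1 ≤ j ≤ n`. The formulas satisfy the relations of `H` (`InducedSystem.akSystem`), and the module is
cyclic, so `H` maps onto it.

*Injectivity of `φ`.* The relations of `H'` are invariant under the substitution `θ` that sends `t'_1`
to `t_1` and `t_1` to `t_1⁻¹ t'_1 t_1` and fixes the other generators (`GSystem.gSystem_twist`). Under
`φ` it becomes conjugation by `S`, and the relation with `p + 1` factors says that `θ^p` is
conjugation by `s` (`HG.theta_pow_mul_s`). Hence `H` acts on the sequences `v` in `H'` with
`v (i + p) = s v i`, where `S` acts as the shift and `T_a` by multiplying the `i`-th entry by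
`θ^i(t_a)`. The action of `H'` obtained from this through `φ` is multiplication by `θ^i(h)` in the
`i`-th entry, which is faithful.

*Fixed points.* Both the elements `φ(h) S^i` and the monomials span `H` and are eigenvectors of `σ`
for powers of `ζ`. Averaging over the powers of `σ` shows that the fixed points are spanned by those
of them that are fixed (`mem_span_of_fixed`); `p` is invertible in a field with a primitive `p`-th
root of unity. As `S^p = φ(s)`, the former lie in the image of `φ`.
-/

namespace CycHecke

/-! ### Systems of generators and the Ariki--Koike algebra -/

section Systems

variable {F A : Type*} [Field F] [Ring A] [Algebra F A]

/-- Elements `S, T 0, …, T (N - 1)` of an algebra that satisfy the braid and quadratic relations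
of the Ariki--Koike algebra on `N + 1` strands, together with `f(S) = 0`. The family `T` is
indexed by all natural numbers; its values from `N` on are irrelevant. -/
structure AKSystem (q : F) (f : F[X]) (N : ℕ) (S : A) (T : ℕ → A) : Prop where
  cyclo : aeval S f = 0
  quad : ∀ i < N, T i * T i = (q - 1) • T i + q • (1 : A)
  braidS : 0 < N → S * T 0 * S * T 0 = T 0 * S * T 0 * S
  commS : ∀ i < N, 0 < i → Commute S (T i)
  comm : ∀ i j, i + 1 < j → j < N → Commute (T i) (T j)
  braid : ∀ i, i + 1 < N → T i * T (i + 1) * T i = T (i + 1) * T i * T (i + 1)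

theorem AKSystem.mono {q : F} {f : F[X]} {M N : ℕ} {S : A} {T : ℕ → A}
    (h : AKSystem q f N S T) (hMN : M ≤ N) : AKSystem q f M S T where
  cyclo := h.cyclo
  quad i hi := h.quad i (by omega)
  braidS hM := h.braidS (by omega)
  commS i hi h0 := h.commS i (by omega) h0
  comm i j hij hj := h.comm i j hij (by omega)
  braid i hi := h.braid i (by omega)

theorem quad_iff {q : F} {t : A} :
    (t + 1) * (t - algebraMap F A q) = 0 ↔ t * t = (q - 1) • t + q • (1 : A) := by
  have : (t + 1) * (t - algebraMap F A q) = t * t - ((q - 1) • t + q • (1 : A)) := by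
    rw [Algebra.algebraMap_eq_smul_one, add_mul, mul_sub, mul_smul_comm, mul_one, one_mul,
      sub_smul, one_smul]
    abel
  rw [this, sub_eq_zero]

/-- The inverse `q⁻¹ (t - (q - 1))` of an element `t` with `(t + 1)(t - q) = 0`. -/
def heckeInv (q : F) (t : A) : A := q⁻¹ • (t - (q - 1) • 1)

theorem heckeInv_mul {q : F} (hq : q ≠ 0) {t : A} (ht : t * t = (q - 1) • t + q • (1 : A)) :
    heckeInv q t * t = 1 := by
  rw [heckeInv, smul_mul_assoc, sub_mul, ht, smul_mul_assoc, one_mul, add_sub_cancel_left,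
    smul_smul, inv_mul_cancel₀ hq, one_smul]

theorem mul_heckeInv {q : F} (hq : q ≠ 0) {t : A} (ht : t * t = (q - 1) • t + q • (1 : A)) :
    t * heckeInv q t = 1 := by
  rw [heckeInv, mul_smul_comm, mul_sub, ht, mul_smul_comm, mul_one, add_sub_cancel_left,
    smul_smul, inv_mul_cancel₀ hq, one_smul]

theorem commute_heckeInv {q : F} {a t : A} (h : Commute a t) : Commute a (heckeInv q t) :=
  (h.sub_right ((Commute.one_right a).smul_right _)).smul_right _

/-- An element with `(t + 1)(t - q) = 0`, as a unit. -/
def heckeUnit {q : F} (hq : q ≠ 0) {t : A} (ht : t * t = (q - 1) • t + q • (1 : A)) : Aˣ :=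
  ⟨t, heckeInv q t, mul_heckeInv hq ht, heckeInv_mul hq ht⟩

/-- An element killed by a polynomial with nonzero constant term is invertible. -/
theorem isUnit_of_aeval_eq_zero {f : F[X]} (hf : f.coeff 0 ≠ 0) {S : A} (hS : aeval S f = 0) :
    IsUnit S := by
  have h1 : aeval S f.divX * S = - algebraMap F A (f.coeff 0) := by
    have := congrArg (aeval S) (divX_mul_X_add f)
    rw [hS, map_add, map_mul, aeval_X, aeval_C] at this
    exact eq_neg_of_add_eq_zero_left this
  have hc : Commute S (aeval S f.divX) := by
    have : aeval S (X * f.divX) = aeval S (f.divX * X) := by rw [mul_comm]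
    rwa [map_mul, map_mul, aeval_X] at this
  have h2 : ((-(f.coeff 0)⁻¹) • aeval S f.divX) * S = 1 := by
    rw [smul_mul_assoc, h1, Algebra.algebraMap_eq_smul_one, ← neg_smul, smul_smul]
    simp [hf]
  refine ⟨⟨S, (-(f.coeff 0)⁻¹) • aeval S f.divX, ?_, h2⟩, rfl⟩
  rw [(hc.smul_right _).eq, h2]

end Systems

section Lift

variable {F A : Type*} [Field F] [Ring A] [Algebra F A]

/-- The generators `T` of the Ariki--Koike algebra, extended by `0` to all natural numbers. -/
def AK.Tn (n p : ℕ) (q ζ : F) (Λ : Weight p q) (i : ℕ) : AK n p q ζ Λ :=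
  if h : i < n - 1 then AK.T n p q ζ Λ ⟨i, h⟩ else 0

theorem AK.Tn_of_lt {n p : ℕ} {q ζ : F} {Λ : Weight p q} {i : ℕ} (h : i < n - 1) :
    AK.Tn n p q ζ Λ i = AK.T n p q ζ Λ ⟨i, h⟩ := dif_pos h

theorem AK.system (n p : ℕ) (q ζ : F) (Λ : Weight p q) :
    AKSystem q (akPoly p q ζ Λ) (n - 1) (AK.S n p q ζ Λ) (AK.Tn n p q ζ Λ) where
  cyclo := by
    have := RingQuot.mkAlgHom_rel F (AKRel.cyclo (n := n) (p := p) (q := q) (ζ := ζ) (Λ := Λ))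
    rwa [← Polynomial.aeval_algHom_apply, map_zero] at this
  quad i hi := by
    rw [AK.Tn_of_lt hi, ← quad_iff]
    have := RingQuot.mkAlgHom_rel F (AKRel.quad (p := p) (q := q) (ζ := ζ) (Λ := Λ) ⟨i, hi⟩)
    simp only [map_mul, map_add, map_sub, map_one, map_zero, AlgHom.commutes] at this
    exact this
  braidS h0 := by
    rw [AK.Tn_of_lt h0]
    have := RingQuot.mkAlgHom_rel F
      (AKRel.braidS (p := p) (q := q) (ζ := ζ) (Λ := Λ) ⟨0, h0⟩ rfl)
    simp only [map_mul] at this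
    exact this
  commS i hi h0 := by
    rw [AK.Tn_of_lt hi]
    have := RingQuot.mkAlgHom_rel F
      (AKRel.commS (p := p) (q := q) (ζ := ζ) (Λ := Λ) ⟨i, hi⟩ h0)
    simp only [map_mul] at this
    exact this
  comm i j hij hj := by
    rw [AK.Tn_of_lt hj, AK.Tn_of_lt (show i < n - 1 by omega)]
    have := RingQuot.mkAlgHom_rel F
      (AKRel.comm (p := p) (q := q) (ζ := ζ) (Λ := Λ) ⟨i, by omega⟩ ⟨j, hj⟩ (Or.inl hij))
    simp only [map_mul] at this
    exact this
  braid i hi := by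
    rw [AK.Tn_of_lt hi, AK.Tn_of_lt (show i < n - 1 by omega)]
    have := RingQuot.mkAlgHom_rel F
      (AKRel.braid (p := p) (q := q) (ζ := ζ) (Λ := Λ) ⟨i, by omega⟩ ⟨i + 1, hi⟩ rfl)
    simp only [map_mul] at this
    exact this

/-- The homomorphism from the Ariki--Koike algebra given by a system of elements that satisfy the
defining relations. -/
def AK.lift {n p : ℕ} {q ζ : F} {Λ : Weight p q} {S : A} {T : ℕ → A}
    (h : AKSystem q (akPoly p q ζ Λ) (n - 1) S T) : AK n p q ζ Λ →ₐ[F] A :=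
  RingQuot.liftAlgHom F (s := AKRel n p q ζ Λ)
    ⟨FreeAlgebra.lift F fun | AKGen.S => S | AKGen.T a => T a, by
      have hS : FreeAlgebra.lift F (fun | AKGen.S => S | AKGen.T a => T a : AKGen n → A)
        (fS F n) = S := by simp [fS]
      have hT : ∀ a : Fin (n - 1), FreeAlgebra.lift F
        (fun | AKGen.S => S | AKGen.T a => T a : AKGen n → A) (fT F a) = T a := by simp [fT]
      intro x y hxy
      induction hxy with
      | cyclo => rw [← Polynomial.aeval_algHom_apply, hS, map_zero, h.cyclo]
      | quad a =>
        simp only [map_mul, map_add, map_sub, map_one, map_zero, AlgHom.commutes, hT]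
        exact quad_iff.2 (h.quad a a.2)
      | braidS a ha =>
        simp only [map_mul, hS, hT, ha]
        exact h.braidS (ha ▸ a.2)
      | commS a ha =>
        simp only [map_mul, hS, hT]
        exact h.commS a a.2 ha
      | comm a b hab =>
        simp only [map_mul, hT]
        rcases hab with hab | hab
        · exact h.comm a b hab b.2
        · exact (h.comm b a hab a.2).symm
      | braid a b hab =>
        simp only [map_mul, hT, ← hab]
        exact h.braid a (hab ▸ b.2)⟩

@[simp]
theorem AK.lift_S {n p : ℕ} {q ζ : F} {Λ : Weight p q} {S : A} {T : ℕ → A}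
    (h : AKSystem q (akPoly p q ζ Λ) (n - 1) S T) : AK.lift h (AK.S n p q ζ Λ) = S := by
  rw [AK.lift, AK.S, RingQuot.liftAlgHom_mkAlgHom_apply, fS, FreeAlgebra.lift_ι_apply]

@[simp]
theorem AK.lift_T {n p : ℕ} {q ζ : F} {Λ : Weight p q} {S : A} {T : ℕ → A}
    (h : AKSystem q (akPoly p q ζ Λ) (n - 1) S T) (a : Fin (n - 1)) :
    AK.lift h (AK.T n p q ζ Λ a) = T a := by
  rw [AK.lift, AK.T, RingQuot.liftAlgHom_mkAlgHom_apply, fT, FreeAlgebra.lift_ι_apply]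

theorem AK.hom_ext {n p : ℕ} {q ζ : F} {Λ : Weight p q} {g g' : AK n p q ζ Λ →ₐ[F] A}
    (hS : g (AK.S n p q ζ Λ) = g' (AK.S n p q ζ Λ))
    (hT : ∀ a, g (AK.T n p q ζ Λ a) = g' (AK.T n p q ζ Λ a)) : g = g' := by
  refine RingQuot.ringQuot_ext' F _ _ (FreeAlgebra.hom_ext (funext fun a => ?_))
  cases a with
  | S => exact hS
  | T a => exact hT a

/-- Induction principle: a subspace that contains `1` and is stable under left multiplication by
the generators is everything. -/
theorem AK.eq_top_of_mul_mem {n p : ℕ} {q ζ : F} {Λ : Weight p q}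
    (M : Submodule F (AK n p q ζ Λ)) (h1 : 1 ∈ M)
    (hS : ∀ x ∈ M, AK.S n p q ζ Λ * x ∈ M)
    (hT : ∀ a, ∀ x ∈ M, AK.T n p q ζ Λ a * x ∈ M) : M = ⊤ := by
  have key : ∀ y : FreeAlgebra F (AKGen n), ∀ x ∈ M,
      RingQuot.mkAlgHom F (AKRel n p q ζ Λ) y * x ∈ M := by
    intro y
    induction y using FreeAlgebra.induction with
    | grade0 r =>
      intro x hx
      rw [AlgHom.commutes, ← Algebra.smul_def]
      exact M.smul_mem _ hx
    | grade1 a => cases a with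
      | S => exact hS
      | T a => exact hT a
    | mul a b ha hb => intro x hx; rw [map_mul, mul_assoc]; exact ha _ (hb _ hx)
    | add a b ha hb => intro x hx; rw [map_add, add_mul]; exact M.add_mem (ha _ hx) (hb _ hx)
  refine eq_top_iff.2 fun x _ => ?_
  obtain ⟨y, rfl⟩ := RingQuot.mkAlgHom_surjective F (AKRel n p q ζ Λ) x
  simpa using key y 1 h1

end Lift

/-! ### Normal forms of words under braid relations -/

section Words

/-- The word `(j + k - 1, …, j + 1, j)` of `k` consecutive descending letters. -/
def descList (j : ℕ) : ℕ → List ℕ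
  | 0 => []
  | k + 1 => (j + k) :: descList j k

/-- The product `t_{j+k-1} ⋯ t_{j+1} t_j`. -/
def descProd {M : Type*} [Monoid M] (t : ℕ → M) (j k : ℕ) : M := ((descList j k).map t).prod

@[simp]
theorem descProd_zero {M : Type*} [Monoid M] (t : ℕ → M) (j : ℕ) : descProd t j 0 = 1 := rfl

theorem descProd_succ {M : Type*} [Monoid M] (t : ℕ → M) (j k : ℕ) :
    descProd t j (k + 1) = t (j + k) * descProd t j k := by
  simp [descProd, descList]

theorem descProd_succ' {M : Type*} [Monoid M] (t : ℕ → M) (j k : ℕ) :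
    descProd t j (k + 1) = descProd t (j + 1) k * t j := by
  induction k with
  | zero => simp [descProd_succ]
  | succ k ih => rw [descProd_succ, ih, descProd_succ t (j + 1), mul_assoc]; congr 2; omega

theorem descProd_add {M : Type*} [Monoid M] (t : ℕ → M) (j k l : ℕ) :
    descProd t j (k + l) = descProd t (j + k) l * descProd t j k := by
  induction l with
  | zero => simp
  | succ l ih =>
    rw [← add_assoc, descProd_succ, ih, descProd_succ t (j + k), mul_assoc, add_assoc j]

/-- The braid relations between `t 0, …, t (N - 1)`. -/
structure BraidSystem {M : Type*} [Monoid M] (N : ℕ) (t : ℕ → M) : Prop where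
  comm : ∀ i j, i + 1 < j → j < N → Commute (t i) (t j)
  braid : ∀ i, i + 1 < N → t i * t (i + 1) * t i = t (i + 1) * t i * t (i + 1)

theorem BraidSystem.mono {M : Type*} [Monoid M] {L N : ℕ} {t : ℕ → M} (h : BraidSystem N t)
    (hLN : L ≤ N) : BraidSystem L t :=
  ⟨fun i j hij hj => h.comm i j hij (by omega), fun i hi => h.braid i (by omega)⟩

theorem BraidSystem.commute_descProd {M : Type*} [Monoid M] {N : ℕ} {t : ℕ → M}
    (h : BraidSystem N t) {i j k : ℕ} (hij : i + 1 < j) (hk : j + k ≤ N) :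
    Commute (t i) (descProd t j k) := by
  induction k with
  | zero => simp
  | succ k ih =>
    rw [descProd_succ]
    exact (h.comm i _ (by omega) (by omega)).mul_right (ih (by omega))

theorem BraidSystem.commute_descProd' {M : Type*} [Monoid M] {N : ℕ} {t : ℕ → M}
    (h : BraidSystem N t) {i j k : ℕ} (hij : j + k < i) (hi : i < N) :
    Commute (t i) (descProd t j k) := by
  induction k with
  | zero => simp
  | succ k ih =>
    rw [descProd_succ]
    exact ((h.comm _ i (by omega) (by omega)).symm).mul_right (ih (by omega))

/-- Moving a letter through a descending product that contains both it and its predecessor lowers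
the letter by one. -/
theorem BraidSystem.descProd_mul {M : Type*} [Monoid M] {N : ℕ} {t : ℕ → M}
    (h : BraidSystem N t) {i j k : ℕ} (hij : j < i) (hi : i < j + k) (hk : j + k ≤ N) :
    descProd t j k * t i = t (i - 1) * descProd t j k := by
  obtain ⟨a, rfl⟩ : ∃ a, i = j + a + 1 := ⟨i - j - 1, by omega⟩
  obtain ⟨b, rfl⟩ : ∃ b, k = a + 1 + 1 + b := ⟨k - a - 2, by omega⟩
  have h1 : Commute (t (j + a + 1)) (descProd t j a) := h.commute_descProd' (by omega) (by omega)
  have h2 : Commute (t (j + a)) (descProd t (j + (a + 1 + 1)) b) :=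
    h.commute_descProd (by omega) (by omega)
  have h3 := h.braid (j + a) (by omega)
  rw [descProd_add, descProd_succ, descProd_succ, Nat.add_sub_cancel]
  simp only [mul_assoc]
  rw [← h1.eq]
  simp only [← mul_assoc]
  rw [h2.eq]
  simp only [mul_assoc]
  congr 1
  simp only [← mul_assoc]
  rw [← add_assoc, ← h3]

/-- The normal form words in the letters `0, …, N - 1`: products of descending runs that start at
`0, 1, …, N - 1`. -/
def normalWords : ℕ → Finset (List ℕ)
  | 0 => {[]}
  | N + 1 => Finset.image₂ (fun u k => u ++ descList (N + 1 - k) k) (normalWords N)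
      (Finset.range (N + 2))

theorem card_normalWords_le (N : ℕ) : (normalWords N).card ≤ (N + 1).factorial := by
  induction N with
  | zero => simp [normalWords]
  | succ N ih =>
    refine (Finset.card_image₂_le _ _ _).trans ?_
    rw [Finset.card_range, Nat.factorial_succ (N + 1), mul_comm]
    exact Nat.mul_le_mul_left _ ih

theorem mem_descList {x j k : ℕ} (hx : x ∈ descList j k) : x < j + k := by
  induction k with
  | zero => simp [descList] at hx
  | succ k ih =>
    rcases List.mem_cons.1 hx with rfl | hx
    · omega
    · have := ih hx; omega

theorem mem_normalWords_succ {N : ℕ} {l : List ℕ} :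
    l ∈ normalWords (N + 1) ↔
      ∃ u ∈ normalWords N, ∃ k, k ≤ N + 1 ∧ u ++ descList (N + 1 - k) k = l := by
  simp only [normalWords, Finset.mem_image₂, Finset.mem_range, Nat.lt_succ_iff]

theorem lt_of_mem_normalWords {N : ℕ} {l : List ℕ} (hl : l ∈ normalWords N) :
    ∀ x ∈ l, x < N := by
  induction N generalizing l with
  | zero => simp_all [normalWords]
  | succ N ih =>
    obtain ⟨u, hu, k, hk, rfl⟩ := mem_normalWords_succ.1 hl
    intro x hx
    rcases List.mem_append.1 hx with hx | hx
    · have := ih hu x hx; omega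
    · have := mem_descList hx; omega

/-- By braid relations alone, a word becomes a normal form word or a word with a repeated
letter. -/
theorem BraidSystem.exists_normalWord_or_double {M : Type*} [Monoid M] {N : ℕ} {t : ℕ → M}
    (h : BraidSystem N t) (l : List ℕ) (hl : ∀ x ∈ l, x < N) :
    (∃ u ∈ normalWords N, (u.map t).prod = (l.map t).prod) ∨
      ∃ l₁ a l₂, (∀ x ∈ l₁ ++ l₂, x < N) ∧ (l.map t).prod = ((l₁ ++ a :: a :: l₂).map t).prod := by
  induction N generalizing l with
  | zero =>
    obtain rfl : l = [] := List.eq_nil_iff_forall_not_mem.2 fun x hx => by simpa using hl x hx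
    exact Or.inl ⟨[], by simp [normalWords], rfl⟩
  | succ N ihN =>
    induction l using List.reverseRecOn with
    | nil =>
      have h0 : [] ∈ normalWords (N + 1) := by
        clear ihN h hl
        induction N with
        | zero => exact mem_normalWords_succ.2 ⟨[], by simp [normalWords], 0, by simp, rfl⟩
        | succ N ih => exact mem_normalWords_succ.2 ⟨[], ih, 0, by simp, rfl⟩
      exact Or.inl ⟨[], h0, rfl⟩
    | append_singleton l a ih =>
      have ha : a < N + 1 := hl a (by simp)
      rcases ih (fun x hx => hl x (by simp [hx])) with ⟨u', hu', hul⟩ | ⟨l₁, b, l₂, hl₁, hb⟩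
      · obtain ⟨u, hu, k, hk, rfl⟩ := mem_normalWords_succ.1 hu'
        have e : ((l ++ [a]).map t).prod =
            (u.map t).prod * (descProd t (N + 1 - k) k * t a) := by
          simp only [List.map_append, List.prod_append, ← hul, mul_assoc, List.map_cons,
            List.map_nil, List.prod_cons, List.prod_nil, mul_one]
          rfl
        -- a letter that moves to the left of the last run becomes a letter of the lower level
        have key : ∀ b, b < N → descProd t (N + 1 - k) k * t a = t b * descProd t (N + 1 - k) k →
            (∃ u ∈ normalWords (N + 1), (u.map t).prod = ((l ++ [a]).map t).prod) ∨
            ∃ l₁ a' l₂, (∀ x ∈ l₁ ++ l₂, x < N + 1) ∧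
              ((l ++ [a]).map t).prod = ((l₁ ++ a' :: a' :: l₂).map t).prod := by
          intro b hb hba
          have e' : ((l ++ [a]).map t).prod =
              ((u ++ [b]).map t).prod * descProd t (N + 1 - k) k := by
            rw [e, hba]; simp [mul_assoc]
          rcases ihN (h.mono (by omega)) (u ++ [b]) (by
            intro x hx
            rcases List.mem_append.1 hx with hx | hx
            · exact lt_of_mem_normalWords hu x hx
            · rw [List.mem_singleton.1 hx]; exact hb) with ⟨v, hv, hvu⟩ | ⟨l₁, c, l₂, hl₁, hc⟩
          · refine Or.inl ⟨_, mem_normalWords_succ.2 ⟨v, hv, k, hk, rfl⟩, ?_⟩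
            rw [e', List.map_append, List.prod_append, hvu]; rfl
          · refine Or.inr ⟨l₁, c, l₂ ++ descList (N + 1 - k) k, ?_, ?_⟩
            · intro x hx
              rw [← List.append_assoc] at hx
              rcases List.mem_append.1 hx with hx | hx
              · have := hl₁ x hx; omega
              · have := mem_descList hx; omega
            · rw [e', hc, descProd]
              simp [mul_assoc]
        rcases lt_trichotomy (a + 1) (N + 1 - k) with hak | hak | hak
        · exact key a (by omega) (h.commute_descProd hak (by omega)).eq.symm
        · refine Or.inl ⟨_, mem_normalWords_succ.2 ⟨u, hu, k + 1, by omega, rfl⟩, ?_⟩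
          rw [e, List.map_append, List.prod_append]
          have e1 : N + 1 - (k + 1) = a := by omega
          have := descProd_succ' t a k
          rw [hak] at this
          rw [e1, ← this]; rfl
        · rcases Nat.lt_or_ge (N + 1 - k) a with hka | hka
          · exact key (a - 1) (by omega) (h.descProd_mul hka (by omega) (by omega))
          · obtain ⟨k, rfl⟩ : ∃ k', k = k' + 1 := ⟨k - 1, by omega⟩
            have e1 : N + 1 - (k + 1) = a := by omega
            refine Or.inr ⟨u ++ descList (a + 1) k, a, [], ?_, ?_⟩
            · intro x hx
              rw [List.append_nil] at hx
              rcases List.mem_append.1 hx with hx | hx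
              · have := lt_of_mem_normalWords hu x hx; omega
              · have := mem_descList hx; omega
            · rw [e, e1, descProd_succ', descProd]
              simp [mul_assoc]
      · refine Or.inr ⟨l₁, b, l₂ ++ [a], ?_, ?_⟩
        · intro x hx
          rw [← List.append_assoc] at hx
          rcases List.mem_append.1 hx with hx | hx
          · exact hl₁ x hx
          · rw [List.mem_singleton.1 hx]; exact ha
        · rw [List.map_append, List.prod_append, hb]
          simp [mul_assoc]

end Words

/-! ### Reduced expressions -/

section Perms

/-- The simple transpositions, extended by `1` to all natural numbers. -/
def simpleTranspN (n i : ℕ) : Equiv.Perm (Fin n) :=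
  if h : i < n - 1 then simpleTransp ⟨i, h⟩ else 1

theorem simpleTranspN_of_lt {n i : ℕ} (h : i < n - 1) :
    simpleTranspN n i = simpleTransp ⟨i, h⟩ := dif_pos h

theorem braidSystem_simpleTranspN (n : ℕ) : BraidSystem (n - 1) (simpleTranspN n) where
  comm i j hij hj := by
    rw [simpleTranspN_of_lt hj, simpleTranspN_of_lt (show i < n - 1 by omega)]
    refine Equiv.Perm.Disjoint.commute ?_
    rw [Equiv.Perm.disjoint_iff_eq_or_eq]
    intro x
    by_cases hx : x.val = i ∨ x.val = i + 1
    · right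
      refine Equiv.swap_apply_of_ne_of_ne ?_ ?_ <;> rw [Ne, Fin.ext_iff] <;> simp <;> omega
    · left
      refine Equiv.swap_apply_of_ne_of_ne ?_ ?_ <;> rw [Ne, Fin.ext_iff] <;> simp <;> omega
  braid i hi := by
    rw [simpleTranspN_of_lt hi, simpleTranspN_of_lt (show i < n - 1 by omega)]
    simp only [simpleTransp]
    rw [Equiv.swap_mul_swap_mul_swap (by simp) (by simp; omega)]
    rw [Equiv.swap_comm (⟨i, _⟩ : Fin n) ⟨i + 1, _⟩,
      Equiv.swap_comm (⟨i + 1, _⟩ : Fin n) ⟨i + 1 + 1, _⟩,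
      Equiv.swap_mul_swap_mul_swap (by simp) (by simp; omega), Equiv.swap_comm]

theorem map_val_simpleTranspN {n : ℕ} (l : List (Fin (n - 1))) :
    (l.map Fin.val).map (simpleTranspN n) = l.map simpleTransp := by
  rw [List.map_map]
  exact List.map_congr_left fun a _ => simpleTranspN_of_lt a.2

/-- A word with letters below `n - 1` and the permutation `w` is at least as long as a reduced
expression of `w`. -/
theorem IsReducedExpr.length_le {n : ℕ} {l : List (Fin (n - 1))} {w : Equiv.Perm (Fin n)}
    (hl : IsReducedExpr l w) {u : List ℕ} (hu : ∀ x ∈ u, x < n - 1)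
    (huw : (u.map (simpleTranspN n)).prod = w) : l.length ≤ u.length := by
  have e : (u.attach.map fun x => (⟨x.1, hu x.1 x.2⟩ : Fin (n - 1))).map Fin.val = u := by
    rw [List.map_map]
    exact List.attach_map_subtype_val u
  have := hl.2 (u.attach.map fun x => ⟨x.1, hu x.1 x.2⟩) (by
    rw [← map_val_simpleTranspN, e, huw])
  simpa using this

/-- The normal form of a reduced expression: a normal form word with the same product in every
monoid with braid relations. The proof applies the rewriting of words in the product of the given
monoid with the symmetric group and with `ℕ`, so that the permutation and the length of the word
are recorded as well; a repeated letter would contradict minimality of the length. -/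
theorem IsReducedExpr.exists_normalWord {M : Type*} [Monoid M] {n : ℕ} {t : ℕ → M}
    (h : BraidSystem (n - 1) t) {l : List (Fin (n - 1))} {w : Equiv.Perm (Fin n)}
    (hl : IsReducedExpr l w) :
    ∃ u ∈ normalWords (n - 1), (u.map (simpleTranspN n)).prod = w ∧
      (u.map t).prod = ((l.map Fin.val).map t).prod := by
  have hs := braidSystem_simpleTranspN n
  let t' : ℕ → M × Equiv.Perm (Fin n) × Multiplicative ℕ :=
    fun i => (t i, simpleTranspN n i, Multiplicative.ofAdd 1)
  have ht' : BraidSystem (n - 1) t' :=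
    ⟨fun i j hij hj => Prod.ext (h.comm i j hij hj) (Prod.ext (hs.comm i j hij hj) rfl),
      fun i hi => Prod.ext (h.braid i hi) (Prod.ext (hs.braid i hi) rfl)⟩
  have hprod : ∀ v : List ℕ, (v.map t').prod =
      ((v.map t).prod, (v.map (simpleTranspN n)).prod, Multiplicative.ofAdd v.length) := by
    intro v
    induction v with
    | nil => rfl
    | cons a v ih =>
      simp only [List.map_cons, List.prod_cons, ih, List.length_cons]
      refine Prod.ext rfl (Prod.ext rfl ?_)
      exact congrArg Multiplicative.ofAdd (add_comm 1 v.length)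
  have hlw : ((l.map Fin.val).map (simpleTranspN n)).prod = w := by
    rw [map_val_simpleTranspN, hl.1]
  rcases ht'.exists_normalWord_or_double (l.map Fin.val) (by simp) with
    ⟨u, hu, hul⟩ | ⟨l₁, a, l₂, hl₁, hal⟩
  · rw [hprod, hprod, Prod.ext_iff, Prod.ext_iff] at hul
    exact ⟨u, hu, hul.2.1.trans hlw, hul.1⟩
  · exfalso
    rw [hprod, hprod, Prod.ext_iff, Prod.ext_iff] at hal
    have hlen : l.length = l₁.length + (l₂.length + 1 + 1) := by
      simpa using congrArg Multiplicative.toAdd hal.2.2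
    have hss : simpleTranspN n a * simpleTranspN n a = 1 := by
      rw [simpleTranspN]
      split_ifs
      · exact Equiv.swap_mul_self _ _
      · simp
    have hperm : ((l.map Fin.val).map (simpleTranspN n)).prod =
        ((l₁ ++ a :: a :: l₂).map (simpleTranspN n)).prod := hal.2.1
    have := hl.length_le hl₁ (by
      rw [← hlw, hperm]
      simp only [List.map_append, List.map_cons, List.prod_append, List.prod_cons]
      rw [← mul_assoc (simpleTranspN n a), hss, one_mul])
    rw [List.length_append] at this
    omega

/-- Distinct normal form words have distinct permutations: there are at most `n!` of them, and
every permutation occurs. -/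
theorem injOn_normalWords (n : ℕ) :
    Set.InjOn (fun u : List ℕ => (u.map (simpleTranspN n)).prod) (normalWords (n - 1) : Set _) := by
  cases n with
  | zero => simp [normalWords]
  | succ N =>
    refine Finset.injOn_of_surjOn_of_card_le (t := Finset.univ) _ (by simp [Set.MapsTo]) ?_ ?_
    · intro w _
      obtain ⟨l, hl⟩ := exists_isReducedExpr w
      obtain ⟨u, hu, huw, -⟩ := hl.exists_normalWord (braidSystem_simpleTranspN (N + 1))
      exact ⟨u, hu, huw⟩
    · rw [Finset.card_univ, Fintype.card_perm, Fintype.card_fin]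
      exact card_normalWords_le N

/-- The product of a normal form word is that of any reduced expression of its permutation. -/
theorem prod_normalWord_eq {M : Type*} [Monoid M] {n : ℕ} {t : ℕ → M}
    (h : BraidSystem (n - 1) t) {u : List ℕ} (hu : u ∈ normalWords (n - 1))
    {l : List (Fin (n - 1))} (hl : IsReducedExpr l (u.map (simpleTranspN n)).prod) :
    (u.map t).prod = ((l.map Fin.val).map t).prod := by
  obtain ⟨v, hv, hvw, hvl⟩ := hl.exists_normalWord h
  rw [← hvl, injOn_normalWords n hv hu hvw]

end Perms

/-! ### Jucys--Murphy elements -/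

section JucysMurphy

variable {F A : Type*} [Field F] [Ring A] [Algebra F A]

/-- The elements `X_{k+1}` attached to `S` and a family `T`: `X_1 = S` and
`q X_{a+1} = T_a X_a T_a`. -/
def jm (q : F) (S : A) (T : ℕ → A) : ℕ → A
  | 0 => S
  | k + 1 => q⁻¹ • (T k * jm q S T k * T k)

theorem AKSystem.braidSystem {q : F} {f : F[X]} {N : ℕ} {S : A} {T : ℕ → A}
    (h : AKSystem q f N S T) : BraidSystem N T := ⟨h.comm, h.braid⟩

namespace AKSystem

variable {q : F} {f : F[X]} {N : ℕ} {S : A} {T : ℕ → A} (h : AKSystem q f N S T)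
include h

theorem commute_T_jm_of_lt {i k : ℕ} (hki : k < i) (hi : i < N) : Commute (T i) (jm q S T k) := by
  induction k with
  | zero => exact (h.commS i hi hki).symm
  | succ k ih =>
    have h1 : Commute (T i) (T k) := (h.comm k i hki hi).symm
    exact ((h1.mul_right (ih (by omega))).mul_right h1).smul_right _

theorem commute_T_jm_add_two {i : ℕ} (hi : i + 1 < N) : Commute (T i) (jm q S T (i + 2)) := by
  have h1 := h.braid i hi
  have h2 := h.commute_T_jm_of_lt (Nat.lt_succ_self i) hi
  refine Commute.smul_right ?_ _
  rw [jm, mul_smul_comm, smul_mul_assoc]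
  refine Commute.smul_right ?_ _
  calc T i * (T (i + 1) * (T i * jm q S T i * T i) * T (i + 1))
      = (T i * T (i + 1) * T i) * jm q S T i * (T i * T (i + 1)) := by simp only [mul_assoc]
    _ = T (i + 1) * T i * (T (i + 1) * jm q S T i) * (T i * T (i + 1)) := by
        rw [h1]; simp only [mul_assoc]
    _ = T (i + 1) * T i * jm q S T i * (T (i + 1) * T i * T (i + 1)) := by
        rw [h2.eq]; simp only [mul_assoc]
    _ = _ := by rw [← h1]; simp only [mul_assoc]

theorem commute_T_jm {i k : ℕ} (hik : i + 1 < k) (hk : k ≤ N) : Commute (T i) (jm q S T k) := by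
  obtain ⟨b, rfl⟩ : ∃ b, k = i + 2 + b := ⟨k - (i + 2), by omega⟩
  induction b with
  | zero => exact h.commute_T_jm_add_two (by omega)
  | succ b ih =>
    have h1 : Commute (T i) (T (i + 2 + b)) := h.comm _ _ (by omega) (by omega)
    exact ((h1.mul_right (ih (by omega) (by omega))).mul_right h1).smul_right _

theorem commute_S_jm {k : ℕ} (hk : k ≤ N) : Commute S (jm q S T k) := by
  induction k with
  | zero => exact Commute.refl _
  | succ k ih =>
    refine Commute.smul_right ?_ _
    rcases Nat.eq_zero_or_pos k with rfl | h0
    · have := h.braidS hk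
      show S * (T 0 * S * T 0) = T 0 * S * T 0 * S
      rw [← this]; simp only [mul_assoc]
    · have h1 := h.commS k hk h0
      exact (h1.mul_right (ih (by omega))).mul_right h1

/-- The elements `X_k` commute with each other. -/
theorem commute_jm_jm {j k : ℕ} (hjk : j < k) (hk : k ≤ N) :
    Commute (jm q S T j) (jm q S T k) := by
  induction j with
  | zero => exact h.commute_S_jm hk
  | succ j ih =>
    have h1 := h.commute_T_jm hjk hk
    exact ((h1.mul_left (ih (by omega))).mul_left h1).smul_left _

end AKSystem

end JucysMurphy

/-! ### Spanning by monomials -/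

section Spanning

variable {F A : Type*} [Field F] [Ring A] [Algebra F A]

theorem mul_mem_of_mem_span {s : Set A} {Q : Submodule F A} {t x : A}
    (hs : ∀ g ∈ s, g * t ∈ Q) (hx : x ∈ Submodule.span F s) : x * t ∈ Q := by
  have : Submodule.span F s ≤ Q.comap (LinearMap.mulRight F t) := Submodule.span_le.2 hs
  exact this hx

theorem mul_mem_of_mem_span' {s : Set A} {Q : Submodule F A} {t x : A}
    (hs : ∀ g ∈ s, t * g ∈ Q) (hx : x ∈ Submodule.span F s) : t * x ∈ Q := by
  have : Submodule.span F s ≤ Q.comap (LinearMap.mulLeft F t) := Submodule.span_le.2 hs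
  exact this hx

/-- The subalgebra generated by `S, T 0, …, T (N - 1)`. -/
def levelAlg (F : Type*) {A : Type*} [Field F] [Ring A] [Algebra F A] (S : A) (T : ℕ → A)
    (N : ℕ) : Subalgebra F A :=
  Algebra.adjoin F (insert S (T '' Set.Iio N))

variable {q : F} {f : F[X]} {S : A} {T : ℕ → A} {N : ℕ}

theorem S_mem_levelAlg (N : ℕ) : S ∈ levelAlg F S T N :=
  Algebra.subset_adjoin (Set.mem_insert _ _)

theorem T_mem_levelAlg {i : ℕ} (hi : i < N) : T i ∈ levelAlg F S T N :=
  Algebra.subset_adjoin (Set.mem_insert_of_mem _ ⟨i, hi, rfl⟩)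

theorem commute_levelAlg {x : A} (hS : Commute x S) (hT : ∀ i < N, Commute x (T i)) {b : A}
    (hb : b ∈ levelAlg F S T N) : Commute x b := by
  have : levelAlg F S T N ≤ Subalgebra.centralizer F {x} := by
    refine Algebra.adjoin_le ?_
    rintro y (rfl | ⟨i, hi, rfl⟩)
    · exact (Set.mem_centralizer_iff).2 (by rintro _ rfl; exact hS)
    · exact (Set.mem_centralizer_iff).2 (by rintro _ rfl; exact hT i hi)
  exact (Set.mem_centralizer_iff).1 (this hb) x rfl

theorem heckeInv_mem {B : Subalgebra F A} {t : A} (ht : t ∈ B) : heckeInv q t ∈ B :=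
  B.smul_mem (B.sub_mem ht (B.smul_mem B.one_mem _)) _

theorem descProd_mem {B : Subalgebra F A} {t : ℕ → A} {j k : ℕ} (h : ∀ i < j + k, t i ∈ B) :
    descProd t j k ∈ B := by
  induction k with
  | zero => exact B.one_mem
  | succ k ih =>
    rw [descProd_succ]
    exact B.mul_mem (h _ (by omega)) (ih fun i hi => h i (by omega))

/-- The span of the elements `b X^k T_N ⋯ T_j` with `k < m` and `j ≤ N + 1`, where `X` is the last
Jucys--Murphy element and `b` runs through the subalgebra one level below. -/
def stepSpan (q : F) (S : A) (T : ℕ → A) (N m : ℕ) : Submodule F A :=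
  Submodule.span F {x | ∃ b ∈ levelAlg F S T N, ∃ k < m, ∃ l ≤ N + 1,
    x = b * jm q S T (N + 1) ^ k * descProd T (N + 1 - l) l}

/-- The span of the elements `b T_N ⋯ T_j` with `1 ≤ j ≤ N + 1` and `b` one level below. -/
def properSpan (S : A) (T : ℕ → A) (N : ℕ) : Submodule F A :=
  Submodule.span F {x | ∃ b ∈ levelAlg F S T N, ∃ l ≤ N, x = b * descProd T (N + 1 - l) l}

theorem mem_stepSpan {b : A} (hb : b ∈ levelAlg F S T N) {k m l : ℕ} (hk : k < m)
    (hl : l ≤ N + 1) :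
    b * jm q S T (N + 1) ^ k * descProd T (N + 1 - l) l ∈ stepSpan q S T N m :=
  Submodule.subset_span ⟨b, hb, k, hk, l, hl, rfl⟩

theorem stepSpan_mono {m m' : ℕ} (h : m ≤ m') : stepSpan q S T N m ≤ stepSpan q S T N m' := by
  refine Submodule.span_mono ?_
  rintro x ⟨b, hb, k, hk, l, hl, rfl⟩
  exact ⟨b, hb, k, by omega, l, hl, rfl⟩

theorem mul_stepSpan {b : A} (hb : b ∈ levelAlg F S T N) {m : ℕ} {x : A}
    (hx : x ∈ stepSpan q S T N m) : b * x ∈ stepSpan q S T N m := by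
  refine mul_mem_of_mem_span' ?_ hx
  rintro x ⟨c, hc, k, hk, l, hl, rfl⟩
  rw [← mul_assoc, ← mul_assoc]
  exact mem_stepSpan ((levelAlg F S T N).mul_mem hb hc) hk hl

namespace AKSystem

/-- `T_{k-1} ⋯ T_0 S = q^k X_{k+1} T_{k-1}⁻¹ ⋯ T_0⁻¹`. -/
theorem descProd_mul_S (hq : q ≠ 0) (h : AKSystem q f N S T) {k : ℕ} (hk : k ≤ N) :
    descProd T 0 k * S = q ^ k • (jm q S T k * descProd (fun i => heckeInv q (T i)) 0 k) := by
  induction k with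
  | zero => simp [jm]
  | succ k ih =>
    rw [descProd_succ, descProd_succ, mul_assoc, ih (by omega), zero_add, jm, mul_smul_comm,
      smul_mul_assoc, smul_smul, pow_succ, mul_assoc, mul_inv_cancel₀ hq, mul_one]
    congr 1
    simp only [mul_assoc]
    rw [← mul_assoc (T k) (heckeInv q (T k)), mul_heckeInv hq (h.quad k (by omega)), one_mul]

variable (h : AKSystem q f (N + 1) S T)
include h

theorem commute_jm_levelAlg {b : A} (hb : b ∈ levelAlg F S T N) :
    Commute (jm q S T (N + 1)) b :=
  commute_levelAlg (h.commute_S_jm le_rfl).symm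
    (fun i hi => (h.commute_T_jm (by omega) le_rfl).symm) hb

theorem commute_pow_levelAlg {b : A} (hb : b ∈ levelAlg F S T N) (k : ℕ) :
    jm q S T (N + 1) ^ k * b = b * jm q S T (N + 1) ^ k :=
  ((h.commute_jm_levelAlg hb).pow_left k).eq

theorem stepSpan_mul_T {i m : ℕ} (hi : i < N + 1) {x : A} (hx : x ∈ stepSpan q S T N m) :
    x * T i ∈ stepSpan q S T N m := by
  have hB := h.braidSystem
  refine mul_mem_of_mem_span ?_ hx
  rintro x ⟨b, hb, k, hk, l, hl, rfl⟩
  have key : ∀ i' < N, descProd T (N + 1 - l) l * T i = T i' * descProd T (N + 1 - l) l →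
      b * jm q S T (N + 1) ^ k * descProd T (N + 1 - l) l * T i ∈ stepSpan q S T N m := by
    intro i' hi' e
    have h1 := T_mem_levelAlg (F := F) (S := S) (T := T) hi'
    rw [mul_assoc, e, ← mul_assoc, mul_assoc b, h.commute_pow_levelAlg h1, ← mul_assoc]
    exact mem_stepSpan ((levelAlg F S T N).mul_mem hb h1) hk hl
  rcases lt_trichotomy (i + 1) (N + 1 - l) with hil | hil | hil
  · exact key i (by omega) (hB.commute_descProd hil (by omega)).eq.symm
  · have e := descProd_succ' T i l
    rw [hil] at e
    rw [mul_assoc, ← e]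
    have e1 : i = N + 1 - (l + 1) := by omega
    rw [e1]
    exact mem_stepSpan hb hk (by omega)
  · rcases Nat.lt_or_ge (N + 1 - l) i with hli | hli
    · exact key (i - 1) (by omega) (hB.descProd_mul hli (by omega) (by omega))
    · obtain ⟨l, rfl⟩ : ∃ l', l = l' + 1 := ⟨l - 1, by omega⟩
      have e1 : N + 1 - (l + 1) = i := by omega
      have e2 : i + 1 = N + 1 - l := by omega
      have e3 : b * jm q S T (N + 1) ^ k * descProd T (N + 1 - (l + 1)) (l + 1) * T i =
          (q - 1) • (b * jm q S T (N + 1) ^ k * descProd T (N + 1 - (l + 1)) (l + 1)) +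
          q • (b * jm q S T (N + 1) ^ k * descProd T (N + 1 - l) l) := by
        rw [e1, descProd_succ', e2]
        simp only [mul_assoc, h.quad i hi, mul_add, mul_smul_comm, mul_one]
      rw [e3]
      exact Submodule.add_mem _ (Submodule.smul_mem _ _ (mem_stepSpan hb hk hl))
        (Submodule.smul_mem _ _ (mem_stepSpan hb hk (by omega)))

theorem descProd_commute_S {l : ℕ} (hl : l ≤ N) :
    descProd T (N + 1 - l) l * S = S * descProd T (N + 1 - l) l := by
  have : ∀ k j, 0 < j → j + k ≤ N + 1 → Commute S (descProd T j k) := by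
    intro k j hj hk
    induction k with
    | zero => simp
    | succ k ih =>
      rw [descProd_succ]
      exact (h.commS _ (by omega) (by omega)).mul_right (ih (by omega))
  exact (this l _ (by omega) (by omega)).eq.symm

theorem properSpan_mul_S {y : A} (hy : y ∈ properSpan (F := F) S T N) :
    y * S ∈ properSpan (F := F) S T N := by
  refine mul_mem_of_mem_span ?_ hy
  rintro x ⟨b, hb, l, hl, rfl⟩
  rw [mul_assoc, h.descProd_commute_S hl, ← mul_assoc]
  exact Submodule.subset_span
    ⟨_, (levelAlg F S T N).mul_mem hb (S_mem_levelAlg N), l, hl, rfl⟩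

theorem pow_mul_properSpan {y : A} (hy : y ∈ properSpan (F := F) S T N) {k m : ℕ} (hk : k < m) :
    jm q S T (N + 1) ^ k * y ∈ stepSpan q S T N m := by
  refine mul_mem_of_mem_span' ?_ hy
  rintro x ⟨b, hb, l, hl, rfl⟩
  rw [← mul_assoc, h.commute_pow_levelAlg hb]
  exact mem_stepSpan hb hk (by omega)

/-- `T_N⁻¹ ⋯ T_0⁻¹` agrees with `q^{-(N+1)} T_N ⋯ T_0` up to shorter products. -/
theorem descProd_heckeInv_sub_mem :
    descProd (fun i => heckeInv q (T i)) 0 (N + 1) - (q ^ (N + 1))⁻¹ • descProd T 0 (N + 1) ∈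
      properSpan (F := F) S T N := by
  induction N with
  | zero =>
    have e : descProd (fun i => heckeInv q (T i)) 0 (0 + 1) -
        (q ^ (0 + 1))⁻¹ • descProd T 0 (0 + 1) = (-(q⁻¹ * (q - 1))) • (1 : A) := by
      simp only [descProd_succ, descProd_zero, mul_one, heckeInv, zero_add, pow_one, smul_sub,
        sub_sub_cancel_left, smul_smul, neg_smul]
    rw [e]
    refine Submodule.smul_mem _ _ (Submodule.subset_span
      ⟨1, (levelAlg F S T 0).one_mem, 0, le_rfl, by simp⟩)
  | succ N ih =>
    have ih := ih (h.mono (by omega))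
    set v := descProd (fun i => heckeInv q (T i)) 0 (N + 1)
    set u := descProd T 0 (N + 1)
    have hv : v ∈ levelAlg F S T (N + 1) :=
      descProd_mem fun i hi => heckeInv_mem (T_mem_levelAlg (by omega))
    have e : descProd (fun i => heckeInv q (T i)) 0 (N + 1 + 1) -
        (q ^ (N + 1 + 1))⁻¹ • descProd T 0 (N + 1 + 1) =
        q⁻¹ • (T (N + 1) * (v - (q ^ (N + 1))⁻¹ • u)) + (-(q⁻¹ * (q - 1))) • (v * 1) := by
      have e1 : heckeInv q (T (N + 1)) * v = q⁻¹ • (T (N + 1) * v) - (q⁻¹ * (q - 1)) • v := by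
        rw [heckeInv, smul_mul_assoc, sub_mul, smul_mul_assoc, one_mul, smul_sub, smul_smul]
      rw [descProd_succ, descProd_succ T, zero_add, e1, mul_sub (T (N + 1)), smul_sub, mul_smul_comm,
        smul_smul, pow_succ q (N + 1), mul_inv, mul_comm (q ^ (N + 1))⁻¹, mul_one, neg_smul]
      abel
    rw [e]
    refine Submodule.add_mem _ (Submodule.smul_mem _ _ ?_) (Submodule.smul_mem _ _ ?_)
    · refine mul_mem_of_mem_span' ?_ ih
      rintro x ⟨b, hb, l, hl, rfl⟩
      have hc : Commute (T (N + 1)) b := commute_levelAlg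
        (h.commS _ (by omega) (by omega)).symm
        (fun i hi => (h.comm i _ (by omega) (by omega)).symm) hb
      have hb' : b ∈ levelAlg F S T (N + 1) :=
        Algebra.adjoin_mono (Set.insert_subset_insert
          (Set.image_mono (Set.Iio_subset_Iio (Nat.le_succ N)))) hb
      refine Submodule.subset_span ⟨b, hb', l + 1, by omega, ?_⟩
      rw [← mul_assoc, hc.eq, mul_assoc, descProd_succ]
      have e1 : N + 1 + 1 - (l + 1) = N + 1 - l := by omega
      have e2 : N + 1 - l + l = N + 1 := by omega
      rw [e1, e2]
    · exact Submodule.subset_span ⟨v, hv, 0, by omega, by simp⟩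

/-- Right multiplication by `S` raises the degree in the last Jucys--Murphy element by at most
one. -/
theorem stepSpan_mul_S (hq : q ≠ 0) {m : ℕ} {x : A} (hx : x ∈ stepSpan q S T N m) :
    x * S ∈ stepSpan q S T N (m + 1) := by
  refine mul_mem_of_mem_span ?_ hx
  rintro x ⟨b, hb, k, hk, l, hl, rfl⟩
  rcases Nat.lt_or_ge N l with hlN | hlN
  · obtain rfl : l = N + 1 := by omega
    have h1 := h.descProd_heckeInv_sub_mem
    have h2 := h.descProd_mul_S hq le_rfl
    set v := descProd (fun i => heckeInv q (T i)) 0 (N + 1)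
    set u := descProd T 0 (N + 1)
    have e : b * jm q S T (N + 1) ^ k * descProd T (N + 1 - (N + 1)) (N + 1) * S =
        b * jm q S T (N + 1) ^ (k + 1) * descProd T (N + 1 - (N + 1)) (N + 1) +
        q ^ (N + 1) • (b * (jm q S T (N + 1) ^ (k + 1) * (v - (q ^ (N + 1))⁻¹ • u))) := by
      rw [Nat.sub_self, mul_assoc, h2]
      simp only [mul_sub, smul_sub, mul_smul_comm, smul_smul,
        mul_inv_cancel₀ (pow_ne_zero (N + 1) hq), one_smul,
        pow_succ (jm q S T (N + 1)), mul_assoc]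
      abel
    rw [e]
    exact Submodule.add_mem _ (mem_stepSpan hb (by omega) hl) (Submodule.smul_mem _ _
      (mul_stepSpan hb (h.pow_mul_properSpan h1 (by omega))))
  · rw [mul_assoc, h.descProd_commute_S hlN, ← mul_assoc, mul_assoc b,
      h.commute_pow_levelAlg (S_mem_levelAlg N), ← mul_assoc]
    exact mem_stepSpan ((levelAlg F S T N).mul_mem hb (S_mem_levelAlg N)) (by omega) hl

theorem descProd_mul_pow_mem (hq : q ≠ 0) (m : ℕ) :
    descProd T 0 (N + 1) * S ^ m ∈ stepSpan q S T N (m + 1) := by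
  induction m with
  | zero =>
    have := mem_stepSpan (q := q) (T := T) (levelAlg F S T N).one_mem (k := 0) (m := 1)
      one_pos (le_refl (N + 1))
    simpa using this
  | succ m ih => rw [pow_succ, ← mul_assoc]; exact h.stepSpan_mul_S hq ih

/-- The leading term of `T_N ⋯ T_0 S^m` with respect to the last Jucys--Murphy element. -/
theorem descProd_mul_pow_sub_mem (hq : q ≠ 0) (m : ℕ) :
    descProd T 0 (N + 1) * S ^ (m + 1) - q ^ (N + 1) •
      (jm q S T (N + 1) ^ (m + 1) * descProd (fun i => heckeInv q (T i)) 0 (N + 1)) ∈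
      stepSpan q S T N (m + 1) := by
  have h1 := h.descProd_heckeInv_sub_mem
  have h2 := h.descProd_mul_S hq le_rfl
  induction m with
  | zero => simp [h2]
  | succ m ih =>
    set v := descProd (fun i => heckeInv q (T i)) 0 (N + 1)
    set u := descProd T 0 (N + 1)
    set X := jm q S T (N + 1) with hX
    have e : u * S ^ (m + 1 + 1) - q ^ (N + 1) • (X ^ (m + 1 + 1) * v) =
        (u * S ^ (m + 1) - q ^ (N + 1) • (X ^ (m + 1) * v)) * S +
        q ^ (N + 1) • (X ^ (m + 1) * ((v - (q ^ (N + 1))⁻¹ • u) * S)) := by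
      have e1 : X ^ (m + 1) * (u * S) = q ^ (N + 1) • (X ^ (m + 1 + 1) * v) := by
        rw [h2, mul_smul_comm, ← mul_assoc, ← pow_succ]
      simp only [sub_mul, mul_sub, smul_sub, mul_smul_comm, smul_mul_assoc, smul_smul, mul_assoc,
        e1, pow_succ S (m + 1)]
      rw [mul_inv_cancel_left₀ (pow_ne_zero _ hq)]
      abel
    rw [e]
    exact Submodule.add_mem _ (h.stepSpan_mul_S hq ih) (Submodule.smul_mem _ _
      (h.pow_mul_properSpan (h.properSpan_mul_S h1) (by omega)))

theorem mem_of_mul_descProd_heckeInv_mem (hq : q ≠ 0) {m k j : ℕ} (hj : j + k ≤ N + 1) {z : A}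
    (hz : z * descProd (fun i => heckeInv q (T i)) j k ∈ stepSpan q S T N m) :
    z ∈ stepSpan q S T N m := by
  induction k generalizing j with
  | zero => simpa using hz
  | succ k ih =>
    refine ih (j := j + 1) (by omega) ?_
    have := h.stepSpan_mul_T (i := j) (by omega) hz
    rwa [descProd_succ', mul_assoc, mul_assoc, heckeInv_mul hq (h.quad j (by omega)),
      mul_one] at this

/-- The reduction of the power `X^r` of the last Jucys--Murphy element, where `r = deg f`. -/
theorem jm_pow_mem (hq : q ≠ 0) (hf : f.Monic) (hr : 0 < f.natDegree) :
    jm q S T (N + 1) ^ f.natDegree ∈ stepSpan q S T N f.natDegree := by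
  obtain ⟨m, hm⟩ : ∃ m, f.natDegree = m + 1 := ⟨f.natDegree - 1, by omega⟩
  have h1 := h.descProd_mul_pow_sub_mem hq m
  have h2 : descProd T 0 (N + 1) * S ^ (m + 1) ∈ stepSpan q S T N (m + 1) := by
    have h0 := congrArg (descProd T 0 (N + 1) * ·) h.cyclo
    simp only [mul_zero] at h0
    rw [aeval_eq_sum_range, Finset.sum_range_succ, hf.coeff_natDegree, one_smul, mul_add,
      add_eq_zero_iff_eq_neg', hm] at h0
    rw [h0, Finset.mul_sum]
    refine Submodule.neg_mem _ (Submodule.sum_mem _ fun k hk => ?_)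
    rw [mul_smul_comm]
    refine Submodule.smul_mem _ _ (stepSpan_mono ?_ (h.descProd_mul_pow_mem hq k))
    have := Finset.mem_range.1 hk
    omega
  have h3 := Submodule.sub_mem _ h2 h1
  rw [sub_sub_cancel] at h3
  have h4 := Submodule.smul_mem _ (q ^ (N + 1))⁻¹ h3
  rw [smul_smul, inv_mul_cancel₀ (pow_ne_zero _ hq), one_smul] at h4
  rw [hm]
  exact h.mem_of_mul_descProd_heckeInv_mem hq (by omega) h4

theorem levelAlg_succ_le (hq : q ≠ 0) (hf : f.Monic) (hr : 0 < f.natDegree) {x : A}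
    (hx : x ∈ levelAlg F S T (N + 1)) : x ∈ stepSpan q S T N f.natDegree := by
  have hTw : ∀ j k : ℕ, j + k ≤ N + 1 → ∀ y ∈ stepSpan q S T N f.natDegree,
      y * descProd T j k ∈ stepSpan q S T N f.natDegree := by
    intro j k hk
    induction k with
    | zero => intro y hy; simpa using hy
    | succ k ih =>
      intro y hy
      rw [descProd_succ, ← mul_assoc]
      exact ih (by omega) _ (h.stepSpan_mul_T (by omega) hy)
  have hle : stepSpan q S T N (f.natDegree + 1) ≤ stepSpan q S T N f.natDegree := by
    refine Submodule.span_le.2 ?_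
    rintro x ⟨b, hb, k, hk, l, hl, rfl⟩
    rcases Nat.lt_succ_iff_lt_or_eq.1 hk with hk | rfl
    · exact mem_stepSpan hb hk hl
    · exact hTw _ _ (by omega) _ (mul_stepSpan hb (h.jm_pow_mem hq hf hr))
  have h1 : (1 : A) ∈ stepSpan q S T N f.natDegree := by
    have := mem_stepSpan (q := q) (T := T) (levelAlg F S T N).one_mem (k := 0) hr
      (Nat.zero_le (N + 1))
    simpa using this
  have key : ∀ y ∈ stepSpan q S T N f.natDegree, y * x ∈ stepSpan q S T N f.natDegree := by
    induction hx using Algebra.adjoin_induction with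
    | mem x hx =>
      intro y hy
      rcases hx with rfl | ⟨i, hi, rfl⟩
      · exact hle (h.stepSpan_mul_S hq hy)
      · exact h.stepSpan_mul_T hi hy
    | algebraMap r =>
      intro y hy
      rw [← Algebra.commutes, ← Algebra.smul_def]
      exact Submodule.smul_mem _ _ hy
    | add a b _ _ ha hb =>
      intro y hy
      rw [mul_add]
      exact Submodule.add_mem _ (ha y hy) (hb y hy)
    | mul a b _ _ ha hb =>
      intro y hy
      rw [← mul_assoc]
      exact hb _ (ha y hy)
  simpa using key 1 h1

end AKSystem

/-- The product `X_1^{m_0} ⋯ X_{N+1}^{m_N}`. -/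
def jmProd (q : F) (S : A) (T : ℕ → A) (N : ℕ) (m : ℕ → ℕ) : A :=
  (List.ofFn fun a : Fin (N + 1) => jm q S T a ^ m a).prod

theorem jmProd_succ (N : ℕ) (m : ℕ → ℕ) :
    jmProd q S T (N + 1) m = jmProd q S T N m * jm q S T (N + 1) ^ m (N + 1) := by
  rw [jmProd, List.ofFn_succ', List.concat_eq_append, List.prod_append, List.prod_singleton]
  rfl

theorem jmProd_congr {m m' : ℕ → ℕ} (hm : ∀ a ≤ N, m a = m' a) :
    jmProd q S T N m = jmProd q S T N m' := by
  rw [jmProd, jmProd]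
  congr 2
  funext a
  rw [hm a (by omega)]

/-- The elements `X_1^{m_1} ⋯ X_n^{m_n} T_u`, with exponents below the degree of the cyclotomic
polynomial and with normal form words `u`, span the algebra. -/
theorem AKSystem.levelAlg_le_span (h : AKSystem q f N S T) (hq : q ≠ 0) (hf : f.Monic)
    (hr : 0 < f.natDegree) {x : A} (hx : x ∈ levelAlg F S T N) :
    x ∈ Submodule.span F {x | ∃ m : ℕ → ℕ, (∀ a, m a < f.natDegree) ∧ ∃ u ∈ normalWords N,
      x = jmProd q S T N m * (u.map T).prod} := by
  induction N generalizing x with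
  | zero =>
    have hx' : x ∈ Algebra.adjoin F {S} := by simpa [levelAlg] using hx
    rw [Algebra.adjoin_singleton_eq_range_aeval] at hx'
    obtain ⟨g, rfl⟩ := hx'
    have e : aeval S g = aeval S (g %ₘ f) := by
      conv_lhs => rw [← modByMonic_add_div g f]
      rw [map_add, map_mul, h.cyclo, zero_mul, add_zero]
    change aeval S g ∈ _
    rw [e, aeval_eq_sum_range' (natDegree_modByMonic_lt g hf (by rintro rfl; simp at hr))]
    refine Submodule.sum_mem _ fun k hk => Submodule.smul_mem _ _ (Submodule.subset_span ?_)
    exact ⟨fun _ => k, fun _ => Finset.mem_range.1 hk, [], by simp [normalWords],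
      by simp [jmProd, jm]⟩
  | succ N ih =>
    have hB := h.braidSystem
    have hx' := h.levelAlg_succ_le hq hf hr hx
    refine Submodule.span_le.2 ?_ hx'
    rintro x ⟨b, hb, k, hk, l, hl, rfl⟩
    rw [mul_assoc]
    refine mul_mem_of_mem_span ?_ (ih (h.mono (Nat.le_succ N)) hb)
    rintro x ⟨m, hm, u, hu, rfl⟩
    refine Submodule.subset_span ⟨Function.update m (N + 1) k, ?_,
      u ++ descList (N + 1 - l) l, mem_normalWords_succ.2 ⟨u, hu, l, hl, rfl⟩, ?_⟩
    · intro a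
      rcases eq_or_ne a (N + 1) with rfl | ha
      · simpa using hk
      · simpa [ha] using hm a
    · have hTu : (u.map T).prod ∈ levelAlg F S T N :=
        (levelAlg F S T N).list_prod_mem fun y hy => by
          obtain ⟨i, hi, rfl⟩ := List.mem_map.1 hy
          exact T_mem_levelAlg (lt_of_mem_normalWords hu i hi)
      have hm' : jmProd q S T N (Function.update m (N + 1) k) = jmProd q S T N m :=
        jmProd_congr fun a ha => Function.update_of_ne (by omega) _ _
      rw [jmProd_succ, Function.update_self, hm', List.map_append, List.prod_append,
        mul_assoc, mul_assoc, ← mul_assoc (u.map T).prod, ← h.commute_pow_levelAlg hTu k]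
      simp only [mul_assoc]
      rfl

end Spanning

/-! ### The module induced from one strand fewer -/

section Induced

variable {F H V : Type*} [Field F] [Ring H] [Algebra F H] [AddCommGroup V] [Module F V]

/-- `STS^kT - TS^kTS = (q-1)(STS^k - S^kTS)`. -/
theorem AKSystem.braidS_pow {q : F} {f : F[X]} {N : ℕ} {s : H} {τ : ℕ → H} (hq : q ≠ 0)
    (h : AKSystem q f N s τ) (hN : 0 < N) (k : ℕ) :
    s * τ 0 * s ^ k * τ 0 - τ 0 * s ^ k * τ 0 * s =
      (q - 1) • (s * τ 0 * s ^ k - s ^ k * τ 0 * s) := by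
  have hb := h.braidS hN
  have ht := h.quad 0 hN
  set t := τ 0
  induction k with
  | zero =>
    simp only [pow_zero, mul_one, one_mul, mul_assoc, ht]
    simp only [mul_add, add_mul, mul_smul_comm, smul_mul_assoc, mul_one, one_mul]
    module
  | succ k ih =>
    have hc : Commute s (t * s * t) := by
      show s * (t * s * t) = t * s * t * s
      rw [← hb]; simp only [mul_assoc]
    have hcp : s ^ k * (t * s * t) = t * s * t * s ^ k := (hc.pow_left k).eq
    have hcp' : s ^ (k + 1) * (t * s * t) = t * s * t * s ^ (k + 1) := (hc.pow_left (k + 1)).eq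
    have hti : heckeInv q t * t = 1 := heckeInv_mul hq ht
    -- `T S^k S T = (T S^k T⁻¹)(T S T)`
    have e1 : q • (t * s ^ (k + 1) * t) =
        (t * s ^ k * t - (q - 1) • (t * s ^ k)) * (t * s * t) := by
      have : q • (t * s ^ (k + 1) * t) = t * s ^ k * (q • heckeInv q t) * (t * s * t) := by
        rw [mul_smul_comm, smul_mul_assoc, mul_assoc (t * s ^ k), ← mul_assoc (heckeInv q t),
          ← mul_assoc (heckeInv q t), hti, one_mul, pow_succ]
        simp only [mul_assoc]
      rw [this, heckeInv, smul_smul, mul_inv_cancel₀ hq, one_smul, mul_sub, mul_smul_comm,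
        mul_one]
    have hZ : t * (t * s * t) = (q - 1) • (t * s * t) + q • (s * t) := by
      rw [← mul_assoc, ← mul_assoc, ht]
      simp only [add_mul, smul_mul_assoc, one_mul]
    have e2 : q • (s * (t * s ^ (k + 1) * t) - t * s ^ (k + 1) * t * s) =
        (s * t * s ^ k * t - t * s ^ k * t * s) * (t * s * t) -
        (q - 1) • (s * t * s ^ k - t * s ^ (k + 1)) * (t * s * t) := by
      rw [smul_sub, ← mul_smul_comm, ← smul_mul_assoc q (t * s ^ (k + 1) * t), e1,
        mul_assoc _ (t * s * t) s, ← hc.eq, pow_succ]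
      simp only [mul_sub, sub_mul, smul_mul_assoc, mul_smul_comm, smul_sub, mul_assoc]
      abel
    have e3 : t * s ^ (k + 1) * (t * s * t) =
        (q - 1) • (t * s * t * s ^ (k + 1)) + q • (s * t * s ^ (k + 1)) := by
      rw [mul_assoc, hcp', ← mul_assoc, hZ, add_mul, smul_mul_assoc, smul_mul_assoc]
    have e4 : s ^ k * t * s * (t * s * t) =
        (q - 1) • (t * s * t * s ^ (k + 1)) + q • (s ^ (k + 1) * t * s) := by
      rw [mul_assoc _ s, hc.eq, ← mul_assoc, mul_assoc _ t, hZ, mul_add, mul_smul_comm, hcp,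
        add_mul, smul_mul_assoc, mul_assoc (t * s * t), ← pow_succ, mul_smul_comm,
        smul_mul_assoc, ← mul_assoc (s ^ k), ← pow_succ]
    rw [ih] at e2
    have e5 : q • (s * (t * s ^ (k + 1) * t) - t * s ^ (k + 1) * t * s) =
        q • ((q - 1) • (s * t * s ^ (k + 1) - s ^ (k + 1) * t * s)) := by
      rw [e2, ← sub_mul, ← smul_sub, sub_sub_sub_cancel_left, smul_mul_assoc, sub_mul, e3, e4]
      module
    have := (smul_right_injective H hq) e5
    rw [← this]
    simp only [mul_assoc]

/-- The product `D_j = T_{j-2}⁻¹ ⋯ T_0⁻¹` (for `j ≥ 1`). -/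
def downInv (q : F) (τ : ℕ → H) (j : ℕ) : H := descProd (fun i => heckeInv q (τ i)) 0 (j - 1)

namespace AKSystem

variable {q : F} {f : F[X]} {N : ℕ} {s : H} {τ : ℕ → H} (h : AKSystem q f N s τ)
include h

theorem braidSystem_heckeInv (hq : q ≠ 0) : BraidSystem N fun i => heckeInv q (τ i) where
  comm i j hij hj := commute_heckeInv (commute_heckeInv (h.comm i j hij hj).symm).symm
  braid i hi := by
    let u := heckeUnit hq (h.quad i (by omega))
    let v := heckeUnit hq (h.quad (i + 1) hi)
    have e : u * v * u = v * u * v := Units.ext (h.braid i hi)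
    have e' := congrArg (fun w : Hˣ => ((w⁻¹ : Hˣ) : H)) e
    simp only [mul_inv_rev, Units.val_mul, ← mul_assoc] at e'
    exact e'

theorem downInv_mul_of_lt {i j : ℕ} (hij : j < i) (hi : i ≤ N) :
    downInv q τ j * τ (i - 1) = τ (i - 1) * downInv q τ j := by
  have : ∀ k ≤ j - 1, Commute (τ (i - 1)) (descProd (fun i => heckeInv q (τ i)) 0 k) := by
    intro k hk
    induction k with
    | zero => simp
    | succ k ih =>
      rw [descProd_succ]
      exact (commute_heckeInv (h.comm _ _ (by omega) (by omega)).symm).mul_right (ih (by omega))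
  exact (this _ le_rfl).eq.symm

theorem downInv_mul (hq : q ≠ 0) {i j : ℕ} (hi : 0 < i) (hij : i + 1 < j) (hj : j ≤ N + 1) :
    downInv q τ j * τ i = τ (i - 1) * downInv q τ j := by
  have h1 := (h.braidSystem_heckeInv hq).descProd_mul (i := i) (j := 0) (k := j - 1) hi
    (by omega) (by omega)
  have e : ∀ t : H, t = q • heckeInv q t + (q - 1) • 1 := by
    intro t
    rw [heckeInv, smul_smul, mul_inv_cancel₀ hq, one_smul, sub_add_cancel]
  rw [e (τ i), e (τ (i - 1)), mul_add, add_mul, mul_smul_comm, smul_mul_assoc, downInv, h1]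
  simp

theorem mul_downInv (hq : q ≠ 0) {j : ℕ} (hj : j < N) :
    τ j * downInv q τ (j + 2) = downInv q τ (j + 1) := by
  rw [downInv, downInv, Nat.add_sub_cancel, show j + 2 - 1 = j + 1 by omega, descProd_succ,
    zero_add, ← mul_assoc, mul_heckeInv hq (h.quad j hj), one_mul]

/-- `D_j T_0` commutes with `S`, because `D_j` is a product of letters `T_i⁻¹` with `i > 0` and of
`T_0⁻¹`. -/
theorem downInv_mul_zero (hq : q ≠ 0) {j : ℕ} (hj : 2 ≤ j) (hjN : j ≤ N + 1) :
    s * (downInv q τ j * τ 0) = downInv q τ j * (τ 0 * s) ∧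
      Commute s (descProd (fun i => heckeInv q (τ i)) 1 (j - 2)) ∧
      downInv q τ j = descProd (fun i => heckeInv q (τ i)) 1 (j - 2) * heckeInv q (τ 0) := by
  have hD : downInv q τ j =
      descProd (fun i => heckeInv q (τ i)) 1 (j - 2) * heckeInv q (τ 0) := by
    rw [downInv, show j - 1 = j - 2 + 1 by omega, descProd_succ']
  have hc : ∀ k ≤ j - 2, Commute s (descProd (fun i => heckeInv q (τ i)) 1 k) := by
    intro k hk
    induction k with
    | zero => simp
    | succ k ih =>
      rw [descProd_succ]
      exact (commute_heckeInv (h.commS _ (by omega) (by omega))).mul_right (ih (by omega))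
  refine ⟨?_, hc _ le_rfl, hD⟩
  have hti := heckeInv_mul hq (h.quad 0 (by omega))
  rw [hD, ← mul_assoc (_ * _) (τ 0) s, mul_assoc _ (heckeInv q (τ 0)), hti, mul_one]
  exact (hc _ le_rfl).eq

theorem mul_downInv_pow_mul (hq : q ≠ 0) {j : ℕ} (hj : 2 ≤ j) (hjN : j ≤ N + 1) (k : ℕ) :
    downInv q τ j * (s ^ k * (τ 0 * s)) = s * (downInv q τ j * (s ^ k * τ 0)) -
      (q - 1) • (s * (downInv q τ j * s ^ k) - s * (s ^ k * downInv q τ j)) := by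
  obtain ⟨-, hc, hD⟩ := h.downInv_mul_zero hq hj hjN
  have hK := h.braidS_pow hq (by omega) k
  have hck : s ^ k * descProd (fun i => heckeInv q (τ i)) 1 (j - 2) =
      descProd (fun i => heckeInv q (τ i)) 1 (j - 2) * s ^ k := (hc.pow_left k).eq
  set E := descProd (fun i => heckeInv q (τ i)) 1 (j - 2)
  set t := τ 0
  set y := heckeInv q t with hy
  have hyz : ∀ z, q • (y * z) = t * z - (q - 1) • z := fun z => by
    rw [hy, heckeInv, smul_mul_assoc, smul_smul, mul_inv_cancel₀ hq, one_smul, sub_mul,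
      smul_mul_assoc, one_mul]
  have hzy : ∀ z, q • (z * y) = z * t - (q - 1) • z := fun z => by
    rw [hy, heckeInv, mul_smul_comm, smul_smul, mul_inv_cancel₀ hq, one_smul, mul_sub,
      mul_smul_comm, mul_one]
  have e : y * (s ^ k * (t * s)) = s * (y * (s ^ k * t)) -
      (q - 1) • (s * (y * s ^ k) - s * (s ^ k * y)) := by
    refine smul_right_injective H hq ?_
    have e1 : t * s ^ k * t * s = s * t * s ^ k * t -
        (q - 1) • (s * t * s ^ k - s ^ k * t * s) := by rw [← hK]; abel
    simp only [mul_assoc] at e1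
    show q • (y * (s ^ k * (t * s))) = q • (s * (y * (s ^ k * t)) -
      (q - 1) • (s * (y * s ^ k) - s * (s ^ k * y)))
    rw [smul_sub, smul_comm q (q - 1), smul_sub, hyz, ← mul_smul_comm q s (y * (s ^ k * t)), hyz,
      ← mul_smul_comm q s (y * s ^ k), hyz, ← mul_assoc s (s ^ k) y, hzy, e1]
    simp only [mul_sub, mul_smul_comm, mul_assoc]
    module
  rw [hD, mul_assoc, e, mul_sub, mul_smul_comm, mul_sub]
  simp only [← mul_assoc]
  rw [← hc.eq]
  simp only [mul_assoc]
  rw [← mul_assoc (s ^ k), hck]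
  simp only [mul_assoc]

end AKSystem

/-- Operators `S, T 0, …, T N` on a space spanned by vectors `w j k b`, which stand for
`T_{j-1}⁻¹ ⋯ T_0⁻¹ S^k T_0 ⋯ T_N b`, with `b` in an algebra `H` that carries a system `s, τ` one level
below. Here `j ≤ N + 1` and `k` is arbitrary. The rule for `S` is the formula
`S T_0⁻¹ S^k T_0 = T_0⁻¹ S^k T_0 S + (1 - q⁻¹) (S T_0 S^k - S^{k+1} T_0)`, and `root` is the relation
`f(S) = 0` on the vectors with `j = 0`. -/
structure InducedSystem (q : F) (f : F[X]) (N : ℕ) (s : H) (τ : ℕ → H)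
    (w : ℕ → ℕ → H →ₗ[F] V) (S : Module.End F V) (T : ℕ → Module.End F V) : Prop where
  mem_span : ∀ v, v ∈ Submodule.span F {u | ∃ j ≤ N + 1, ∃ k b, u = w j k b}
  T_lt : ∀ i j k b, i + 1 < j → j ≤ N + 1 → T i (w j k b) = w j k (τ i * b)
  T_pred : ∀ i j k b, i + 1 = j → j ≤ N + 1 → T i (w j k b) = w i k b
  T_self : ∀ i j k b, i = j → j < N + 1 → T i (w j k b) = (q - 1) • w i k b + q • w (i + 1) k b
  T_gt : ∀ i j k b, j < i → i < N + 1 → T i (w j k b) = w j k (τ (i - 1) * b)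
  S_zero : ∀ k b, S (w 0 k b) = w 0 (k + 1) b
  S_pos : ∀ j k b, 0 < j → j ≤ N + 1 → S (w j k b) = w j k (s * b) +
    (1 - q⁻¹) • (w 0 1 (downInv q τ j * (s ^ k * b)) - w 0 (k + 1) (downInv q τ j * b))
  root : ∀ k b, ∑ i ∈ Finset.range (f.natDegree + 1), f.coeff i • w 0 (i + k) b = 0

/-- An intertwiner for `s` and `S` is one for all polynomials in `s` and `S`. -/
theorem aeval_apply_of_intertwines {y : H →ₗ[F] V} {S : Module.End F V} {s : H}
    (hy : ∀ b, S (y b) = y (s * b)) (g : F[X]) (b : H) :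
    aeval S g (y b) = y (aeval s g * b) := by
  induction g using Polynomial.induction_on generalizing b with
  | C a => simp [Algebra.algebraMap_eq_smul_one]
  | add g g' hg hg' => simp [hg, hg', add_mul]
  | monomial n a ih =>
    rw [pow_succ, ← mul_assoc, map_mul (aeval S), map_mul (aeval s), aeval_X, aeval_X,
      Module.End.mul_apply, hy, ih, mul_assoc]

namespace InducedSystem

variable {q : F} {f : F[X]} {N : ℕ} {s : H} {τ : ℕ → H} {w : ℕ → ℕ → H →ₗ[F] V}
  {S : Module.End F V} {T : ℕ → Module.End F V}

theorem ext (R : InducedSystem q f N s τ w S T) (φ ψ : Module.End F V)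
    (hφ : ∀ j ≤ N + 1, ∀ k b, φ (w j k b) = ψ (w j k b)) : φ = ψ := by
  refine LinearMap.ext_on (eq_top_iff.2 fun v _ => R.mem_span v) ?_
  rintro _ ⟨j, hj, k, b, rfl⟩
  exact hφ j hj k b

/-- The vectors `w (N + 1) 0 b` generate the module. -/
theorem eq_top (R : InducedSystem q f N s τ w S T) (hq : q ≠ 0) (M : Submodule F V)
    (hS : ∀ v ∈ M, S v ∈ M) (hT : ∀ i < N + 1, ∀ v ∈ M, T i v ∈ M)
    (h1 : ∀ b, w (N + 1) 0 b ∈ M) : M = ⊤ := by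
  have h2 : ∀ c ≤ N + 1, ∀ b, w (N + 1 - c) 0 b ∈ M := by
    intro c
    induction c with
    | zero => exact fun _ => h1
    | succ c ih =>
      intro hc b
      rw [← R.T_pred (N + 1 - (c + 1)) (N + 1 - c) 0 b (by omega) (by omega)]
      exact hT _ (by omega) _ (ih (by omega) b)
  have h3 : ∀ k b, w 0 k b ∈ M := by
    intro k b
    induction k with
    | zero => simpa using h2 (N + 1) le_rfl b
    | succ k ih => rw [← R.S_zero]; exact hS _ ih
  have h4 : ∀ j ≤ N + 1, ∀ k b, w j k b ∈ M := by
    intro j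
    induction j with
    | zero => exact fun _ => h3
    | succ j ih =>
      intro hj k b
      have h5 := ih (by omega) k b
      have h6 := hT j (by omega) _ h5
      rw [R.T_self j j k b rfl (by omega)] at h6
      have h7 := M.sub_mem h6 (M.smul_mem (q - 1) h5)
      rw [add_sub_cancel_left] at h7
      have h8 := M.smul_mem q⁻¹ h7
      rwa [smul_smul, inv_mul_cancel₀ hq, one_smul] at h8
  refine eq_top_iff.2 fun v _ => Submodule.span_le.2 ?_ (R.mem_span v)
  rintro _ ⟨j, hj, k, b, rfl⟩
  exact h4 j hj k b

/-- The polynomial relation for `S`. The vectors `w j k b` with `j > 0` are corrected by vectors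
with `j = 0` to intertwiners for `s` and `S`. -/
theorem cyclo (R : InducedSystem q f N s τ w S T) (h : AKSystem q f N s τ) :
    aeval S f = 0 := by
  have hpow : ∀ i k b, (S ^ i) (w 0 k b) = w 0 (i + k) b := by
    intro i k b
    induction i with
    | zero => simp
    | succ i ih => rw [pow_succ', Module.End.mul_apply, ih, R.S_zero]; congr 2; omega
  have h0 : ∀ k b, aeval S f (w 0 k b) = 0 := by
    intro k b
    rw [aeval_eq_sum_range, LinearMap.sum_apply, ← R.root k b]
    exact Finset.sum_congr rfl fun i _ => by rw [LinearMap.smul_apply, hpow]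
  have hS : ∀ v, aeval S f v = 0 → aeval S f (S v) = 0 := by
    intro v hv
    have : aeval S f * S = S * aeval S f := by
      have : aeval S (f * X) = aeval S (X * f) := by rw [mul_comm]
      simpa only [map_mul, aeval_X] using this
    rw [← Module.End.mul_apply, this, Module.End.mul_apply, hv, map_zero]
  refine R.ext _ _ fun j hj k b => ?_
  rw [LinearMap.zero_apply]
  rcases Nat.eq_zero_or_pos j with rfl | hj0
  · exact h0 k b
  set D := downInv q τ j
  have hG : ∀ k, ∃ G : H →ₗ[F] V, (∀ b, aeval S f (G b) = 0) ∧
      ∀ b, G (s * b) = S (G b) + (w 0 1 (D * (s ^ k * b)) - w 0 (k + 1) (D * b)) := by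
    intro k
    induction k with
    | zero => exact ⟨0, by simp, by simp⟩
    | succ k ih =>
      obtain ⟨G, hG0, hG⟩ := ih
      refine ⟨(w 0 1) ∘ₗ LinearMap.mulLeft F (D * s ^ k) + S ∘ₗ G, fun b => ?_, fun b => ?_⟩
      · simp only [LinearMap.add_apply, LinearMap.comp_apply, map_add, h0, hS _ (hG0 b), add_zero]
      · simp only [LinearMap.add_apply, LinearMap.comp_apply, LinearMap.mulLeft_apply, hG, map_add,
          map_sub, R.S_zero, pow_succ, mul_assoc]
        abel
  obtain ⟨G, hG0, hG⟩ := hG k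
  have hy : ∀ b, S ((w j k + (1 - q⁻¹) • G) b) = (w j k + (1 - q⁻¹) • G) (s * b) := by
    intro b
    simp only [LinearMap.add_apply, LinearMap.smul_apply, map_add, map_smul, hG,
      R.S_pos j k b hj0 hj]
    module
  have := aeval_apply_of_intertwines hy f b
  rw [h.cyclo, zero_mul, map_zero, LinearMap.add_apply, LinearMap.smul_apply, map_add, map_smul,
    hG0, smul_zero, add_zero] at this
  exact this

theorem quad (R : InducedSystem q f N s τ w S T) (h : AKSystem q f N s τ) {i : ℕ}
    (hi : i < N + 1) : T i * T i = (q - 1) • T i + q • (1 : Module.End F V) := by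
  refine R.ext _ _ fun j hj k b => ?_
  simp only [Module.End.mul_apply, LinearMap.add_apply, LinearMap.smul_apply,
    Module.End.one_apply]
  have key : ∀ i < N, ∀ b, τ i * (τ i * b) = (q - 1) • (τ i * b) + q • b := by
    intro i hi b
    rw [← mul_assoc, h.quad i hi, add_mul, smul_mul_assoc, smul_mul_assoc, one_mul]
  rcases lt_trichotomy i j with hij | rfl | hij
  · rcases Nat.lt_or_ge (i + 1) j with hij' | hij'
    · rw [R.T_lt _ _ _ _ hij' hj, R.T_lt _ _ _ _ hij' hj, key i (by omega), map_add, map_smul,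
        map_smul]
    · obtain rfl : j = i + 1 := by omega
      rw [R.T_pred _ _ _ _ rfl hj, R.T_self _ _ _ _ rfl (by omega)]
  · rw [R.T_self _ _ _ _ rfl hi, map_add, map_smul, map_smul, R.T_self _ _ _ _ rfl hi,
      R.T_pred _ _ _ _ rfl (by omega)]
  · rw [R.T_gt _ _ _ _ hij hi, R.T_gt _ _ _ _ hij hi, key (i - 1) (by omega), map_add, map_smul,
      map_smul]

theorem comm (R : InducedSystem q f N s τ w S T) (h : AKSystem q f N s τ) {i l : ℕ}
    (hil : i + 1 < l) (hl : l < N + 1) : Commute (T i) (T l) := by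
  refine R.ext _ _ fun j hj k b => ?_
  simp only [Module.End.mul_apply]
  have key : ∀ i l, i + 1 < l → l < N → ∀ b, τ i * (τ l * b) = τ l * (τ i * b) := by
    intro i l hil hl b
    rw [← mul_assoc, (h.comm i l hil hl).eq, mul_assoc]
  obtain hc | hc | hc | hc | hc | hc | hc : j < i ∨ j = i ∨ j = i + 1 ∨ (i + 1 < j ∧ j < l) ∨
    j = l ∨ j = l + 1 ∨ l + 1 < j := by omega
  · simp (disch := omega) only [R.T_gt]
    rw [key _ _ (by omega) (by omega)]
  · subst hc
    simp (disch := omega) only [R.T_gt, R.T_self, map_add, map_smul]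
  · subst hc
    simp (disch := omega) only [R.T_gt, R.T_pred]
  · simp (disch := omega) only [R.T_gt, R.T_lt]
    rw [key _ _ (by omega) (by omega)]
  · subst hc
    simp (disch := omega) only [R.T_lt, R.T_self, map_add, map_smul]
  · subst hc
    simp (disch := omega) only [R.T_lt, R.T_pred]
  · simp (disch := omega) only [R.T_lt]
    rw [key _ _ (by omega) (by omega)]

theorem braid (R : InducedSystem q f N s τ w S T) (h : AKSystem q f N s τ) {i : ℕ}
    (hi : i + 1 < N + 1) : T i * T (i + 1) * T i = T (i + 1) * T i * T (i + 1) := by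
  refine R.ext _ _ fun j hj k b => ?_
  simp only [Module.End.mul_apply]
  have key : ∀ i, i + 1 < N → ∀ b,
      τ i * (τ (i + 1) * (τ i * b)) = τ (i + 1) * (τ i * (τ (i + 1) * b)) := by
    intro i hi b
    simp only [← mul_assoc, h.braid i hi]
  obtain hc | hc | hc | hc | hc : j < i ∨ j = i ∨ j = i + 1 ∨ j = i + 2 ∨ i + 2 < j := by omega
  · simp (disch := omega) only [R.T_gt]
    obtain ⟨i, rfl⟩ : ∃ i', i = i' + 1 := ⟨i - 1, by omega⟩
    simp only [Nat.add_sub_cancel]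
    rw [key i (by omega)]
  · subst hc
    have e : τ j * (τ j * b) = (q - 1) • (τ j * b) + q • b := by
      rw [← mul_assoc, h.quad j (by omega), add_mul, smul_mul_assoc, smul_mul_assoc, one_mul]
    simp (disch := omega) only [R.T_gt, R.T_self, R.T_pred, R.T_lt, map_add, map_smul,
      Nat.add_sub_cancel, e]
    module
  · subst hc
    simp (disch := omega) only [R.T_gt, R.T_self, R.T_pred, R.T_lt, map_add, map_smul,
      Nat.add_sub_cancel]
  · subst hc
    simp (disch := omega) only [R.T_gt, R.T_pred, R.T_lt, Nat.add_sub_cancel]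
  · simp (disch := omega) only [R.T_lt, key]

theorem commS (R : InducedSystem q f N s τ w S T) (hq : q ≠ 0) (h : AKSystem q f N s τ) {i : ℕ}
    (hi : i < N + 1) (hi0 : 0 < i) : Commute S (T i) := by
  have key : ∀ i < N, 0 < i → ∀ k b, s ^ k * (τ i * b) = τ i * (s ^ k * b) := by
    intro i hi hi0 k b
    rw [← mul_assoc, ((h.commS i hi hi0).pow_left k).eq, mul_assoc]
  have key1 : ∀ i < N, 0 < i → ∀ b, s * (τ i * b) = τ i * (s * b) := by
    intro i hi hi0 b
    rw [← mul_assoc, (h.commS i hi hi0).eq, mul_assoc]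
  -- the case `j = i + 1`
  have hpred : ∀ k b, S (T i (w (i + 1) k b)) = T i (S (w (i + 1) k b)) := by
    intro k b
    have e : ∀ b, downInv q τ i * b = τ (i - 1) * (downInv q τ (i + 1) * b) := by
      intro b
      have := h.mul_downInv hq (show i - 1 < N by omega)
      rw [show i - 1 + 2 = i + 1 by omega, Nat.sub_add_cancel hi0] at this
      rw [← mul_assoc, this]
    simp (disch := omega) only [R.T_pred, R.S_pos, map_add, map_smul, map_sub, R.T_gt, e]
  refine R.ext _ _ fun j hj k b => ?_
  simp only [Module.End.mul_apply]
  obtain hc | hc | hc | hc | hc : j = 0 ∨ (0 < j ∧ j < i) ∨ j = i ∨ j = i + 1 ∨ i + 1 < j := by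
    omega
  · subst hc
    simp (disch := omega) only [R.T_gt, R.S_zero]
  · have e : ∀ b, downInv q τ j * (τ (i - 1) * b) = τ (i - 1) * (downInv q τ j * b) := by
      intro b
      rw [← mul_assoc, h.downInv_mul_of_lt hc.2 (by omega), mul_assoc]
    simp (disch := omega) only [R.T_gt, R.S_pos, map_add, map_smul, map_sub]
    rw [key _ (by omega) (by omega), key1 _ (by omega) (by omega), e, e]
  · -- as `w i k b = T_i (w (i + 1) k b)`, the quadratic relation reduces this to `j = i + 1`
    subst hc
    have e : w j k b = T j (w (j + 1) k b) := (R.T_pred _ _ _ _ rfl (by omega)).symm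
    have hquad : ∀ v, T j (T j v) = (q - 1) • T j v + q • v := fun v => by
      rw [← Module.End.mul_apply, R.quad h hi]
      rfl
    rw [e, hquad, map_add, map_smul, map_smul, hpred, hquad]
  · subst hc
    exact hpred k b
  · have e : ∀ b, downInv q τ j * (τ i * b) = τ (i - 1) * (downInv q τ j * b) := by
      intro b
      rw [← mul_assoc, h.downInv_mul hq hi0 hc (by omega), mul_assoc]
    simp (disch := omega) only [R.T_gt, R.T_lt, R.S_pos, map_add, map_smul, map_sub]
    rw [key _ (by omega) (by omega), key1 _ (by omega) (by omega), e, e]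

theorem braidS (R : InducedSystem q f N s τ w S T) (hq : q ≠ 0) (h : AKSystem q f N s τ) :
    S * T 0 * S * T 0 = T 0 * S * T 0 * S := by
  have hD1 : ∀ b, downInv q τ 1 * b = b := fun b => by simp [downInv]
  -- the case `j = 1`
  have hone : ∀ k b, S (T 0 (S (T 0 (w 1 k b)))) = T 0 (S (T 0 (S (w 1 k b)))) := by
    intro k b
    simp (disch := omega) only [R.T_pred, R.T_self, R.S_zero, R.S_pos, map_add, map_smul, map_sub,
      hD1, pow_one, zero_add, ← mul_assoc, ← pow_succ']
    match_scalars <;> field_simp <;> ring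
  refine R.ext _ _ fun j hj k b => ?_
  simp only [Module.End.mul_apply]
  obtain hc | hc | hc : j = 0 ∨ j = 1 ∨ 2 ≤ j := by omega
  · subst hc
    have e : w 0 k b = T 0 (w 1 k b) := (R.T_pred _ _ _ _ rfl (by omega)).symm
    have hquad : ∀ v, T 0 (T 0 v) = (q - 1) • T 0 v + q • v := fun v => by
      rw [← Module.End.mul_apply, R.quad h (by omega)]
      rfl
    rw [e, hquad]
    simp only [map_add, map_smul, hone]
    rw [hquad]
  · subst hc
    exact hone k b
  · have hDt : ∀ b, downInv q τ j * (τ 0 * (s * b)) = s * (downInv q τ j * (τ 0 * b)) := by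
      intro b
      have := (h.downInv_mul_zero hq hc hj).1
      simp only [← mul_assoc] at this ⊢
      rw [this]
    have hDp : ∀ b, downInv q τ j * (s ^ k * (τ 0 * (s * b))) =
        s * (downInv q τ j * (s ^ k * (τ 0 * b))) -
        (q - 1) • (s * (downInv q τ j * (s ^ k * b)) - s * (s ^ k * (downInv q τ j * b))) := by
      intro b
      have := congrArg (· * b) (h.mul_downInv_pow_mul hq hc hj k)
      simpa only [sub_mul, smul_mul_assoc, mul_assoc] using this
    have hb : ∀ b, τ 0 * (s * (τ 0 * (s * b))) = s * (τ 0 * (s * (τ 0 * b))) := by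
      intro b
      have := congrArg (· * b) (h.braidS (by omega))
      simpa only [mul_assoc] using this.symm
    have ht : ∀ b, τ 0 * (τ 0 * b) = (q - 1) • (τ 0 * b) + q • b := by
      intro b
      rw [← mul_assoc, h.quad 0 (by omega), add_mul, smul_mul_assoc, smul_mul_assoc, one_mul]
    simp (disch := omega) only [R.T_pred, R.T_self, R.T_lt, R.S_zero, R.S_pos, map_add, map_smul,
      map_sub, hD1, zero_add, hDp, hDt, ht, mul_add, mul_smul_comm, hb, pow_succ', pow_zero,
      one_mul, mul_assoc]
    match_scalars <;> field_simp <;> ring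

/-- The operators of an induced system satisfy the relations of the Ariki--Koike algebra one level
up. -/
theorem akSystem (R : InducedSystem q f N s τ w S T) (hq : q ≠ 0) (h : AKSystem q f N s τ) :
    AKSystem q f (N + 1) S T where
  cyclo := R.cyclo h
  quad _ hi := R.quad h hi
  braidS _ := R.braidS hq h
  commS _ hi hi0 := R.commS hq h hi hi0
  comm _ _ hij hj := R.comm h hij hj
  braid _ hi := R.braid h hi

end InducedSystem

end Induced

/-! ### Construction of the induced module and the dimension bound -/

section Construction

open TensorProduct

variable {F H : Type*} [Field F] [Ring H] [Algebra F H]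

/-- The truncated polynomial algebra `F[x]/(f)`, whose basis `1, x, …, x^{r-1}` indexes the colours. -/
abbrev ColourAlg (f : F[X]) : Type _ := F[X] ⧸ Ideal.span {f}

/-- The class of `x` in `F[x]/(f)`. -/
noncomputable def colourX (f : F[X]) : ColourAlg f := Ideal.Quotient.mkₐ F (Ideal.span {f}) X

theorem aeval_colourX (f g : F[X]) :
    aeval (colourX f) g = Ideal.Quotient.mkₐ F (Ideal.span {f}) g := by
  rw [colourX, aeval_algHom_apply, aeval_X_left_apply]

theorem aeval_colourX_self (f : F[X]) : aeval (colourX f) f = 0 := by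
  rw [aeval_colourX]
  exact Ideal.Quotient.eq_zero_iff_mem.2 (Ideal.mem_span_singleton_self f)

theorem span_range_colourX_pow (f : F[X]) :
    Submodule.span F (Set.range fun k => colourX f ^ k) = ⊤ := by
  refine eq_top_iff.2 fun c _ => ?_
  obtain ⟨g, rfl⟩ := Ideal.Quotient.mkₐ_surjective F (Ideal.span {f}) c
  rw [← aeval_colourX, aeval_eq_sum_range]
  exact Submodule.sum_mem _ fun k _ => Submodule.smul_mem _ _ (Submodule.subset_span ⟨k, rfl⟩)

/-- The linear map `c ⊗ b ↦ 1 ⊗ c(s) b` for a root `s` of `f`. -/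
noncomputable def colourEval {f : F[X]} {s : H} (hs : aeval s f = 0) :
    ColourAlg f ⊗[F] H →ₗ[F] ColourAlg f ⊗[F] H :=
  (TensorProduct.mk F (ColourAlg f) H 1) ∘ₗ TensorProduct.lift ((LinearMap.mul F H) ∘ₗ
    (Ideal.Quotient.liftₐ (Ideal.span {f}) (aeval s) (fun g hg => by
      obtain ⟨g', rfl⟩ := Ideal.mem_span_singleton'.1 hg
      rw [map_mul, hs, mul_zero])).toLinearMap)

theorem colourEval_tmul {f : F[X]} {s : H} (hs : aeval s f = 0) (k : ℕ) (b : H) :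
    colourEval hs ((colourX f ^ k) ⊗ₜ b) = 1 ⊗ₜ (s ^ k * b) := by
  simp only [colourEval, LinearMap.comp_apply, TensorProduct.lift.tmul, TensorProduct.mk_apply,
    LinearMap.mul_apply', AlgHom.toLinearMap_apply, map_pow]
  congr 3
  exact aeval_X s

variable (f : F[X]) (N : ℕ)

/-- The vectors `w j k b = e_j ⊗ x^k ⊗ b`, which are `0` for `j > N + 1`. -/
noncomputable def indE (j : ℕ) : ColourAlg f ⊗[F] H →ₗ[F] (Fin (N + 2) → ColourAlg f ⊗[F] H) :=
  if h : j < N + 2 then LinearMap.single F (fun _ => ColourAlg f ⊗[F] H) ⟨j, h⟩ else 0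

/-- The vectors that stand for `T_{j-1}⁻¹ ⋯ T_0⁻¹ S^k T_0 ⋯ T_N b`. -/
noncomputable def indW (j k : ℕ) : H →ₗ[F] (Fin (N + 2) → ColourAlg f ⊗[F] H) :=
  indE f N j ∘ₗ TensorProduct.mk F (ColourAlg f) H (colourX f ^ k)

/-- The operator `T_i` on the induced module. -/
noncomputable def indT (q : F) (τ : ℕ → H) (i : ℕ) :
    Module.End F (Fin (N + 2) → ColourAlg f ⊗[F] H) :=
  LinearMap.lsum F (fun _ => ColourAlg f ⊗[F] H) F fun j =>
    if i + 1 < (j : ℕ) then indE f N j ∘ₗ (LinearMap.mulLeft F (τ i)).lTensor _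
    else if i + 1 = (j : ℕ) then indE f N i
    else if i = (j : ℕ) then (q - 1) • indE f N i + q • indE f N (i + 1)
    else indE f N j ∘ₗ (LinearMap.mulLeft F (τ (i - 1))).lTensor _

/-- The operator `S` on the induced module. -/
noncomputable def indS {f : F[X]} (q : F) (τ : ℕ → H) {s : H} (hs : aeval s f = 0) :
    Module.End F (Fin (N + 2) → ColourAlg f ⊗[F] H) :=
  LinearMap.lsum F (fun _ => ColourAlg f ⊗[F] H) F fun j =>
    if (j : ℕ) = 0 then indE f N 0 ∘ₗ (LinearMap.mulLeft F (colourX f)).rTensor _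
    else indE f N j ∘ₗ (LinearMap.mulLeft F s).lTensor _ +
      (1 - q⁻¹) • (indE f N 0 ∘ₗ (LinearMap.mulLeft F (colourX f)).rTensor _ ∘ₗ
        (LinearMap.mulLeft F (downInv q τ j)).lTensor _ ∘ₗ (colourEval hs - LinearMap.id))

variable {f N}

theorem indE_of_lt {j : ℕ} (h : j < N + 2) (v : ColourAlg f ⊗[F] H) :
    indE f N j v = Pi.single ⟨j, h⟩ v := by
  rw [indE, dif_pos h]; rfl

theorem indW_apply (j k : ℕ) (b : H) : indW f N j k b = indE f N j ((colourX f ^ k) ⊗ₜ b) := rfl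

theorem indT_apply (q : F) (τ : ℕ → H) (i : ℕ) {j : ℕ} (hj : j ≤ N + 1)
    (v : ColourAlg f ⊗[F] H) : indT f N q τ i (indE f N j v) =
      (if i + 1 < j then indE f N j ∘ₗ (LinearMap.mulLeft F (τ i)).lTensor _
      else if i + 1 = j then indE f N i
      else if i = j then (q - 1) • indE f N i + q • indE f N (i + 1)
      else indE f N j ∘ₗ (LinearMap.mulLeft F (τ (i - 1))).lTensor _) v := by
  rw [indE_of_lt (show j < N + 2 by omega), indT, LinearMap.lsum_piSingle]

theorem inducedSystem {q : F} {s : H} {τ : ℕ → H} (h : AKSystem q f N s τ) :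
    InducedSystem q f N s τ (indW f N) (indS N q τ h.cyclo) (indT f N q τ) where
  mem_span v := by
    rw [← Finset.univ_sum_single v]
    refine Submodule.sum_mem _ fun j _ => ?_
    have key : ∀ c b, indE f N j (c ⊗ₜ b) ∈ Submodule.span F
        {u | ∃ j ≤ N + 1, ∃ k b, u = indW (H := H) f N j k b} := by
      intro c b
      have hc : c ∈ Submodule.span F (Set.range fun k => colourX f ^ k) := by
        rw [span_range_colourX_pow]; trivial
      induction hc using Submodule.span_induction with
      | mem x hx =>
        obtain ⟨k, rfl⟩ := hx
        exact Submodule.subset_span ⟨j, by omega, k, b, rfl⟩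
      | zero => rw [TensorProduct.zero_tmul, map_zero]; exact Submodule.zero_mem _
      | add x y _ _ hx hy =>
        rw [TensorProduct.add_tmul, map_add]
        exact Submodule.add_mem _ hx hy
      | smul a x _ hx =>
        rw [← TensorProduct.smul_tmul', map_smul]
        exact Submodule.smul_mem _ _ hx
    rw [show Pi.single j (v j) = indE f N j (v j) from (indE_of_lt j.2 _).symm]
    induction v j using TensorProduct.induction_on with
    | zero => rw [map_zero]; exact Submodule.zero_mem _
    | tmul c b => exact key c b
    | add x y hx hy => rw [map_add]; exact Submodule.add_mem _ hx hy
  T_lt i j k b hij hj := by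
    rw [indW_apply, indT_apply q τ i hj, if_pos hij]
    rfl
  T_pred i j k b hij hj := by
    rw [indW_apply, indT_apply q τ i hj, if_neg (by omega), if_pos hij]
    rfl
  T_self i j k b hij hj := by
    rw [indW_apply, indT_apply q τ i (by omega), if_neg (by omega), if_neg (by omega), if_pos hij]
    rfl
  T_gt i j k b hji hi := by
    rw [indW_apply, indT_apply q τ i (by omega), if_neg (by omega), if_neg (by omega),
      if_neg (by omega)]
    rfl
  S_zero k b := by
    rw [indW_apply, indE_of_lt (Nat.succ_pos _), indS, LinearMap.lsum_piSingle, if_pos rfl,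
      LinearMap.comp_apply, LinearMap.rTensor_tmul, LinearMap.mulLeft_apply, ← pow_succ']
    rfl
  S_pos j k b hj0 hj := by
    rw [indW_apply, indE_of_lt (show j < N + 2 by omega), indS, LinearMap.lsum_piSingle,
      if_neg (by simpa using hj0.ne')]
    simp only [LinearMap.add_apply, LinearMap.comp_apply, LinearMap.smul_apply,
      LinearMap.sub_apply, LinearMap.id_apply, colourEval_tmul, map_sub, LinearMap.lTensor_tmul,
      LinearMap.rTensor_tmul, LinearMap.mulLeft_apply, ← pow_succ', mul_one, indW_apply, pow_one]
  root k b := by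
    have e : ∀ i, f.coeff i • indW f N 0 (i + k) b =
        indE f N 0 ((f.coeff i • colourX f ^ i * colourX f ^ k) ⊗ₜ b) := by
      intro i
      rw [indW_apply, pow_add, smul_mul_assoc, ← TensorProduct.smul_tmul', map_smul]
    simp only [e]
    rw [← map_sum, ← TensorProduct.sum_tmul, ← Finset.sum_mul, ← aeval_eq_sum_range,
      aeval_colourX_self, zero_mul, TensorProduct.zero_tmul, map_zero]

end Construction

section Dimension

open TensorProduct

variable {F : Type*} [Field F] {p : ℕ} {q ζ : F} {Λ : Weight p q}

/-- The induced module is cyclic, generated by `w (N + 1) 0 1`. Hence the dimension of the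
Ariki--Koike algebra grows at least by the factor `(N + 2) r` in each step. -/
theorem finrank_step (hq : q ≠ 0) (N : ℕ) [Module.Finite F (AK (N + 2) p q ζ Λ)]
    [Module.Finite F (AK (N + 1) p q ζ Λ)] (hf : (akPoly p q ζ Λ).Monic) :
    (N + 2) * ((akPoly p q ζ Λ).natDegree * Module.finrank F (AK (N + 1) p q ζ Λ)) ≤
      Module.finrank F (AK (N + 2) p q ζ Λ) := by
  have h : AKSystem q (akPoly p q ζ Λ) N (AK.S (N + 1) p q ζ Λ) (AK.Tn (N + 1) p q ζ Λ) :=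
    AK.system (N + 1) p q ζ Λ
  set f := akPoly p q ζ Λ with hf'
  have R := inducedSystem h
  have h' := R.akSystem hq h
  let L := AK.lift (n := N + 2) h'
  have hLS : L (AK.S (N + 2) p q ζ Λ) = indS N q (AK.Tn (N + 1) p q ζ Λ) h.cyclo :=
    AK.lift_S (n := N + 2) h'
  have hLT : ∀ a : Fin (N + 1), L (AK.T (N + 2) p q ζ Λ a) = indT f N q (AK.Tn (N + 1) p q ζ Λ) a :=
    AK.lift_T (n := N + 2) h'
  let v : Fin (N + 2) → ColourAlg f ⊗[F] AK (N + 1) p q ζ Λ := indW f N (N + 1) 0 1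
  let ev : AK (N + 2) p q ζ Λ →ₗ[F] (Fin (N + 2) → ColourAlg f ⊗[F] AK (N + 1) p q ζ Λ) :=
    LinearMap.applyₗ v ∘ₗ L.toLinearMap
  have hev : ∀ a, ev a = L a v := fun a => rfl
  have hS : ∀ u ∈ LinearMap.range ev,
      indS N q (AK.Tn (N + 1) p q ζ Λ) h.cyclo u ∈ LinearMap.range ev := by
    rintro _ ⟨a, rfl⟩
    exact ⟨AK.S _ p q ζ Λ * a, by rw [hev, map_mul, hLS]; rfl⟩
  have hT : ∀ i < N + 1, ∀ u ∈ LinearMap.range ev,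
      indT f N q (AK.Tn (N + 1) p q ζ Λ) i u ∈ LinearMap.range ev := by
    rintro i hi _ ⟨a, rfl⟩
    exact ⟨AK.T (N + 2) p q ζ Λ ⟨i, hi⟩ * a, by rw [hev, map_mul, hLT]; rfl⟩
  have htop : LinearMap.range ev = ⊤ := by
    refine R.eq_top hq _ hS hT fun b => ?_
    have : (LinearMap.range ev).comap (indW f N (N + 1) 0) = ⊤ := by
      refine AK.eq_top_of_mul_mem _ ?_ ?_ ?_
      · exact ⟨1, by rw [hev, map_one]; rfl⟩
      · intro b hb
        have := hS _ hb
        rw [R.S_pos (N + 1) 0 b (by omega) le_rfl] at this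
        simpa using this
      · intro a b hb
        have ha : (a : ℕ) < N := a.2
        have := hT a (by omega) _ hb
        rw [R.T_lt a (N + 1) 0 b (by omega) le_rfl, AK.Tn_of_lt a.2] at this
        exact this
    have hb : b ∈ (LinearMap.range ev).comap (indW f N (N + 1) 0) := this ▸ Submodule.mem_top
    exact hb
  have hC : Module.finrank F (ColourAlg f) = f.natDegree := finrank_quotient_span_eq_natDegree
  have : Module.Finite F (ColourAlg f) := hf.finite_quotient
  have hle := LinearMap.finrank_le_finrank_of_surjective (LinearMap.range_eq_top.1 htop)
  rw [Module.finrank_pi_fintype, Module.finrank_tensorProduct, hC] at hle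
  simpa using hle

/-- The lower bound for the dimension on one strand: the Ariki--Koike algebra maps onto
`F[x]/(f)`. -/
theorem natDegree_le_finrank [Module.Finite F (AK 1 p q ζ Λ)] :
    (akPoly p q ζ Λ).natDegree ≤ Module.finrank F (AK 1 p q ζ Λ) := by
  have h : AKSystem q (akPoly p q ζ Λ) 0 (colourX (akPoly p q ζ Λ)) (fun _ => 0) :=
    ⟨aeval_colourX_self _, by simp, by simp, by simp, by simp, by simp⟩
  let L := AK.lift (n := 1) h
  have hL : L (AK.S 1 p q ζ Λ) = colourX (akPoly p q ζ Λ) := AK.lift_S (n := 1) h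
  have hC : Module.finrank F (ColourAlg (akPoly p q ζ Λ)) = (akPoly p q ζ Λ).natDegree :=
    finrank_quotient_span_eq_natDegree
  rw [← hC]
  refine LinearMap.finrank_le_finrank_of_surjective (f := L.toLinearMap) fun c => ?_
  obtain ⟨g, rfl⟩ := Ideal.Quotient.mkₐ_surjective F (Ideal.span {akPoly p q ζ Λ}) c
  refine ⟨aeval (AK.S 1 p q ζ Λ) g, ?_⟩
  rw [AlgHom.toLinearMap_apply, ← aeval_algHom_apply, hL, aeval_colourX]

/-- The dimension of the Ariki--Koike algebra is at least `r^n n!`. -/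
theorem le_finrank (hq : q ≠ 0) (hf : (akPoly p q ζ Λ).Monic)
    (hfin : ∀ N, Module.Finite F (AK (N + 1) p q ζ Λ)) (N : ℕ) :
    (akPoly p q ζ Λ).natDegree ^ (N + 1) * (N + 1).factorial ≤
      Module.finrank F (AK (N + 1) p q ζ Λ) := by
  induction N with
  | zero => simpa using natDegree_le_finrank
  | succ N ih =>
    have := hfin N
    have := hfin (N + 1)
    refine le_trans (le_of_eq ?_) ((Nat.mul_le_mul_left (N + 2)
      (Nat.mul_le_mul_left _ ih)).trans (finrank_step hq N hf))
    rw [Nat.factorial_succ (N + 1), pow_succ _ (N + 1)]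
    ring

end Dimension

/-! ### The cyclotomic polynomial, eigenvectors, and the basis -/

section Polynomials

variable {F : Type*} [Field F] {p : ℕ} {q ζ : F} {Λ : Weight p q} {lam : WeightI q}

theorem prod_X_sub_C_zmodPow_mul (hp : 1 ≤ p) (hζ : IsPrimitiveRoot ζ p) (a : F) :
    ∏ j ∈ (Finset.range p).image (Nat.cast : ℕ → ZMod p), (X - C (zmodPow ζ j * a)) =
      X ^ p - C (a ^ p) := by
  have : NeZero p := ⟨by omega⟩
  have hval : ∀ k < p, ((k : ZMod p).cast : ℤ) = k := fun k hk => by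
    rw [ZMod.cast_eq_val, ZMod.val_cast_of_lt hk]
  rw [Finset.prod_image]
  · rw [X_pow_sub_C_eq_prod hζ (by omega) rfl]
    refine Finset.prod_congr rfl fun k hk => ?_
    rw [zmodPow, hval k (Finset.mem_range.1 hk), zpow_natCast]
  · intro k hk l hl hkl
    have := congrArg (fun x : ZMod p => (x.cast : ℤ)) hkl
    simp only [hval k (by simpa using hk), hval l (by simpa using hl)] at this
    exact_mod_cast this

/-- Independence of `Λ` of the second index makes the cyclotomic polynomial a polynomial in
`X ^ p`. -/
theorem akPoly_eq_comp (hp : 1 ≤ p) (hζ : IsPrimitiveRoot ζ p)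
    (hΛ : ∀ (i : ZMod (orderOf q)) (j : ZMod p), Λ (i, j) = lam i) :
    akPoly p q ζ Λ = (gPoly p q lam).comp (X ^ p) := by
  classical
  have : NeZero p := ⟨by omega⟩
  have huniv : (Finset.range p).image (Nat.cast : ℕ → ZMod p) = Finset.univ := by
    ext x
    simp only [Finset.mem_image, Finset.mem_range, Finset.mem_univ, iff_true]
    exact ⟨x.val, x.val_lt, ZMod.natCast_zmod_val x⟩
  rw [akPoly, Finsupp.prod_of_support_subset (s := lam.support ×ˢ Finset.univ) _ ?_ _ (by simp),
    Finset.prod_product, gPoly, Finsupp.prod, Polynomial.prod_comp]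
  · refine Finset.prod_congr rfl fun i _ => ?_
    simp only [hΛ, Finset.prod_pow]
    rw [← huniv, prod_X_sub_C_zmodPow_mul hp hζ]
    simp
  · rintro ⟨i, j⟩ hij
    have := Finsupp.mem_support_iff.1 hij
    rw [hΛ] at this
    simpa using this

theorem monic_akPoly : (akPoly p q ζ Λ).Monic :=
  monic_prod_of_monic _ _ fun _ _ => (monic_X_sub_C _).pow _

theorem natDegree_akPoly : (akPoly p q ζ Λ).natDegree = Λ.sum fun _ m => m := by
  rw [akPoly, Finsupp.prod, natDegree_prod_of_monic _ _ fun _ _ => (monic_X_sub_C _).pow _]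
  exact Finset.sum_congr rfl fun _ _ => by rw [natDegree_pow, natDegree_X_sub_C, mul_one]

theorem coeff_zero_akPoly_ne_zero (hq : q ≠ 0) (hζ : ζ ≠ 0) : (akPoly p q ζ Λ).coeff 0 ≠ 0 := by
  rw [coeff_zero_eq_eval_zero, akPoly, Finsupp.prod, eval_prod]
  refine Finset.prod_ne_zero_iff.2 fun ij _ => ?_
  rw [eval_pow, eval_sub, eval_X, eval_C, zero_sub]
  exact pow_ne_zero _ (neg_ne_zero.2 (mul_ne_zero (zpow_ne_zero _ hζ) (zpow_ne_zero _ hq)))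

end Polynomials

section Eigen

/-- If a linear map `σ` scales each member of a spanning family by a power of a primitive `p`-th
root of unity `ζ`, then its fixed vectors lie in the span of the members that it fixes. This follows
by averaging over the powers of `σ`, as `p` is invertible in the field. -/
theorem mem_span_of_fixed {F V ι : Type*} [Field F] [AddCommGroup V] [Module F V] {p : ℕ}
    (hp : 1 ≤ p) {ζ : F} (hζ : IsPrimitiveRoot ζ p) (σ : Module.End F V) {v : ι → V} {wt : ι → ℕ}
    (hσ : ∀ i, σ (v i) = ζ ^ wt i • v i) (hv : Submodule.span F (Set.range v) = ⊤) {x : V}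
    (hx : σ x = x) : x ∈ Submodule.span F {y | ∃ i, p ∣ wt i ∧ y = v i} := by
  have : NeZero p := ⟨by omega⟩
  have hpF : (p : F) ≠ 0 := hζ.neZero'.out
  have hpow : ∀ k i, (σ ^ k) (v i) = (ζ ^ wt i) ^ k • v i := by
    intro k i
    induction k with
    | zero => simp
    | succ k ih =>
      rw [pow_succ', Module.End.mul_apply, ih, map_smul, hσ, smul_smul, pow_succ]
  have hmem : ∀ y, (∑ k ∈ Finset.range p, σ ^ k) y ∈
      Submodule.span F {y | ∃ i, p ∣ wt i ∧ y = v i} := by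
    intro y
    have hy : y ∈ Submodule.span F (Set.range v) := hv ▸ Submodule.mem_top
    induction hy using Submodule.span_induction with
    | mem y hy =>
      obtain ⟨i, rfl⟩ := hy
      rw [LinearMap.sum_apply]
      simp only [hpow]
      rw [← Finset.sum_smul]
      by_cases hi : p ∣ wt i
      · exact Submodule.smul_mem _ _ (Submodule.subset_span ⟨i, hi, rfl⟩)
      · have h1 : ζ ^ wt i ≠ 1 := fun h => hi ((hζ.pow_eq_one_iff_dvd _).1 h)
        have h2 := geom_sum_mul (ζ ^ wt i) p
        rw [← pow_mul, mul_comm (wt i) p, pow_mul, hζ.pow_eq_one, one_pow, sub_self] at h2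
        rw [(mul_eq_zero.1 h2).resolve_right (sub_ne_zero.2 h1), zero_smul]
        exact Submodule.zero_mem _
    | zero => rw [map_zero]; exact Submodule.zero_mem _
    | add a b _ _ ha hb => rw [map_add]; exact Submodule.add_mem _ ha hb
    | smul a b _ hb => rw [map_smul]; exact Submodule.smul_mem _ _ hb
  have hfix : ∀ k, (σ ^ k) x = x := by
    intro k
    induction k with
    | zero => simp
    | succ k ih => rw [pow_succ, Module.End.mul_apply, hx, ih]
  have h3 := hmem x
  rw [LinearMap.sum_apply] at h3
  simp only [hfix, Finset.sum_const, Finset.card_range] at h3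
  rw [← Nat.cast_smul_eq_nsmul F] at h3
  have h4 := Submodule.smul_mem _ (p : F)⁻¹ h3
  rwa [smul_smul, inv_mul_cancel₀ hpF, one_smul] at h4

end Eigen

section Basis

variable {F : Type*} [Field F] {p : ℕ} {q ζ : F} {Λ : Weight p q} {N : ℕ}

theorem AK.X_eq_jm {k : ℕ} (hk : k ≤ N) :
    AK.X (N + 1) p q ζ Λ k = jm q (AK.S (N + 1) p q ζ Λ) (AK.Tn (N + 1) p q ζ Λ) k := by
  induction k with
  | zero => rfl
  | succ k ih =>
    have hk' : k < N + 1 - 1 := by omega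
    rw [AK.X, dif_pos hk', jm, ih (by omega), AK.Tn_of_lt hk']

theorem AK.monomial_eq (m : ℕ → ℕ) (l : List (Fin N)) :
    AK.monomial (N + 1) p q ζ Λ (fun a => m a) l =
      jmProd q (AK.S (N + 1) p q ζ Λ) (AK.Tn (N + 1) p q ζ Λ) N m *
        ((l.map Fin.val).map (AK.Tn (N + 1) p q ζ Λ)).prod := by
  rw [AK.monomial, jmProd, AK.Tword, List.map_map]
  congr 3
  · funext a
    rw [AK.X_eq_jm (by omega)]
  · funext a
    rw [Function.comp_apply, AK.Tn_of_lt a.2]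

theorem AK.levelAlg_eq_top :
    levelAlg F (AK.S (N + 1) p q ζ Λ) (AK.Tn (N + 1) p q ζ Λ) N = ⊤ := by
  have := AK.eq_top_of_mul_mem (Subalgebra.toSubmodule
    (levelAlg F (AK.S (N + 1) p q ζ Λ) (AK.Tn (N + 1) p q ζ Λ) N)) (Subalgebra.one_mem _)
    (fun x hx => Subalgebra.mul_mem _ (S_mem_levelAlg N) hx)
    (fun a x hx => Subalgebra.mul_mem _ (by
      have := T_mem_levelAlg (F := F) (S := AK.S (N + 1) p q ζ Λ)
        (T := AK.Tn (N + 1) p q ζ Λ) (N := N) (i := a) a.2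
      rwa [AK.Tn_of_lt a.2] at this) hx)
  exact Subalgebra.toSubmodule_injective this

theorem AK.span_monomial (hq : q ≠ 0) {r : ℕ} (hr : 0 < r) (hdeg : (akPoly p q ζ Λ).natDegree = r)
    (red : Equiv.Perm (Fin (N + 1)) → List (Fin N))
    (hred : ∀ w, IsReducedExpr (n := N + 1) (red w) w) :
    Submodule.span F (Set.range fun x : (Fin (N + 1) → Fin r) × Equiv.Perm (Fin (N + 1)) =>
      AK.monomial (N + 1) p q ζ Λ (fun a => (x.1 a : ℕ)) (red x.2)) = ⊤ := by
  refine eq_top_iff.2 fun x _ => ?_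
  have h : AKSystem q (akPoly p q ζ Λ) N (AK.S (N + 1) p q ζ Λ) (AK.Tn (N + 1) p q ζ Λ) :=
    AK.system (N + 1) p q ζ Λ
  have hx := h.levelAlg_le_span hq monic_akPoly (hdeg ▸ hr)
    (x := x) (by rw [AK.levelAlg_eq_top]; trivial)
  refine Submodule.span_mono ?_ hx
  rintro _ ⟨m, hm, u, hu, rfl⟩
  refine ⟨(fun a => ⟨m a, hdeg ▸ hm a⟩, (u.map (simpleTranspN (N + 1))).prod), ?_⟩
  rw [prod_normalWord_eq (n := N + 1) h.braidSystem hu (hred _)]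
  exact AK.monomial_eq m _

theorem AK.finite (hq : q ≠ 0) (hr : 0 < (akPoly p q ζ Λ).natDegree) (N : ℕ) :
    Module.Finite F (AK (N + 1) p q ζ Λ) := by
  choose red hred using fun w : Equiv.Perm (Fin (N + 1)) => exists_isReducedExpr w
  exact ⟨Submodule.fg_def.2 ⟨_, Set.finite_range _, AK.span_monomial hq hr rfl red hred⟩⟩

theorem AK.linearIndependent_monomial (hq : q ≠ 0) {r : ℕ} (hr : 0 < r)
    (hdeg : (akPoly p q ζ Λ).natDegree = r)
    (red : Equiv.Perm (Fin (N + 1)) → List (Fin N))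
    (hred : ∀ w, IsReducedExpr (n := N + 1) (red w) w) :
    LinearIndependent F fun x : (Fin (N + 1) → Fin r) × Equiv.Perm (Fin (N + 1)) =>
      AK.monomial (N + 1) p q ζ Λ (fun a => (x.1 a : ℕ)) (red x.2) := by
  have hspan := AK.span_monomial hq hr hdeg red hred
  have hfin := AK.finite (F := F) (p := p) (q := q) (ζ := ζ) (Λ := Λ) hq (hdeg ▸ hr)
  have := hfin N
  have hcard : Fintype.card ((Fin (N + 1) → Fin r) × Equiv.Perm (Fin (N + 1))) =
      r ^ (N + 1) * (N + 1).factorial := by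
    simp [Fintype.card_perm]
  refine linearIndependent_of_top_le_span_of_card_eq_finrank hspan.ge (le_antisymm ?_ ?_)
  · rw [hcard, ← hdeg]
    exact le_finrank hq monic_akPoly hfin N
  · have h1 := finrank_range_le_card (R := F)
      (b := fun x : (Fin (N + 1) → Fin r) × Equiv.Perm (Fin (N + 1)) =>
        AK.monomial (N + 1) p q ζ Λ (fun a => (x.1 a : ℕ)) (red x.2))
    rwa [Set.finrank, hspan, finrank_top] at h1

end Basis

/-! ### The relations of type `G(r, p, n)` -/

section GSystems

variable {F A : Type*} [Field F] [Ring A] [Algebra F A]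

/-- Elements `s, t', t 0, …, t (N - 1)` of an algebra that satisfy the defining relations of the
cyclotomic Hecke algebra of type `G(r, p, N + 1)`. The values of `t` from `N` on are irrelevant. -/
structure GSystem (q : F) (g : F[X]) (p N : ℕ) (s t' : A) (t : ℕ → A) : Prop where
  cyclo : aeval s g = 0
  quad' : t' * t' = (q - 1) • t' + q • (1 : A)
  quad : ∀ i < N, t i * t i = (q - 1) • t i + q • (1 : A)
  braid' : 1 < N → t' * t 1 * t' = t 1 * t' * t 1
  braid : ∀ i, i + 1 < N → t i * t (i + 1) * t i = t (i + 1) * t i * t (i + 1)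
  braid6 : 1 < N → (t' * t 0 * t 1) ^ 2 = (t 1 * t' * t 0) ^ 2
  comm' : ∀ i < N, 2 ≤ i → Commute t' (t i)
  comm : ∀ i j, i + 1 < j → j < N → Commute (t i) (t j)
  commS : ∀ i < N, 1 ≤ i → Commute s (t i)
  braidS : 0 < N → s * t' * t 0 = t' * t 0 * s
  bigBraid : 0 < N → s * altProd t' (t 0) p = t 0 * s * altProd t' (t 0) (p - 1)

theorem altProd_two_mul {M : Type*} [Monoid M] (a b : M) (k : ℕ) :
    altProd a b (2 * k) = (a * b) ^ k := by
  induction k with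
  | zero => simp [altProd]
  | succ k ih =>
    rw [show 2 * (k + 1) = 2 * k + 1 + 1 by ring, altProd, altProd, ih, pow_succ', mul_assoc]

theorem altProd_two_mul_add_one {M : Type*} [Monoid M] (a b : M) (k : ℕ) :
    altProd a b (2 * k + 1) = (a * b) ^ k * a := by
  induction k with
  | zero => simp [altProd]
  | succ k ih =>
    rw [show 2 * (k + 1) + 1 = 2 * k + 1 + 1 + 1 by ring, altProd, altProd, ih, pow_succ']
    simp only [mul_assoc]

/-- In a group with the braid relations for `a, c` and for `b, c`, the relation
`(abc)^2 = (cab)^2` amounts to the braid relation for `b⁻¹ab, c`. -/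
theorem braid_conj {G : Type*} [Group G] {a b c : G} (hac : a * c * a = c * a * c)
    (hbc : b * c * b = c * b * c) (h6 : (a * b * c) ^ 2 = (c * a * b) ^ 2) :
    b⁻¹ * a * b * c * (b⁻¹ * a * b) = c * (b⁻¹ * a * b) * c := by
  refine mul_left_cancel (a := a * c * b) ?_
  calc a * c * b * (b⁻¹ * a * b * c * (b⁻¹ * a * b))
      = a * c * a * b * c * b⁻¹ * a * b := by group
    _ = c * a * (c * b * c) * b⁻¹ * a * b := by rw [hac]; group
    _ = (c * a * b) ^ 2 := by rw [← hbc, pow_two]; group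
    _ = a * (b * c * b) * b⁻¹ * a * b * c := by rw [← h6, pow_two]; group
    _ = a * c * b * (c * (b⁻¹ * a * b) * c) := by rw [hbc]; group

namespace GSystem

variable {q : F} {g : F[X]} {p N : ℕ} {s t' : A} {t : ℕ → A}

/-- The image of `t` under conjugation by the generator `S` of the larger algebra:
`t_1` becomes `t_1⁻¹ t'_1 t_1` and the other `t_a` are unchanged. -/
noncomputable def twist (q : F) (t' : A) (t : ℕ → A) (i : ℕ) : A :=
  if i = 0 then heckeInv q (t 0) * t' * t 0 else t i

theorem mul_twist_zero (hq : q ≠ 0) (h : GSystem q g p N s t' t) (hN : 0 < N) :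
    t 0 * twist q t' t 0 = t' * t 0 := by
  rw [twist, if_pos rfl, ← mul_assoc, ← mul_assoc, mul_heckeInv hq (h.quad 0 hN), one_mul]

/-- The relations are invariant under conjugation by the generator `S` of the larger algebra. -/
theorem gSystem_twist (hq : q ≠ 0) (hp : 1 ≤ p) (h : GSystem q g p N s t' t) (hN : 0 < N) :
    GSystem q g p N s (t 0) (twist q t' t) := by
  have hpos : ∀ i, i ≠ 0 → twist q t' t i = t i := fun i hi => if_neg hi
  have hz := h.mul_twist_zero hq hN
  have hinv := heckeInv_mul hq (h.quad 0 hN)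
  have hinv' := mul_heckeInv hq (h.quad 0 hN)
  have hsz : Commute s (t' * t 0) := by
    have := h.braidS hN
    rwa [mul_assoc] at this
  refine
    { cyclo := h.cyclo
      quad' := h.quad 0 hN
      quad := fun i hi => ?_
      braid' := fun h1 => ?_
      braid := fun i hi => ?_
      braid6 := fun h1 => ?_
      comm' := fun i hi h2 => ?_
      comm := fun i j hij hj => ?_
      commS := fun i hi h1 => ?_
      braidS := fun _ => ?_
      bigBraid := fun _ => ?_ }
  · by_cases h0 : i = 0
    · subst h0
      have e : twist q t' t 0 * twist q t' t 0 = heckeInv q (t 0) * (t' * t') * t 0 := by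
        rw [twist, if_pos rfl]
        calc heckeInv q (t 0) * t' * t 0 * (heckeInv q (t 0) * t' * t 0)
            = heckeInv q (t 0) * t' * (t 0 * heckeInv q (t 0)) * t' * t 0 := by
              simp only [mul_assoc]
          _ = _ := by rw [hinv', mul_one]; simp only [mul_assoc]
      rw [e, h.quad', twist, if_pos rfl]
      simp only [mul_add, add_mul, mul_smul_comm, smul_mul_assoc, mul_one, hinv]
    · rw [hpos i h0]; exact h.quad i hi
  · rw [hpos 1 one_ne_zero]; exact h.braid 0 h1
  · rw [hpos (i + 1) (Nat.succ_ne_zero i)]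
    by_cases h0 : i = 0
    · subst h0
      let a := heckeUnit hq h.quad'
      let b := heckeUnit hq (h.quad 0 hN)
      let c := heckeUnit hq (h.quad 1 hi)
      have := braid_conj (a := a) (b := b) (c := c) (Units.ext (h.braid' hi))
        (Units.ext (h.braid 0 hi)) (Units.ext (h.braid6 hi))
      exact congrArg Units.val this
    · rw [hpos i h0]; exact h.braid i hi
  · rw [hpos 1 one_ne_zero, hz, mul_assoc (t 1), hz, ← mul_assoc]
    exact h.braid6 h1
  · rw [hpos i (by omega)]; exact h.comm 0 i (by omega) hi
  · rw [hpos j (by omega)]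
    by_cases h0 : i = 0
    · subst h0
      have h1 := h.comm 0 j hij hj
      rw [twist, if_pos rfl]
      exact (((commute_heckeInv h1.symm).mul_right (h.comm' j hj (by omega)).symm).mul_right
        h1.symm).symm
    · rw [hpos i h0]; exact h.comm i j hij hj
  · rw [hpos i (by omega)]; exact h.commS i hi h1
  · rw [mul_assoc, hz]; exact hsz.eq
  · have hb := h.bigBraid hN
    -- both sides are compared after left multiplication by `t 0`
    have hcancel : ∀ x y : A, t 0 * x = t 0 * y → x = y := fun x y hxy => by
      rw [← one_mul x, ← one_mul y, ← hinv, mul_assoc, hxy, mul_assoc]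
    refine hcancel _ _ ?_
    rw [← mul_assoc (t 0) (_ * s), ← mul_assoc (t 0) _ s, hz]
    have hzs : ∀ k, t' * t 0 * s * (t' * t 0) ^ k = s * (t' * t 0) ^ k * (t' * t 0) := fun k => by
      rw [← hsz.eq, mul_assoc, ← pow_succ', mul_assoc, ← pow_succ]
    obtain ⟨k, rfl | rfl⟩ := Nat.even_or_odd' p
    · obtain ⟨k, rfl⟩ : ∃ k', k = k' + 1 := ⟨k - 1, by omega⟩
      rw [show 2 * (k + 1) - 1 = 2 * k + 1 by omega, altProd_two_mul,
        altProd_two_mul_add_one] at hb ⊢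
      rw [hz, ← mul_assoc, ← mul_assoc _ _ (t 0), hzs, mul_assoc s _ (t' * t 0), ← pow_succ, hb,
        pow_succ]
      simp only [mul_assoc]
    · rw [Nat.add_sub_cancel, altProd_two_mul, altProd_two_mul_add_one] at hb ⊢
      rw [hz, hzs, ← mul_assoc (s * _), mul_assoc s _ t', hb]
      simp only [mul_assoc]

end GSystem

end GSystems

section GLift

variable {F A : Type*} [Field F] [Ring A] [Algebra F A] {n p : ℕ} {q : F} {lam : WeightI q}

/-- The generators `t` of the algebra of type `G(r, p, n)`, extended by `0` to all natural
numbers. -/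
noncomputable def HG.tn (n p : ℕ) (q : F) (lam : WeightI q) (i : ℕ) : HG n p q lam :=
  if h : i < n - 1 then HG.t n p q lam ⟨i, h⟩ else 0

theorem HG.tn_of_lt {i : ℕ} (h : i < n - 1) : HG.tn n p q lam i = HG.t n p q lam ⟨i, h⟩ :=
  dif_pos h

theorem altProd_map {M M' G : Type*} [Monoid M] [Monoid M'] [FunLike G M M']
    [MonoidHomClass G M M'] (φ : G) (a b : M) (k : ℕ) :
    φ (altProd a b k) = altProd (φ a) (φ b) k := by
  induction k generalizing a b with
  | zero => exact map_one φ
  | succ k ih => rw [altProd, map_mul, ih, altProd]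

theorem HG.system (n p : ℕ) (q : F) (lam : WeightI q) :
    GSystem q (gPoly p q lam) p (n - 1) (HG.s n p q lam) (HG.t' n p q lam)
      (HG.tn n p q lam) := by
  have hrel : ∀ {x y}, GRel n p q lam x y → RingQuot.mkAlgHom F (GRel n p q lam) x =
      RingQuot.mkAlgHom F (GRel n p q lam) y := fun h => RingQuot.mkAlgHom_rel F h
  refine
    { cyclo := ?_
      quad' := ?_
      quad := fun i hi => ?_
      braid' := fun h1 => ?_
      braid := fun i hi => ?_
      braid6 := fun h1 => ?_
      comm' := fun i hi h2 => ?_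
      comm := fun i j hij hj => ?_
      commS := fun i hi h1 => ?_
      braidS := fun h0 => ?_
      bigBraid := fun h0 => ?_ }
  · have := hrel (GRel.cyclo (n := n) (p := p) (q := q) (lam := lam))
    rwa [← Polynomial.aeval_algHom_apply, map_zero] at this
  · rw [← quad_iff]
    have := hrel (GRel.quad' (n := n) (p := p) (q := q) (lam := lam))
    simp only [map_mul, map_add, map_sub, map_one, map_zero, AlgHom.commutes] at this
    exact this
  · rw [HG.tn_of_lt hi, ← quad_iff]
    have := hrel (GRel.quad (p := p) (q := q) (lam := lam) ⟨i, hi⟩)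
    simp only [map_mul, map_add, map_sub, map_one, map_zero, AlgHom.commutes] at this
    exact this
  · rw [HG.tn_of_lt h1]
    have := hrel (GRel.braid' (p := p) (q := q) (lam := lam) ⟨1, h1⟩ rfl)
    simp only [map_mul] at this
    exact this
  · rw [HG.tn_of_lt hi, HG.tn_of_lt (show i < n - 1 by omega)]
    have := hrel (GRel.braid (p := p) (q := q) (lam := lam) ⟨i, by omega⟩ ⟨i + 1, hi⟩ rfl)
    simp only [map_mul] at this
    exact this
  · rw [HG.tn_of_lt h1, HG.tn_of_lt (show 0 < n - 1 by omega)]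
    have := hrel (GRel.braid6 (p := p) (q := q) (lam := lam) ⟨0, by omega⟩ ⟨1, h1⟩ rfl rfl)
    simp only [map_mul, map_pow] at this
    exact this
  · rw [HG.tn_of_lt hi]
    have := hrel (GRel.comm' (p := p) (q := q) (lam := lam) ⟨i, hi⟩ h2)
    simp only [map_mul] at this
    exact this
  · rw [HG.tn_of_lt hj, HG.tn_of_lt (show i < n - 1 by omega)]
    have := hrel (GRel.comm (p := p) (q := q) (lam := lam) ⟨i, by omega⟩ ⟨j, hj⟩ (Or.inl hij))
    simp only [map_mul] at this
    exact this
  · rw [HG.tn_of_lt hi]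
    have := hrel (GRel.commS (p := p) (q := q) (lam := lam) ⟨i, hi⟩ h1)
    simp only [map_mul] at this
    exact this
  · rw [HG.tn_of_lt h0]
    have := hrel (GRel.braidS (p := p) (q := q) (lam := lam) ⟨0, h0⟩ rfl)
    simp only [map_mul] at this
    exact this
  · rw [HG.tn_of_lt h0]
    have := hrel (GRel.bigBraid (p := p) (q := q) (lam := lam) ⟨0, h0⟩ rfl)
    simp only [map_mul, altProd_map] at this
    exact this

/-- The homomorphism from the algebra of type `G(r, p, n)` given by a system of elements that
satisfy the defining relations. -/
noncomputable def HG.lift {s t' : A} {t : ℕ → A}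
    (h : GSystem q (gPoly p q lam) p (n - 1) s t' t) : HG n p q lam →ₐ[F] A :=
  RingQuot.liftAlgHom F (s := GRel n p q lam)
    ⟨FreeAlgebra.lift F fun | GGen.s => s | GGen.t' => t' | GGen.t a => t a, by
      have hs : FreeAlgebra.lift F (fun | GGen.s => s | GGen.t' => t' | GGen.t a => t a :
        GGen n → A) (fs F n) = s := by simp [fs]
      have ht' : FreeAlgebra.lift F (fun | GGen.s => s | GGen.t' => t' | GGen.t a => t a :
        GGen n → A) (ft' F n) = t' := by simp [ft']
      have ht : ∀ a : Fin (n - 1), FreeAlgebra.lift F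
        (fun | GGen.s => s | GGen.t' => t' | GGen.t a => t a : GGen n → A) (ft F a) = t a := by
        simp [ft]
      intro x y hxy
      induction hxy with
      | cyclo => rw [← Polynomial.aeval_algHom_apply, hs, map_zero, h.cyclo]
      | quad' =>
        simp only [map_mul, map_add, map_sub, map_one, map_zero, AlgHom.commutes, ht']
        exact quad_iff.2 h.quad'
      | quad a =>
        simp only [map_mul, map_add, map_sub, map_one, map_zero, AlgHom.commutes, ht]
        exact quad_iff.2 (h.quad a a.2)
      | braid' b hb =>
        simp only [map_mul, ht', ht, hb]
        exact h.braid' (by have := b.2; omega)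
      | braid a b hab =>
        simp only [map_mul, ht, ← hab]
        exact h.braid a (hab ▸ b.2)
      | braid6 a b ha hb =>
        simp only [map_mul, map_pow, ht', ht, ha, hb]
        exact h.braid6 (by have := b.2; omega)
      | comm' a ha =>
        simp only [map_mul, ht', ht]
        exact h.comm' a a.2 ha
      | comm a b hab =>
        simp only [map_mul, ht]
        rcases hab with hab | hab
        · exact h.comm a b hab b.2
        · exact (h.comm b a hab a.2).symm
      | commS a ha =>
        simp only [map_mul, hs, ht]
        exact h.commS a a.2 ha
      | braidS a ha =>
        simp only [map_mul, hs, ht', ht, ha]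
        exact h.braidS (ha ▸ a.2)
      | bigBraid a ha =>
        simp only [map_mul, altProd_map, hs, ht', ht, ha]
        exact h.bigBraid (ha ▸ a.2)⟩

section

variable {s t' : A} {t : ℕ → A} (h : GSystem q (gPoly p q lam) p (n - 1) s t' t)

@[simp]
theorem HG.lift_s : HG.lift h (HG.s n p q lam) = s := by
  rw [HG.lift, HG.s, RingQuot.liftAlgHom_mkAlgHom_apply, fs, FreeAlgebra.lift_ι_apply]

@[simp]
theorem HG.lift_t' : HG.lift h (HG.t' n p q lam) = t' := by
  rw [HG.lift, HG.t', RingQuot.liftAlgHom_mkAlgHom_apply, ft', FreeAlgebra.lift_ι_apply]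

@[simp]
theorem HG.lift_t (a : Fin (n - 1)) : HG.lift h (HG.t n p q lam a) = t a := by
  rw [HG.lift, HG.t, RingQuot.liftAlgHom_mkAlgHom_apply, ft, FreeAlgebra.lift_ι_apply]

theorem HG.lift_tn {i : ℕ} (hi : i < n - 1) : HG.lift h (HG.tn n p q lam i) = t i := by
  rw [HG.tn_of_lt hi, HG.lift_t]

end

theorem HG.hom_ext {g g' : HG n p q lam →ₐ[F] A} (hs : g (HG.s n p q lam) = g' (HG.s n p q lam))
    (ht' : g (HG.t' n p q lam) = g' (HG.t' n p q lam))
    (ht : ∀ a, g (HG.t n p q lam a) = g' (HG.t n p q lam a)) : g = g' := by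
  refine RingQuot.ringQuot_ext' F _ _ (FreeAlgebra.hom_ext (funext fun a => ?_))
  cases a with
  | s => exact hs
  | t' => exact ht'
  | t a => exact ht a

/-- A subalgebra that contains the generators is everything. -/
theorem HG.eq_top_of_mem (B : Subalgebra F (HG n p q lam)) (hs : HG.s n p q lam ∈ B)
    (ht' : HG.t' n p q lam ∈ B) (ht : ∀ a, HG.t n p q lam a ∈ B) : B = ⊤ := by
  have key : ∀ y, RingQuot.mkAlgHom F (GRel n p q lam) y ∈ B := by
    intro y
    induction y using FreeAlgebra.induction with
    | grade0 r => rw [AlgHom.commutes]; exact B.algebraMap_mem r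
    | grade1 a => cases a with
      | s => exact hs
      | t' => exact ht'
      | t a => exact ht a
    | mul a b ha hb => rw [map_mul]; exact B.mul_mem ha hb
    | add a b ha hb => rw [map_add]; exact B.add_mem ha hb
  refine eq_top_iff.2 fun x _ => ?_
  obtain ⟨y, rfl⟩ := RingQuot.mkAlgHom_surjective F (GRel n p q lam) x
  exact key y

end GLift

/-! ### The twist, its representation, and injectivity -/

section Twist

variable {F : Type*} [Field F] {n p : ℕ} {q : F} {lam : WeightI q}

/-- The endomorphism of the algebra of type `G(r, p, n)` that fixes `s` and `t_a` for `a ≥ 2`, and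
sends `t'_1` to `t_1` and `t_1` to `t_1⁻¹ t'_1 t_1`. In the larger algebra it becomes conjugation
by `S`. -/
noncomputable def HG.theta (hq : q ≠ 0) (hp : 1 ≤ p) (hn : 0 < n - 1) :
    HG n p q lam →ₐ[F] HG n p q lam :=
  HG.lift ((HG.system n p q lam).gSystem_twist hq hp hn)

variable (hq : q ≠ 0) (hp : 1 ≤ p) (hn : 0 < n - 1)

theorem HG.theta_pow_s (k : ℕ) : (HG.theta hq hp hn ^ k) (HG.s n p q lam) = HG.s n p q lam := by
  induction k with
  | zero => rfl
  | succ k ih => rw [pow_succ, AlgHom.mul_apply,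
      show HG.theta hq hp hn (HG.s n p q lam) = HG.s n p q lam from HG.lift_s _, ih]

theorem HG.theta_t' : HG.theta hq hp hn (HG.t' n p q lam) = HG.tn n p q lam 0 := by
  rw [HG.theta, HG.lift_t']

theorem HG.theta_tn_of_pos {i : ℕ} (hi : 0 < i) :
    HG.theta hq hp hn (HG.tn n p q lam i) = HG.tn n p q lam i := by
  by_cases h : i < n - 1
  · rw [HG.theta, HG.lift_tn _ h, GSystem.twist, if_neg hi.ne']
  · rw [HG.tn, dif_neg h, map_zero]

theorem HG.theta_pow_tn_of_pos {i : ℕ} (hi : 0 < i) (k : ℕ) :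
    (HG.theta hq hp hn ^ k) (HG.tn n p q lam i) = HG.tn n p q lam i := by
  induction k with
  | zero => rfl
  | succ k ih => rw [pow_succ, AlgHom.mul_apply, HG.theta_tn_of_pos hq hp hn hi, ih]

theorem HG.tn_zero_mul_theta :
    HG.tn n p q lam 0 * HG.theta hq hp hn (HG.tn n p q lam 0) =
      HG.t' n p q lam * HG.tn n p q lam 0 := by
  rw [HG.theta, HG.lift_tn _ hn, (HG.system n p q lam).mul_twist_zero hq hn]

/-- The elements `θ^i(t'_1)` form a sequence whose consecutive products are all equal. -/
theorem HG.theta_pow_mul_theta_pow_succ (i : ℕ) :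
    (HG.theta hq hp hn ^ i) (HG.t' n p q lam) * (HG.theta hq hp hn ^ (i + 1)) (HG.t' n p q lam) =
      HG.t' n p q lam * HG.tn n p q lam 0 := by
  induction i with
  | zero => rw [pow_zero, AlgHom.one_apply, zero_add, pow_one, HG.theta_t']
  | succ i ih =>
    rw [pow_succ' _ i, pow_succ' _ (i + 1), AlgHom.mul_apply, AlgHom.mul_apply, ← map_mul, ih,
      map_mul, HG.theta_t', HG.tn_zero_mul_theta]

/-- The element `t'_1 t_1` moves along the sequence `θ^i(t'_1)` in steps of two. -/
theorem HG.pow_mul_theta_pow (i k : ℕ) :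
    (HG.t' n p q lam * HG.tn n p q lam 0) ^ k *
        (HG.theta hq hp hn ^ (i + 2 * k)) (HG.t' n p q lam) =
      (HG.theta hq hp hn ^ i) (HG.t' n p q lam) * (HG.t' n p q lam * HG.tn n p q lam 0) ^ k := by
  induction k with
  | zero => rw [pow_zero, one_mul, mul_one, mul_zero, add_zero]
  | succ k ih =>
    have h1 := HG.theta_pow_mul_theta_pow_succ (lam := lam) hq hp hn (i + 2 * k)
    have h2 := HG.theta_pow_mul_theta_pow_succ (lam := lam) hq hp hn (i + 2 * k + 1)
    have h3 : (HG.t' n p q lam * HG.tn n p q lam 0) *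
        (HG.theta hq hp hn ^ (i + 2 * (k + 1))) (HG.t' n p q lam) =
        (HG.theta hq hp hn ^ (i + 2 * k)) (HG.t' n p q lam) *
          (HG.t' n p q lam * HG.tn n p q lam 0) := by
      rw [← h1, mul_assoc, show i + 2 * (k + 1) = i + 2 * k + 1 + 1 by ring, h2, h1]
    rw [pow_succ, mul_assoc, h3, ← mul_assoc, ih, mul_assoc]

theorem HG.isUnit_t' (hq : q ≠ 0) : IsUnit (HG.t' n p q lam) :=
  (heckeUnit hq (HG.system n p q lam).quad').isUnit

theorem HG.isUnit_tn_zero (hq : q ≠ 0) (hn : 0 < n - 1) : IsUnit (HG.tn n p q lam 0) :=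
  (heckeUnit hq ((HG.system n p q lam).quad 0 hn)).isUnit

theorem HG.theta_pow_t'_mul_s :
    (HG.theta hq hp hn ^ p) (HG.t' n p q lam) * HG.s n p q lam =
      HG.s n p q lam * HG.t' n p q lam := by
  have hG := HG.system n p q lam
  have hsz : Commute (HG.s n p q lam) (HG.t' n p q lam * HG.tn n p q lam 0) := by
    have := hG.braidS hn
    rwa [mul_assoc] at this
  have hb := hG.bigBraid hn
  have hz : IsUnit (HG.t' n p q lam * HG.tn n p q lam 0) :=
    (HG.isUnit_t' hq).mul (HG.isUnit_tn_zero hq hn)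
  -- by `HG.pow_mul_theta_pow`, the claim multiplied by `(t'_1 t_1)^k` with `k = p / 2` only involves
  -- `θ^i(t'_1)` with `i = p - 2 * k ≤ 1`, where it is the relation with `p + 1` factors
  have h : ∃ i k, p = i + 2 * k ∧
      (HG.theta hq hp hn ^ i) (HG.t' n p q lam) * HG.s n p q lam *
          (HG.t' n p q lam * HG.tn n p q lam 0) ^ k =
        HG.s n p q lam * (HG.t' n p q lam * HG.tn n p q lam 0) ^ k * HG.t' n p q lam := by
    obtain ⟨k, hk | hk⟩ := Nat.even_or_odd' p
    · obtain ⟨j, rfl⟩ : ∃ j, k = j + 1 := ⟨k - 1, by omega⟩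
      rw [show altProd (HG.t' n p q lam) (HG.tn n p q lam 0) p =
          (HG.t' n p q lam * HG.tn n p q lam 0) ^ (j + 1) by
            rw [← altProd_two_mul, ← hk],
        show altProd (HG.t' n p q lam) (HG.tn n p q lam 0) (p - 1) =
          (HG.t' n p q lam * HG.tn n p q lam 0) ^ j * HG.t' n p q lam by
            rw [← altProd_two_mul_add_one]; congr 1; omega] at hb
      refine ⟨0, j + 1, by omega, ?_⟩
      rw [pow_zero, AlgHom.one_apply, mul_assoc]
      conv_lhs => rw [hb]
      rw [pow_succ', ← mul_assoc (HG.s n p q lam), hsz.eq]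
      simp only [mul_assoc]
    · rw [show altProd (HG.t' n p q lam) (HG.tn n p q lam 0) p =
          (HG.t' n p q lam * HG.tn n p q lam 0) ^ k * HG.t' n p q lam by
            rw [← altProd_two_mul_add_one, ← hk],
        show altProd (HG.t' n p q lam) (HG.tn n p q lam 0) (p - 1) =
          (HG.t' n p q lam * HG.tn n p q lam 0) ^ k by
            rw [← altProd_two_mul]; congr 1; omega] at hb
      refine ⟨1, k, by omega, ?_⟩
      rw [pow_one, HG.theta_t', ← hb, mul_assoc]
  obtain ⟨i, k, hp', h⟩ := h
  refine (hz.pow k).mul_left_cancel ?_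
  rw [← mul_assoc]
  conv_lhs => rw [show HG.theta (lam := lam) hq hp hn ^ p = HG.theta hq hp hn ^ (i + 2 * k) from
    congrArg _ hp']
  rw [HG.pow_mul_theta_pow, mul_assoc, ← (hsz.pow_right k).eq, ← mul_assoc, h,
    (hsz.pow_right k).eq, mul_assoc]

/-- The `p`-th power of `θ` is conjugation by `s`. -/
theorem HG.theta_pow_mul_s (x : HG n p q lam) :
    (HG.theta hq hp hn ^ p) x * HG.s n p q lam = HG.s n p q lam * x := by
  let B : Subalgebra F (HG n p q lam) :=
    { carrier := {x | (HG.theta hq hp hn ^ p) x * HG.s n p q lam = HG.s n p q lam * x}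
      mul_mem' := fun {a b} ha hb => by
        simp only [Set.mem_ofPred_eq] at *
        rw [map_mul, mul_assoc, hb, ← mul_assoc, ha, mul_assoc]
      add_mem' := fun {a b} ha hb => by
        simp only [Set.mem_ofPred_eq] at *
        rw [map_add, add_mul, ha, hb, mul_add]
      algebraMap_mem' := fun r => by
        simp only [Set.mem_ofPred_eq]
        rw [AlgHom.commutes, Algebra.commutes] }
  have h' := HG.theta_pow_t'_mul_s (lam := lam) hq hp hn
  have hB : B = ⊤ := by
    refine HG.eq_top_of_mem B ?_ h' fun a => ?_
    · exact congrArg (· * HG.s n p q lam) (HG.theta_pow_s hq hp hn p)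
    · change (HG.theta hq hp hn ^ p) _ * _ = _ * _
      rw [← HG.tn_of_lt a.2]
      by_cases ha : (a : ℕ) = 0
      · rw [ha]
        refine ((HG.isUnit_t' hq).map (HG.theta (lam := lam) hq hp hn ^ p)).mul_left_cancel ?_
        rw [← mul_assoc, ← mul_assoc, h', ← HG.theta_t' hq hp hn, ← AlgHom.mul_apply, ← pow_succ,
          HG.theta_pow_mul_theta_pow_succ, HG.theta_t' hq hp hn]
        exact ((HG.system n p q lam).braidS hn).symm
      · rw [HG.theta_pow_tn_of_pos hq hp hn (Nat.pos_of_ne_zero ha)]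
        exact ((HG.system n p q lam).commS a a.2 (Nat.pos_of_ne_zero ha)).eq.symm
  have : x ∈ B := hB ▸ Algebra.mem_top
  exact this

end Twist

section Sequences

variable {F A : Type*} [Field F] [Ring A] [Algebra F A]

/-- The space of sequences `v` in an algebra with `v (i + p) = s v i`. -/
def seqSpace (F : Type*) [Field F] {A : Type*} [Ring A] [Algebra F A] (s : A) (p : ℕ) :
    Submodule F (ℕ → A) where
  carrier := {v | ∀ i, v (i + p) = s * v i}
  zero_mem' i := by simp
  add_mem' {v w} hv hw i := by simp only [Pi.add_apply, hv i, hw i, mul_add]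
  smul_mem' c v hv i := by simp only [Pi.smul_apply, hv i, mul_smul_comm]

/-- The left shift on sequences with `v (i + p) = s v i`; its `p`-th power is multiplication by
`s`. -/
def seqShift (F : Type*) [Field F] {A : Type*} [Ring A] [Algebra F A] (s : A) (p : ℕ) :
    Module.End F (seqSpace F s p) where
  toFun v := ⟨fun i => v.1 (i + 1), fun i => by
    change v.1 (i + p + 1) = _
    rw [add_right_comm, v.2]⟩
  map_add' v w := rfl
  map_smul' c v := rfl

theorem seqShift_pow_apply (s : A) (p k : ℕ) (v : seqSpace F s p) (i : ℕ) :
    ((seqShift F s p ^ k) v).1 i = v.1 (i + k) := by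
  induction k generalizing i with
  | zero => rfl
  | succ k ih =>
    rw [pow_succ', Module.End.mul_apply]
    exact (ih (i + 1)).trans (by rw [add_right_comm, add_assoc])

variable {s : A} {p : ℕ} {θ : A →ₐ[F] A} (hθ : ∀ x, (θ ^ p) x * s = s * x)

/-- The action of an algebra on sequences with `v (i + p) = s v i`, where `h` acts on the `i`-th
entry by `θ^i(h)`. It is well defined if `θ^p` is conjugation by `s`. -/
def seqAction : A →ₐ[F] Module.End F (seqSpace F s p) where
  toFun h :=
    { toFun := fun v => ⟨fun i => (θ ^ i) h * v.1 i, fun i => by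
        change (θ ^ (i + p)) h * v.1 (i + p) = _
        rw [v.2 i, add_comm, pow_add, AlgHom.mul_apply, ← mul_assoc, hθ, mul_assoc]⟩
      map_add' := fun v w => Subtype.ext (funext fun i => mul_add _ _ _)
      map_smul' := fun c v => Subtype.ext (funext fun i => mul_smul_comm c _ (v.1 i)) }
  map_one' := LinearMap.ext fun v => Subtype.ext (funext fun i => by
    change (θ ^ i) 1 * v.1 i = v.1 i
    rw [map_one, one_mul])
  map_mul' a b := LinearMap.ext fun v => Subtype.ext (funext fun i => by
    change (θ ^ i) (a * b) * v.1 i = (θ ^ i) a * ((θ ^ i) b * v.1 i)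
    rw [map_mul, mul_assoc])
  map_zero' := LinearMap.ext fun v => Subtype.ext (funext fun i => by
    change (θ ^ i) 0 * v.1 i = 0
    rw [map_zero, zero_mul])
  map_add' a b := LinearMap.ext fun v => Subtype.ext (funext fun i => by
    change (θ ^ i) (a + b) * v.1 i = (θ ^ i) a * v.1 i + (θ ^ i) b * v.1 i
    rw [map_add, add_mul])
  commutes' r := LinearMap.ext fun v => Subtype.ext (funext fun i => by
    change (θ ^ i) (algebraMap F _ r) * v.1 i = r • v.1 i
    rw [AlgHom.commutes, Algebra.smul_def])

theorem seqAction_apply (h : A) (v : seqSpace F s p) (i : ℕ) :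
    (seqAction hθ h v).1 i = (θ ^ i) h * v.1 i := rfl

theorem seqAction_injective (hp : 1 ≤ p) : Function.Injective (seqAction hθ) := by
  let v : seqSpace F s p := ⟨fun i => s ^ (i / p), fun i => by
    change s ^ ((i + p) / p) = _
    rw [Nat.add_div_right _ (by omega), pow_succ']⟩
  intro a b hab
  have := congrArg (fun f => (f v).1 0) hab
  simpa only [seqAction_apply, pow_zero, AlgHom.one_apply, v, Nat.zero_div, mul_one] using this

theorem seqShift_pow (hs : θ s = s) : seqShift F s p ^ p = seqAction hθ s := by
  have hs' : ∀ k, (θ ^ k) s = s := fun k => by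
    induction k with
    | zero => rfl
    | succ k ih => rw [pow_succ, AlgHom.mul_apply, hs, ih]
  refine LinearMap.ext fun v => Subtype.ext (funext fun i => ?_)
  rw [seqShift_pow_apply, seqAction_apply, hs', v.2 i]

theorem seqShift_mul_seqAction (h : A) :
    seqShift F s p * seqAction hθ h = seqAction hθ (θ h) * seqShift F s p :=
  LinearMap.ext fun v => Subtype.ext (funext fun i => by
    change (θ ^ (i + 1)) h * v.1 (i + 1) = (θ ^ i) (θ h) * v.1 (i + 1)
    rw [pow_succ, AlgHom.mul_apply])

variable {q : F} {g : F[X]} {N : ℕ} {t' : A} {t : ℕ → A}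

/-- The shift and the action of the `t_a` on sequences make up a representation of the
Ariki--Koike algebra. -/
theorem GSystem.akSystem_seqShift (h : GSystem q g p N s t' t) (hs : θ s = s) (ht' : θ t' = t 0)
    (ht : 0 < N → t 0 * θ (t 0) = t' * t 0) (ht_pos : ∀ i, 0 < i → θ (t i) = t i) :
    AKSystem q (g.comp (X ^ p)) N (seqShift F s p) (fun i => seqAction hθ (t i)) where
  cyclo := by
    rw [aeval_comp, map_pow, aeval_X, seqShift_pow hθ hs, aeval_algHom_apply, h.cyclo, map_zero]
  quad i hi := by
    rw [← map_mul, h.quad i hi, map_add, map_smul, map_smul, map_one]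
  braidS hN := by
    have h1 : seqAction hθ (t 0) * seqShift F s p * seqAction hθ (t 0) =
        seqAction hθ (t' * t 0) * seqShift F s p := by
      rw [mul_assoc, seqShift_mul_seqAction, ← mul_assoc, ← map_mul, ht hN]
    have h2 : θ (t' * t 0) = t' * t 0 := by rw [map_mul, ht', ht hN]
    rw [h1, mul_assoc (seqShift F s p), mul_assoc (seqShift F s p), h1, ← mul_assoc,
      seqShift_mul_seqAction, h2]
  commS i _ h0 := by
    change _ * _ = _ * _
    rw [seqShift_mul_seqAction, ht_pos i h0]
  comm i j hij hj := (h.comm i j hij hj).map (seqAction hθ)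
  braid i hi := by simp only [← map_mul, h.braid i hi]

end Sequences

section Injectivity

variable {F : Type*} [Field F] {n p : ℕ} {q ζ : F} {Λ : Weight p q} {lam : WeightI q}

/-- Injectivity of `φ`, for an algebra `A` generated by `s, t', t 0, …, t (n - 2)` with a twist `θ`:
the action on sequences factors through `φ`, and it is faithful. -/
theorem injective_of_twist {A : Type*} [Ring A] [Algebra F A] {s t' : A} {t : ℕ → A}
    {θ : A →ₐ[F] A} (hp : 1 ≤ p) (hn : 0 < n - 1)
    (hcomp : akPoly p q ζ Λ = (gPoly p q lam).comp (X ^ p))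
    (hgen : ∀ B : Subalgebra F A, s ∈ B → t' ∈ B → (∀ i < n - 1, t i ∈ B) → B = ⊤)
    (h : GSystem q (gPoly p q lam) p (n - 1) s t' t)
    (hθ : ∀ x, (θ ^ p) x * s = s * x) (hs : θ s = s) (ht' : θ t' = t 0)
    (ht : t 0 * θ (t 0) = t' * t 0) (ht_pos : ∀ i, 0 < i → θ (t i) = t i)
    (φ : A →ₐ[F] AK n p q ζ Λ) (hφs : φ s = AK.S n p q ζ Λ ^ p)
    (hφt' : AK.S n p q ζ Λ * φ t' = AK.Tn n p q ζ Λ 0 * AK.S n p q ζ Λ)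
    (hφt : ∀ i < n - 1, φ (t i) = AK.Tn n p q ζ Λ i) (hS : IsUnit (AK.S n p q ζ Λ)) :
    Function.Injective φ := by
  have hsys : AKSystem q (akPoly p q ζ Λ) (n - 1) (seqShift F s p)
      (fun i => seqAction hθ (t i)) :=
    hcomp ▸ h.akSystem_seqShift hθ hs ht' (fun _ => ht) ht_pos
  have hT : ∀ i < n - 1, AK.lift hsys (AK.Tn n p q ζ Λ i) = seqAction hθ (t i) := fun i hi => by
    rw [AK.Tn_of_lt hi, AK.lift_T]
  have key : (AK.lift hsys).comp φ = seqAction hθ := by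
    have := hgen (AlgHom.equalizer ((AK.lift hsys).comp φ) (seqAction hθ)) ?_ ?_ ?_
    · exact AlgHom.ext fun x => by
        have hx : x ∈ AlgHom.equalizer ((AK.lift hsys).comp φ) (seqAction hθ) :=
          this ▸ Algebra.mem_top
        exact hx
    · change AK.lift hsys (φ s) = _
      rw [hφs, map_pow, AK.lift_S, seqShift_pow hθ hs]
    · change AK.lift hsys (φ t') = _
      have h1 := hS.map (AK.lift hsys)
      rw [AK.lift_S] at h1
      refine h1.mul_left_cancel ?_
      rw [seqShift_mul_seqAction, ht', ← hT 0 hn]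
      have h2 := congrArg (AK.lift hsys) hφt'
      rwa [map_mul, map_mul, AK.lift_S] at h2
    · intro i hi
      change AK.lift hsys (φ (t i)) = _
      rw [hφt i hi, hT i hi]
  have hinj := seqAction_injective hθ hp
  rw [← key] at hinj
  exact Function.Injective.of_comp (f := AK.lift hsys) hinj

end Injectivity

/-! ### Restriction to type `G(r, p, n)` and fixed points -/

/-- The relation with `p + 1` factors between `a^p`, `a⁻¹ba` and `b`, in a group. -/
theorem pow_mul_altProd_conj {G : Type*} [Group G] {a b : G}
    (hab : a * b * a * b = b * a * b * a) {p : ℕ} (hp : 1 ≤ p) :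
    a ^ p * altProd (a⁻¹ * b * a) b p = b * a ^ p * altProd (a⁻¹ * b * a) b (p - 1) := by
  -- `a * b` is a square root of an element that is central in the subgroup generated by `a, b`
  have hy : ∀ k, a ^ (2 * k) * (a⁻¹ * b * a * b) ^ k = (a * b * a * b) ^ k := fun k => by
    have hc : Commute a (a⁻¹ * b * a * b) := by
      change a * (a⁻¹ * b * a * b) = a⁻¹ * b * a * b * a
      calc a * (a⁻¹ * b * a * b) = a⁻¹ * (a * b * a * b) := by group
        _ = a⁻¹ * b * a * b * a := by rw [hab]; group
    rw [pow_mul, ← (hc.pow_left 2).mul_pow]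
    congr 1
    group
  have hya : Commute a (a * b * a * b) := by
    change a * (a * b * a * b) = a * b * a * b * a
    rw [hab]
    simp only [mul_assoc]
    rw [← mul_assoc a b, ← mul_assoc, ← mul_assoc, ← mul_assoc, hab]
    simp only [mul_assoc]
  have hyb : Commute b (a * b * a * b) := by
    change b * (a * b * a * b) = a * b * a * b * b
    conv_rhs => rw [hab]
    simp only [mul_assoc]
  obtain ⟨k, rfl | rfl⟩ := Nat.even_or_odd' p
  · obtain ⟨j, rfl⟩ : ∃ j, k = j + 1 := ⟨k - 1, by omega⟩
    rw [show 2 * (j + 1) - 1 = 2 * j + 1 by omega, altProd_two_mul, altProd_two_mul_add_one, hy]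
    calc (a * b * a * b) ^ (j + 1) = (a * b * a * b) ^ j * (b * a * b * a) := by
          rw [pow_succ, hab]
      _ = (a * b * a * b) ^ j * (b * a ^ 2) * (a⁻¹ * b * a) := by group
      _ = b * a ^ 2 * (a ^ (2 * j) * (a⁻¹ * b * a * b) ^ j) * (a⁻¹ * b * a) := by
          rw [hy, ((hyb.mul_left (hya.pow_left 2)).pow_right j).eq]
      _ = b * a ^ (2 * (j + 1)) * ((a⁻¹ * b * a * b) ^ j * (a⁻¹ * b * a)) := by
          rw [mul_add, add_comm, pow_add]
          simp only [mul_assoc]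
  · rw [Nat.add_sub_cancel, altProd_two_mul, altProd_two_mul_add_one, pow_succ' a]
    calc a * a ^ (2 * k) * ((a⁻¹ * b * a * b) ^ k * (a⁻¹ * b * a))
        = a * (a ^ (2 * k) * (a⁻¹ * b * a * b) ^ k) * (a⁻¹ * b * a) := by simp only [mul_assoc]
      _ = (a * b * a * b) ^ k * (b * a) := by
          rw [hy, (hya.pow_right k).eq]; group
      _ = b * (a * a ^ (2 * k)) * (a⁻¹ * b * a * b) ^ k := by
          rw [← ((hyb.mul_left hya).pow_right k).eq, ← hy]; simp only [mul_assoc]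

section Restriction

variable {F A : Type*} [Field F] [Ring A] [Algebra F A]

/-- The relations of type `G(r, p, n)` hold for `S^p`, `S⁻¹T_1S` and the `T_a`. -/
theorem AKSystem.gSystem {q : F} (hq : q ≠ 0) {g : F[X]} {p N : ℕ} (hp : 1 ≤ p) {S : Aˣ}
    {T : ℕ → A} (h : AKSystem q (g.comp (X ^ p)) N (S : A) T) (hN : 0 < N) :
    GSystem q g p N ((S : A) ^ p) (↑S⁻¹ * T 0 * S) T := by
  let b := heckeUnit hq (h.quad 0 hN)
  have hSb : S * b * S * b = b * S * b * S := Units.ext (h.braidS hN)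
  refine
    { cyclo := ?_
      quad' := ?_
      quad := h.quad
      braid' := fun h1 => ?_
      braid := h.braid
      braid6 := fun h1 => ?_
      comm' := fun i hi h2 => ?_
      comm := h.comm
      commS := fun i hi h1 => (h.commS i hi h1).pow_left p
      braidS := fun _ => ?_
      bigBraid := fun _ => ?_ }
  · have := h.cyclo
    rwa [aeval_comp, map_pow, aeval_X] at this
  · calc (↑S⁻¹ * T 0 * S : A) * (↑S⁻¹ * T 0 * S) = ↑S⁻¹ * (T 0 * T 0) * S := by
          simp only [mul_assoc, Units.mul_inv_cancel_left]
      _ = _ := by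
          rw [h.quad 0 hN]
          simp only [mul_add, add_mul, mul_smul_comm, smul_mul_assoc, mul_one, Units.inv_mul]
  · let c := heckeUnit hq (h.quad 1 h1)
    have hc : Commute S c := Units.ext (h.commS 1 h1 one_pos)
    have hbc : b * c * b = c * b * c := Units.ext (h.braid 0 h1)
    have : S⁻¹ * b * S * c * (S⁻¹ * b * S) = c * (S⁻¹ * b * S) * c := by
      calc S⁻¹ * b * S * c * (S⁻¹ * b * S) = S⁻¹ * b * (S * c) * S⁻¹ * b * S := by group
        _ = S⁻¹ * (b * c * b) * S := by rw [hc.eq]; group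
        _ = S⁻¹ * c * b * (c * S) := by rw [hbc]; group
        _ = c * (S⁻¹ * b * S) * c := by rw [← hc.eq, hc.inv_left.eq]; group
    exact congrArg Units.val this
  · let c := heckeUnit hq (h.quad 1 h1)
    have hc : Commute S c := Units.ext (h.commS 1 h1 one_pos)
    -- up to scalars, `b * S * b` and `c * b * S * b * c` are `X_2` and `X_3`
    have hx : (b * S * b) * (c * (b * S * b) * c) = c * (b * S * b) * c * (b * S * b) := by
      refine Units.ext ?_
      have h2 := h.commute_jm_jm one_lt_two h1
      have h3 : ∀ x : A, Commute (q⁻¹ • x) (q⁻¹ • (T 1 * (q⁻¹ • x) * T 1)) →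
          x * (T 1 * x * T 1) = T 1 * x * T 1 * x := fun x hxy => by
        have := ((hxy.smul_left q).smul_right q).smul_right q
        rw [smul_inv_smul₀ hq, smul_inv_smul₀ hq, mul_smul_comm, smul_mul_assoc,
          smul_inv_smul₀ hq] at this
        exact this.eq
      exact h3 _ h2
    have : (S⁻¹ * b * S * b * c) ^ 2 = (c * (S⁻¹ * b * S) * b) ^ 2 := by
      have hxS : Commute S (b * S * b) := by
        change S * (b * S * b) = b * S * b * S
        rw [← hSb]; group
      calc (S⁻¹ * b * S * b * c) ^ 2 = S⁻¹ * (b * S * b) * (c * S⁻¹) * (b * S * b) * c := by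
            rw [pow_two]; group
        _ = S⁻¹ * ((b * S * b) * S⁻¹) * c * (b * S * b) * c := by
            rw [← hc.inv_left.eq]; group
        _ = S⁻¹ * S⁻¹ * ((b * S * b) * (c * (b * S * b) * c)) := by
            rw [← hxS.inv_left.eq]; group
        _ = S⁻¹ * (S⁻¹ * c) * (b * S * b) * c * (b * S * b) := by rw [hx]; group
        _ = S⁻¹ * (c * S⁻¹) * (b * S * b) * c * (b * S * b) := by rw [hc.inv_left.eq]
        _ = S⁻¹ * c * (S⁻¹ * (b * S * b)) * c * (b * S * b) := by simp only [mul_assoc]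
        _ = c * S⁻¹ * ((b * S * b) * S⁻¹) * c * (b * S * b) := by
            rw [hxS.inv_left.eq, hc.inv_left.eq]
        _ = c * S⁻¹ * (b * S * b) * (S⁻¹ * c) * (b * S * b) := by simp only [mul_assoc]
        _ = (c * (S⁻¹ * b * S) * b) ^ 2 := by rw [hc.inv_left.eq, pow_two]; group
    exact congrArg Units.val this
  · have h1 := h.commS i hi (by omega)
    exact ((h1.units_inv_left).mul_left (h.comm 0 i (by omega) hi)).mul_left h1
  · have hc : Commute S (S⁻¹ * b * S * b) := by
      change S * (S⁻¹ * b * S * b) = S⁻¹ * b * S * b * S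
      calc S * (S⁻¹ * b * S * b) = S⁻¹ * (S * b * S * b) := by group
        _ = S⁻¹ * b * S * b * S := by rw [hSb]; group
    have := (hc.pow_left p).eq
    rw [← mul_assoc] at this
    exact congrArg Units.val this
  · have := congrArg (Units.coeHom A) (pow_mul_altProd_conj hSb hp)
    simp only [map_mul, altProd_map, map_pow] at this
    exact this

end Restriction

section Fixed

variable {F : Type*} [Field F] {n p : ℕ} {q ζ : F} {Λ : Weight p q} {lam : WeightI q}

theorem AK.isUnit_S (hq : q ≠ 0) (hζ : ζ ≠ 0) : IsUnit (AK.S n p q ζ Λ) :=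
  isUnit_of_aeval_eq_zero (coeff_zero_akPoly_ne_zero hq hζ) (AK.system n p q ζ Λ).cyclo

/-- The relations of the Ariki--Koike algebra are invariant under scaling `S` by a `p`-th root of
unity. -/
theorem AK.system_smul (hcomp : akPoly p q ζ Λ = (gPoly p q lam).comp (Polynomial.X ^ p)) {ξ : F}
    (hξ : ξ ^ p = 1) :
    AKSystem q (akPoly p q ζ Λ) (n - 1) (ξ • AK.S n p q ζ Λ) (AK.Tn n p q ζ Λ) where
  cyclo := by
    have := (AK.system n p q ζ Λ).cyclo
    rw [hcomp, aeval_comp, map_pow, aeval_X] at this ⊢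
    rwa [_root_.smul_pow, hξ, one_smul]
  quad := (AK.system n p q ζ Λ).quad
  braidS hN := by
    simp only [smul_mul_assoc, mul_smul_comm, (AK.system n p q ζ Λ).braidS hN]
  commS i hi h0 := ((AK.system n p q ζ Λ).commS i hi h0).smul_left ξ
  comm := (AK.system n p q ζ Λ).comm
  braid := (AK.system n p q ζ Λ).braid

/-- The shift automorphism `S ↦ ζS`. -/
noncomputable def AK.shift (hcomp : akPoly p q ζ Λ = (gPoly p q lam).comp (Polynomial.X ^ p))
    (hζ : ζ ^ p = 1) (hζ0 : ζ ≠ 0) : AK n p q ζ Λ ≃ₐ[F] AK n p q ζ Λ :=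
  AlgEquiv.ofAlgHom (AK.lift (AK.system_smul hcomp hζ))
    (AK.lift (AK.system_smul hcomp (ξ := ζ⁻¹) (by rw [inv_pow, hζ, inv_one])))
    (AK.hom_ext (by simp [smul_smul, hζ0]) fun a => by
      simp [AK.Tn_of_lt a.2])
    (AK.hom_ext (by simp [smul_smul, hζ0]) fun a => by
      simp [AK.Tn_of_lt a.2])

theorem AK.shift_S (hcomp : akPoly p q ζ Λ = (gPoly p q lam).comp (Polynomial.X ^ p))
    (hζ : ζ ^ p = 1) (hζ0 : ζ ≠ 0) :
    AK.shift hcomp hζ hζ0 (AK.S n p q ζ Λ) = ζ • AK.S n p q ζ Λ :=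
  AK.lift_S _

theorem AK.shift_T (hcomp : akPoly p q ζ Λ = (gPoly p q lam).comp (Polynomial.X ^ p))
    (hζ : ζ ^ p = 1) (hζ0 : ζ ≠ 0) (a : Fin (n - 1)) :
    AK.shift hcomp hζ hζ0 (AK.T n p q ζ Λ a) = AK.T n p q ζ Λ a :=
  (AK.lift_T _ a).trans (AK.Tn_of_lt a.2)

variable {φ : HG n p q lam →ₐ[F] AK n p q ζ Λ} (hφs : φ (HG.s n p q lam) = AK.S n p q ζ Λ ^ p)
  (hφt' : AK.S n p q ζ Λ * φ (HG.t' n p q lam) = AK.Tn n p q ζ Λ 0 * AK.S n p q ζ Λ)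
  (hφt : ∀ a : Fin (n - 1), φ (HG.t n p q lam a) = AK.T n p q ζ Λ a)
  (hS : IsUnit (AK.S n p q ζ Λ))
include hφs hφt' hφt hS

/-- Under `φ`, the endomorphism `θ` becomes conjugation by `S`. -/
theorem AK.S_mul_map (hq : q ≠ 0) (hp : 1 ≤ p) (hn : 0 < n - 1) (x : HG n p q lam) :
    AK.S n p q ζ Λ * φ x = φ (HG.theta hq hp hn x) * AK.S n p q ζ Λ := by
  have hφtn : ∀ i < n - 1, φ (HG.tn n p q lam i) = AK.Tn n p q ζ Λ i := fun i hi => by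
    rw [HG.tn_of_lt hi, hφt, AK.Tn_of_lt hi]
  have hsys := AK.system n p q ζ Λ
  let B : Subalgebra F (HG n p q lam) :=
    { carrier := {x | AK.S n p q ζ Λ * φ x = φ (HG.theta hq hp hn x) * AK.S n p q ζ Λ}
      mul_mem' := fun {a b} ha hb => by
        simp only [Set.mem_ofPred_eq] at *
        rw [map_mul, map_mul, map_mul, ← mul_assoc, ha, mul_assoc, hb, mul_assoc]
      add_mem' := fun {a b} ha hb => by
        simp only [Set.mem_ofPred_eq] at *
        rw [map_add, map_add, map_add, mul_add, ha, hb, add_mul]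
      algebraMap_mem' := fun r => by
        simp only [Set.mem_ofPred_eq]
        rw [AlgHom.commutes, AlgHom.commutes, AlgHom.commutes, Algebra.commutes] }
  have hB : B = ⊤ := by
    refine HG.eq_top_of_mem B ?_ ?_ fun a => ?_
    · change _ * φ _ = φ (HG.theta hq hp hn _) * _
      rw [show HG.theta hq hp hn (HG.s n p q lam) = HG.s n p q lam from HG.lift_s _, hφs,
        ← pow_succ, ← pow_succ']
    · change _ * φ _ = φ (HG.theta hq hp hn _) * _
      rw [HG.theta_t', hφtn 0 hn, hφt']
    · change _ * φ _ = φ (HG.theta hq hp hn _) * _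
      rw [← HG.tn_of_lt a.2]
      by_cases ha : (a : ℕ) = 0
      · rw [ha]
        refine ((heckeUnit hq (hsys.quad 0 hn)).isUnit).mul_left_cancel ?_
        change AK.Tn n p q ζ Λ 0 * _ = AK.Tn n p q ζ Λ 0 * _
        have h1 := congrArg φ (HG.tn_zero_mul_theta (lam := lam) hq hp hn)
        rw [map_mul, map_mul, hφtn 0 hn] at h1
        rw [← mul_assoc _ _ (AK.S n p q ζ Λ), h1, hφtn 0 hn]
        refine hS.mul_left_cancel ?_
        rw [← mul_assoc _ (φ _ * _), ← mul_assoc _ (φ _), hφt', ← mul_assoc, ← mul_assoc,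
          hsys.braidS hn]
      · rw [HG.theta_tn_of_pos hq hp hn (Nat.pos_of_ne_zero ha), hφtn a a.2]
        exact hsys.commS a a.2 (Nat.pos_of_ne_zero ha)
  have : x ∈ B := hB ▸ Algebra.mem_top
  exact this

/-- The elements `φ(h) S^i` span the Ariki--Koike algebra. -/
theorem AK.span_map_mul_pow (hq : q ≠ 0) (hp : 1 ≤ p) (hn : 0 < n - 1) :
    Submodule.span F (Set.range fun x : HG n p q lam × ℕ => φ x.1 * AK.S n p q ζ Λ ^ x.2) = ⊤ := by
  refine AK.eq_top_of_mul_mem _ (Submodule.subset_span ⟨(1, 0), by simp⟩) (fun x hx => ?_)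
    fun a x hx => ?_
  · induction hx using Submodule.span_induction with
    | mem x hx =>
      obtain ⟨⟨h, i⟩, rfl⟩ := hx
      refine Submodule.subset_span ⟨(HG.theta hq hp hn h, i + 1), ?_⟩
      change φ _ * _ = _ * (φ h * _)
      rw [← mul_assoc, AK.S_mul_map hφs hφt' hφt hS hq hp hn, mul_assoc, pow_succ']
    | zero => rw [mul_zero]; exact Submodule.zero_mem _
    | add x y _ _ hx hy => rw [mul_add]; exact Submodule.add_mem _ hx hy
    | smul c x _ hx => rw [mul_smul_comm]; exact Submodule.smul_mem _ _ hx
  · induction hx using Submodule.span_induction with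
    | mem x hx =>
      obtain ⟨⟨h, i⟩, rfl⟩ := hx
      refine Submodule.subset_span ⟨(HG.t n p q lam a * h, i), ?_⟩
      change φ _ * _ = _ * (φ h * _)
      rw [← hφt, map_mul, mul_assoc]
    | zero => rw [mul_zero]; exact Submodule.zero_mem _
    | add x y _ _ hx hy => rw [mul_add]; exact Submodule.add_mem _ hx hy
    | smul c x _ hx => rw [mul_smul_comm]; exact Submodule.smul_mem _ _ hx

/-- A fixed vector is a combination of the `φ(h) S^i` with `p ∣ i`, and `S^p = φ(s)`. -/
theorem AK.range_eq_fixedSubalgebra (hq : q ≠ 0) (hp : 1 ≤ p) (hn : 0 < n - 1)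
    (hζ : IsPrimitiveRoot ζ p) {σ : AK n p q ζ Λ ≃ₐ[F] AK n p q ζ Λ}
    (hσS : σ (AK.S n p q ζ Λ) = ζ • AK.S n p q ζ Λ)
    (hσT : ∀ a, σ (AK.T n p q ζ Λ a) = AK.T n p q ζ Λ a) (hζ0 : ζ ≠ 0) : φ.range = fixedSubalgebra σ := by
  have hfix : ∀ h, σ (φ h) = φ h := by
    have : (σ : AK n p q ζ Λ →ₐ[F] AK n p q ζ Λ).comp φ = φ := by
      refine HG.hom_ext ?_ ?_ fun a => ?_
      · change σ (φ _) = _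
        rw [hφs, map_pow, hσS, _root_.smul_pow, hζ.pow_eq_one, one_smul]
      · change σ (φ _) = _
        have h1 := congrArg σ hφt'
        rw [map_mul, map_mul, hσS, smul_mul_assoc, mul_smul_comm] at h1
        have h2 := smul_right_injective _ hζ0 h1
        rw [AK.Tn, dif_pos hn, hσT, ← AK.Tn_of_lt hn, ← hφt'] at h2
        exact hS.mul_left_cancel h2
      · change σ (φ _) = _
        rw [hφt, hσT]
    exact fun h => congrArg (fun f : HG n p q lam →ₐ[F] AK n p q ζ Λ => f h) this
  refine le_antisymm ?_ fun x hx => ?_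
  · rintro _ ⟨h, rfl⟩
    exact hfix h
  · have hx' : σ x = x := hx
    have h1 := mem_span_of_fixed (wt := Prod.snd) hp hζ σ.toLinearMap (fun i => by
      change σ (_ * _) = _
      rw [map_mul, hfix, map_pow, hσS, _root_.smul_pow, mul_smul_comm])
      (AK.span_map_mul_pow hφs hφt' hφt hS hq hp hn) hx'
    have h2 : Submodule.span F {y | ∃ i : HG n p q lam × ℕ, p ∣ i.2 ∧
        y = φ i.1 * AK.S n p q ζ Λ ^ i.2} ≤ Subalgebra.toSubmodule φ.range := by
      refine Submodule.span_le.2 ?_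
      rintro _ ⟨⟨h, _⟩, ⟨k, rfl⟩, rfl⟩
      refine ⟨h * HG.s n p q lam ^ k, ?_⟩
      change φ _ = _
      rw [map_mul, map_pow, hφs, pow_mul]
    exact h2 h1

end Fixed

section Monomials

variable {F : Type*} [Field F] {n p : ℕ} {q ζ : F} {Λ : Weight p q}
  {σ : AK n p q ζ Λ ≃ₐ[F] AK n p q ζ Λ}
  (hσS : σ (AK.S n p q ζ Λ) = ζ • AK.S n p q ζ Λ)
  (hσT : ∀ a, σ (AK.T n p q ζ Λ a) = AK.T n p q ζ Λ a)
include hσS hσT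

theorem AK.map_X (k : ℕ) : σ (AK.X n p q ζ Λ k) = ζ • AK.X n p q ζ Λ k := by
  induction k with
  | zero => exact hσS
  | succ k ih =>
    rw [AK.X]
    split_ifs with h
    · rw [map_smul, map_mul, map_mul, hσT, ih, mul_smul_comm, smul_mul_assoc, smul_comm]
    · rw [map_zero, smul_zero]

/-- The monomials are eigenvectors of the shift automorphism. -/
theorem AK.map_monomial (m : Fin n → ℕ) (l : List (Fin (n - 1))) :
    σ (AK.monomial n p q ζ Λ m l) = ζ ^ (∑ a, m a) • AK.monomial n p q ζ Λ m l := by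
  have h1 : σ (AK.Tword n p q ζ Λ l) = AK.Tword n p q ζ Λ l := by
    rw [AK.Tword, map_list_prod, List.map_map]
    congr 2
    exact funext hσT
  have h2 : ∀ {k : ℕ} (x : Fin k → AK n p q ζ Λ) (e : Fin k → ℕ), (∀ a, σ (x a) = ζ ^ e a • x a) →
      σ (List.ofFn x).prod = ζ ^ (∑ a, e a) • (List.ofFn x).prod := by
    intro k
    induction k with
    | zero => intro x e _; simp
    | succ k ih =>
      intro x e hx
      rw [List.ofFn_succ, List.prod_cons, map_mul, hx, ih _ (fun a => e a.succ) fun a => hx _,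
        Fin.sum_univ_succ, pow_add, smul_mul_smul_comm]
  rw [AK.monomial, map_mul, h1, h2 _ m fun a => ?_, smul_mul_assoc]
  rw [map_pow, AK.map_X hσS hσT, _root_.smul_pow]

end Monomials

end CycHecke


open CycHecke in
theorem mainTheorem10 {F : Type*} [Field F] (n p d : ℕ) (hn : 2 ≤ n) (hp : 1 ≤ p) (hd : 1 ≤ d)
    (q ζ : F) (hq0 : q ≠ 0) (hq1 : q ≠ 1) (hζ : IsPrimitiveRoot ζ p)
    (Λ : Weight p q) (lam : WeightI q)
    (hlevel : (Λ.sum fun _ m => m) = p * d)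
    (hΛ : ∀ (i : ZMod (orderOf q)) (j : ZMod p), Λ (i, j) = lam i) :
    ∃ (Su : (AK n p q ζ Λ)ˣ) (σ : AK n p q ζ Λ ≃ₐ[F] AK n p q ζ Λ)
      (φ : HG n p q lam →ₐ[F] AK n p q ζ Λ),
      (Su : AK n p q ζ Λ) = AK.S n p q ζ Λ ∧
      -- `σ` is the shift automorphism
      σ (AK.S n p q ζ Λ) = ζ • AK.S n p q ζ Λ ∧
      (∀ a : Fin (n - 1), σ (AK.T n p q ζ Λ a) = AK.T n p q ζ Λ a) ∧
      -- `φ` is Ariki's homomorphism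
      φ (HG.s n p q lam) = AK.S n p q ζ Λ ^ p ∧
      φ (HG.t' n p q lam) =
        (↑Su⁻¹ : AK n p q ζ Λ) * AK.T n p q ζ Λ ⟨0, by omega⟩ * AK.S n p q ζ Λ ∧
      (∀ a : Fin (n - 1), φ (HG.t n p q lam a) = AK.T n p q ζ Λ a) ∧
      -- `φ` is an isomorphism onto the fixed point subalgebra
      Function.Injective φ ∧
      φ.range = fixedSubalgebra σ ∧
      -- for every choice of reduced expressions, the family `X^m T_w` is a basis, and its
      -- members with `∑ m_a ≡ 0 mod p` span the fixed point subalgebra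
      ∀ red : Equiv.Perm (Fin n) → List (Fin (n - 1)), (∀ w, IsReducedExpr (red w) w) →
        LinearIndependent F (fun x : (Fin n → Fin (p * d)) × Equiv.Perm (Fin n) =>
          AK.monomial n p q ζ Λ (fun a => (x.1 a : ℕ)) (red x.2)) ∧
        Submodule.span F (Set.range
          (fun x : (Fin n → Fin (p * d)) × Equiv.Perm (Fin n) =>
            AK.monomial n p q ζ Λ (fun a => (x.1 a : ℕ)) (red x.2))) = ⊤ ∧
        Submodule.span F {h : AK n p q ζ Λ |
          ∃ (m : Fin n → Fin (p * d)) (w : Equiv.Perm (Fin n)),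
            (∑ a, (m a : ℕ)) ≡ 0 [MOD p] ∧
            h = AK.monomial n p q ζ Λ (fun a => (m a : ℕ)) (red w)} =
          Subalgebra.toSubmodule (fixedSubalgebra σ) := by
  obtain ⟨N, rfl⟩ : ∃ N, n = N + 1 := ⟨n - 1, by omega⟩
  have hN : 0 < N + 1 - 1 := by omega
  have : NeZero p := ⟨by omega⟩
  have hζ0 : ζ ≠ 0 := hζ.ne_zero (by omega)
  have hcomp := akPoly_eq_comp hp hζ hΛ
  have hdeg : (akPoly p q ζ Λ).natDegree = p * d := natDegree_akPoly.trans hlevel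
  have hr : 0 < p * d := Nat.mul_pos hp hd
  obtain ⟨Su, hSu⟩ := AK.isUnit_S (n := N + 1) (Λ := Λ) hq0 hζ0
  have hS : IsUnit (AK.S (N + 1) p q ζ Λ) := hSu ▸ Su.isUnit
  have hsys : AKSystem q ((gPoly p q lam).comp (Polynomial.X ^ p)) (N + 1 - 1)
      (Su : AK (N + 1) p q ζ Λ) (AK.Tn (N + 1) p q ζ Λ) := by
    rw [← hcomp, hSu]
    exact AK.system (N + 1) p q ζ Λ
  let σ := AK.shift (n := N + 1) hcomp hζ.pow_eq_one hζ0
  have hσS : σ (AK.S (N + 1) p q ζ Λ) = ζ • AK.S (N + 1) p q ζ Λ := AK.shift_S _ _ _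
  have hσT : ∀ a, σ (AK.T (N + 1) p q ζ Λ a) = AK.T (N + 1) p q ζ Λ a := AK.shift_T _ _ _
  let φ : HG (N + 1) p q lam →ₐ[F] AK (N + 1) p q ζ Λ := HG.lift (hsys.gSystem hq0 hp hN)
  have hφs : φ (HG.s (N + 1) p q lam) = AK.S (N + 1) p q ζ Λ ^ p := by
    rw [← hSu]
    exact HG.lift_s _
  have hφt' : φ (HG.t' (N + 1) p q lam) =
      (↑Su⁻¹ : AK (N + 1) p q ζ Λ) * AK.Tn (N + 1) p q ζ Λ 0 * AK.S (N + 1) p q ζ Λ := by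
    rw [← hSu]
    exact HG.lift_t' _
  have hφt : ∀ a : Fin (N + 1 - 1), φ (HG.t (N + 1) p q lam a) = AK.T (N + 1) p q ζ Λ a :=
    fun a => (HG.lift_t _ a).trans (AK.Tn_of_lt a.2)
  have hφt'' : AK.S (N + 1) p q ζ Λ * φ (HG.t' (N + 1) p q lam) =
      AK.Tn (N + 1) p q ζ Λ 0 * AK.S (N + 1) p q ζ Λ := by
    rw [hφt', ← hSu, mul_assoc, Units.mul_inv_cancel_left]
  refine ⟨Su, σ, φ, hSu, hσS, hσT, hφs, ?_, hφt, ?_, ?_, fun red hred => ⟨?_, ?_, ?_⟩⟩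
  · rw [hφt', AK.Tn_of_lt hN]
  · refine injective_of_twist hp hN hcomp (fun B h1 h2 h3 => ?_) (HG.system (N + 1) p q lam)
      (HG.theta_pow_mul_s hq0 hp hN) (HG.lift_s _) (HG.theta_t' hq0 hp hN)
      (HG.tn_zero_mul_theta hq0 hp hN) (fun i hi => HG.theta_tn_of_pos hq0 hp hN hi) φ hφs hφt''
      (fun i hi => ?_) hS
    · refine HG.eq_top_of_mem B h1 h2 fun a => ?_
      have := h3 a a.2
      rwa [HG.tn_of_lt a.2] at this
    · rw [HG.tn_of_lt hi, hφt, AK.Tn_of_lt hi]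
  · exact AK.range_eq_fixedSubalgebra hφs hφt'' hφt hS hq0 hp hN hζ hσS hσT hζ0
  · exact AK.linearIndependent_monomial hq0 hr hdeg red hred
  · exact AK.span_monomial hq0 hr hdeg red hred
  · refine le_antisymm (Submodule.span_le.2 ?_) fun x hx => ?_
    · rintro _ ⟨m, w, hm, rfl⟩
      change σ _ = AK.monomial (N + 1) p q ζ Λ _ _
      rw [AK.map_monomial hσS hσT, hζ.pow_eq_one_iff_dvd _ |>.2 (Nat.modEq_zero_iff_dvd.1 hm),
        one_smul]
    · have h1 := mem_span_of_fixed hp hζ σ.toLinearMap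
        (fun i => AK.map_monomial hσS hσT _ _) (AK.span_monomial hq0 hr hdeg red hred) hx
      refine Submodule.span_mono ?_ h1
      rintro _ ⟨⟨m, w⟩, hm, rfl⟩
      exact ⟨m, w, Nat.modEq_zero_iff_dvd.2 hm, rfl⟩
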